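/- Let $b>0$, $h\ge 0$, $r\in(0,1]$. Consider the delayed Belousov–Zhabotinsky system, for $t\in\mathbb R$ and $x\in\mathbb R^n$ ($n\ge1$), $$u_t(t,x)=\Delta u(t,x)+u(t,x)\bigl(1-u(t,x)-r\,v(t-h,x)\bigr),\qquad v_t(t,x)=\Delta v(t,x)-b\,u(t,x)v(t,x).$$ The equation $$c=2\max\Bigl\{\sqrt{1-r},\ \frac{\sqrt{b'}}{\sqrt{1+b'}}\Bigr\},\qquad b'=b'(c):=b\,e^{-c^2h/2},$$ has a unique positive root $c_\#=c_\#(r,b,h)$. For every $c\ge c_\#$ there are $C^2$ functions $\phi,\theta:\mathbb R\to(0,\infty)$, with $\phi$ non-decreasing, $\theta$ non-increasing, $(\phi,\theta)(-\infty)=(0,1)$ and $(\phi,\theta)(+\infty)=(1,0)$, such that in every dimension $n$ and for every unit vector $\nu\in\mathbb R^n$ the plane wave $(u,v)(t,x)=(\phi,\theta)(\nu\cdot x+ct)$ is a classical solution of the system (a positive monotone front connecting $(0,1)$ with $(1,0)$), and moreover: (i) if $r=1$ and $c>c_\#$, then, as $t\to-\infty$, $$\phi(t)=\frac{2c^2/b}{t^2}-\frac{8c}{3b}\Bigl(c^2\bigl(1+h+\tfrac1b\bigr)-4\Bigr)\frac{\ln(-t)}{t^3}+O\Bigl(\frac1{t^3}\Bigr),$$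 $$\theta(t)=1+\frac{2c}{t}-\frac43\Bigl(c^2\bigl(1+h+\tfrac1b\bigr)-4\Bigr)\frac{\ln(-t)}{t^2}+O\Bigl(\frac1{t^2}\Bigr);$$ (ii) if $r\in(0,1)$ and $c>2\sqrt{1-r}$, then, with $\lambda:=\tfrac12\bigl(c-\sqrt{c^2-4(1-r)}\bigr)$ and for some $\varepsilon>0$, as $t\to-\infty$, $$\phi(t)=e^{\lambda t}+O\bigl(e^{(\lambda+\varepsilon)t}\bigr),\qquad \theta(t)=1-\frac{b\,e^{\lambda t}}{1-r}+O\bigl(e^{(\lambda+\varepsilon)t}\bigr).$$ -/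

import Mathlib

open Filter Topology Asymptotics

open scoped InnerProductSpace

/-- `(u, v)` is a classical solution, for all times `t ∈ ℝ` and all `x ∈ ℝⁿ`, of the delayed
Belousov-Zhabotinsky system
`u_t(t,x) = Δu(t,x) + u(t,x)(1 - u(t,x) - r v(t-h,x))`,
`v_t(t,x) = Δv(t,x) - b u(t,x) v(t,x)`.
The Laplacian acts on the space variable. -/
structure IsBZSolution {n : ℕ} (r b h : ℝ) (u v : ℝ → EuclideanSpace ℝ (Fin n) → ℝ) : Prop where
  diff_time_u : ∀ x, Differentiable ℝ (fun t => u t x)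
  diff_time_v : ∀ x, Differentiable ℝ (fun t => v t x)
  contDiff_space_u : ∀ t, ContDiff ℝ 2 (u t)
  contDiff_space_v : ∀ t, ContDiff ℝ 2 (v t)
  eq_u : ∀ t x, deriv (fun s => u s x) t
    = Laplacian.laplacian (u t) x + u t x * (1 - u t x - r * v (t - h) x)
  eq_v : ∀ t x, deriv (fun s => v s x) t
    = Laplacian.laplacian (v t) x - b * u t x * v t x

/-- `(φ, θ)` is the profile of a positive monotone front of the delayed Belousov-Zhabotinsky
system, of speed `c`, connecting `(0, 1)` with `(1, 0)`: in every space dimension `n` and for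
every unit vector `ν ∈ ℝⁿ`, the plane wave `(u, v)(t, x) = (φ, θ)(ν · x + c t)` solves the
system. -/
structure IsPositiveMonotoneFront (r b h c : ℝ) (φ θ : ℝ → ℝ) : Prop where
  contDiff_phi : ContDiff ℝ 2 φ
  contDiff_theta : ContDiff ℝ 2 θ
  solution : ∀ (n : ℕ) (ν : EuclideanSpace ℝ (Fin n)), ‖ν‖ = 1 →
    IsBZSolution r b h (fun t x => φ (⟪ν, x⟫_ℝ + c * t)) (fun t x => θ (⟪ν, x⟫_ℝ + c * t))
  phi_pos : ∀ t, 0 < φ t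
  theta_pos : ∀ t, 0 < θ t
  phi_mono : Monotone φ
  theta_anti : Antitone θ
  phi_atBot : Tendsto φ atBot (𝓝 0)
  theta_atBot : Tendsto θ atBot (𝓝 1)
  phi_atTop : Tendsto φ atTop (𝓝 1)
  theta_atTop : Tendsto θ atTop (𝓝 0)

/-- The speed-dependent coefficient `b' = b e^{-c²h/2}`. -/
noncomputable def bPrime (b h c : ℝ) : ℝ := b * Real.exp (-(c ^ 2 * h / 2))

/-- `c` is a positive root of the equation `c = 2 max {√(1-r), √b' / √(1+b')}`, `r ≤ 1`. -/
def IsPositiveRootSharp (r b h c : ℝ) : Prop :=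
  0 < c ∧ c = 2 * max (√(1 - r)) (√(bPrime b h c) / √(1 + bPrime b h c))

/-- The smaller root `λ` of the characteristic equation `z² - c z + (1 - r) = 0`. -/
noncomputable def lam (r c : ℝ) : ℝ := (c - √(c ^ 2 - 4 * (1 - r))) / 2

/-- The algebraic/logarithmic asymptotics of the profile at `-∞` in the critical case `r = 1`. -/
def HasAlgebraicAsymptotics (b h c : ℝ) (φ θ : ℝ → ℝ) : Prop :=
  ((fun t => φ t - ((2 * c ^ 2 / b) / t ^ 2
      - 8 * c / (3 * b) * (c ^ 2 * (1 + h + 1 / b) - 4) * (Real.log (-t) / t ^ 3)))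
    =O[atBot] fun t : ℝ => 1 / t ^ 3) ∧
  ((fun t => θ t - (1 + 2 * c / t
      - 4 / 3 * (c ^ 2 * (1 + h + 1 / b) - 4) * (Real.log (-t) / t ^ 2)))
    =O[atBot] fun t : ℝ => 1 / t ^ 2)

/-- The exponential asymptotics of the profile at `-∞` in the case `r < 1`. -/
def HasExponentialAsymptotics (r b c : ℝ) (φ θ : ℝ → ℝ) : Prop :=
  ∃ ε : ℝ, 0 < ε ∧
    ((fun t => φ t - Real.exp (lam r c * t))
      =O[atBot] fun t => Real.exp ((lam r c + ε) * t)) ∧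
    ((fun t => θ t - (1 - b * Real.exp (lam r c * t) / (1 - r)))
      =O[atBot] fun t => Real.exp ((lam r c + ε) * t))

/-! With `ψ = 1 - θ` and wave coordinate `ν · x + c t`, the system becomes `φ'' - c φ' + φ (1 - r -
φ + r ψ(t - c h)) = 0`, `ψ'' - c ψ' + b φ (1 - ψ) = 0`, which is cooperative on `[0, 1]²`: after
adding `β φ` and `β ψ`, with `β` large, both reaction terms are non-decreasing in both unknowns.
Inverting `y'' - c y' - β y` by its positive kernel (`green`) turns the problem into a fixed-point
equation for an order-preserving map. Iteration from an upper solution decreases to a monotone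
profile above a given lower solution (`exists_isProfile`). Monotone limits are equilibria, so a
nontrivial profile vanishing at `-∞` must tend to `(1, 1)` at `+∞`
(`IsProfile.isPositiveMonotoneFront`).

Everything thus reduces to ordered upper and lower solutions with the same expansion at `-∞`.
`exists_profile_of_local` needs them only near `-∞`. It perturbs them by `± (A, 1) κ e^{μ (t - T)}`
with `μ` slightly above `c / 2`, which is smaller than the retained error terms, and caps the upper
one by `(c² / (4 b), 1) κ e^{c (t - T) / 2}` and then by `1`. The pair `(c² / (4 b), 1) e^{c t / 2}`
solves the second equation linearized at zero. Passing from `t` to `t - c h` multiplies it by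
`e^{-c² h / 2}`, so the first inequality becomes `1 ≤ (c² / 4) (1 + 1 / b')`, the second half of the
condition `c ≥ c_#`. The first half is `1 - r ≤ c² / 4`.

The local pairs are as follows. If `r < 1` and `c > 2 √(1 - r)`, they are combinations of `e^{λ t}`
and `e^{s t}` with `s` slightly larger than `λ` (`exists_profile_exponential`). If `r = 1`, the zero
root leads to a slow solution `ψ' = ψ² / (2 c + a ψ - M ψ²)`, with `φ` a cubic polynomial in `ψ`.
The coefficients are fixed by cancelling the first residuals, and the sign of a large `M` selects an
upper or a lower solution (`exists_profile_algebraic`).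

The remaining speed `c = 2 √(1 - r)`, `r < 1`, is reached by compactness from larger speeds
(`exists_profile_critical`). The uniform bound `ψ ≤ K φ` prevents the limit from having a nonzero
`ψ(-∞)` (`IsProfile.psi_le_mul_phi`). -/

section BZFronts

open MeasureTheory Set

/-! ### One-sided Laplace transforms. -/

/-- The Laplace transform of `g` at `a`. -/
noncomputable def laplaceTransform (a : ℝ) (g : ℝ → ℝ) : ℝ := ∫ s in Ioi (0 : ℝ), Real.exp (-a * s) * g s

theorem integrableOn_laplaceTransform {a M : ℝ} {g : ℝ → ℝ} (ha : 0 < a) (hg : Continuous g)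
    (hM : ∀ s, |g s| ≤ M) : IntegrableOn (fun s => Real.exp (-a * s) * g s) (Ioi 0) := by
  refine Integrable.mono' ((exp_neg_integrableOn_Ioi 0 ha).mul_const M) ?_ ?_
  · exact (Continuous.aestronglyMeasurable (by fun_prop))
  · refine Eventually.of_forall fun s => ?_
    rw [norm_mul, Real.norm_eq_abs, Real.abs_exp, Real.norm_eq_abs]
    exact mul_le_mul_of_nonneg_left (hM s) (Real.exp_pos _).le

theorem laplaceTransform_mono {a M N : ℝ} {f g : ℝ → ℝ} (ha : 0 < a) (hf : Continuous f)
    (hg : Continuous g) (hM : ∀ s, |f s| ≤ M) (hN : ∀ s, |g s| ≤ N) (hfg : ∀ s, f s ≤ g s) :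
    laplaceTransform a f ≤ laplaceTransform a g :=
  integral_mono (integrableOn_laplaceTransform ha hf hM) (integrableOn_laplaceTransform ha hg hN)
    fun s => mul_le_mul_of_nonneg_left (hfg s) (Real.exp_pos _).le

theorem laplaceTransform_const {a : ℝ} (ha : 0 < a) (k : ℝ) :
    laplaceTransform a (fun _ => k) = k / a := by
  unfold laplaceTransform
  rw [integral_mul_const, integral_exp_mul_Ioi (by linarith)]
  simp
  ring

/-- Dominated convergence with majorant `e^{-a₀ s} M`. The rate varies along with the function
because the speed, and with it the kernel, will vary. -/
theorem tendsto_laplaceTransform {ι : Type*} {l : Filter ι} [l.IsCountablyGenerated]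
    {a : ι → ℝ} {a₀ a₁ M : ℝ} {g : ι → ℝ → ℝ} {g₁ : ℝ → ℝ} (ha₀ : 0 < a₀) (ha : ∀ i, a₀ ≤ a i)
    (ha₁ : Tendsto a l (𝓝 a₁)) (hg : ∀ i, Continuous (g i)) (hM : ∀ i s, |g i s| ≤ M)
    (hg₁ : ∀ s, Tendsto (fun i => g i s) l (𝓝 (g₁ s))) :
    Tendsto (fun i => laplaceTransform (a i) (g i)) l (𝓝 (laplaceTransform a₁ g₁)) := by
  refine tendsto_integral_filter_of_dominated_convergence (fun s => Real.exp (-a₀ * s) * M)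
    (Eventually.of_forall fun i => Continuous.aestronglyMeasurable ?_)
    (Eventually.of_forall fun i => ?_) ((exp_neg_integrableOn_Ioi 0 ha₀).mul_const M) ?_
  · have := hg i
    fun_prop
  · filter_upwards [ae_restrict_mem measurableSet_Ioi] with s hs
    rw [norm_mul, Real.norm_eq_abs, Real.abs_exp, Real.norm_eq_abs]
    have hs' : 0 < s := hs
    refine mul_le_mul (Real.exp_le_exp.2 ?_) (hM i s) (abs_nonneg _) (Real.exp_pos _).le
    nlinarith [ha i]
  · refine Eventually.of_forall fun s => ?_
    refine Tendsto.mul ?_ (hg₁ s)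
    exact (Real.continuous_exp.tendsto _).comp ((ha₁.neg).mul_const s)

theorem abs_laplaceTransform_le {a M : ℝ} {g : ℝ → ℝ} (ha : 0 < a) (hg : Continuous g)
    (hM : ∀ s, |g s| ≤ M) : |laplaceTransform a g| ≤ M / a := by
  have hM0 : 0 ≤ M := (abs_nonneg _).trans (hM 0)
  rw [abs_le]
  constructor
  · rw [← neg_div, ← laplaceTransform_const ha]
    exact laplaceTransform_mono (M := |-M|) ha continuous_const hg (fun _ => le_rfl) hM
      fun s => (abs_le.1 (hM s)).1
  · rw [← laplaceTransform_const ha]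
    exact laplaceTransform_mono (N := |M|) ha hg continuous_const hM (fun _ => le_rfl)
      fun s => (abs_le.1 (hM s)).2

theorem hasDerivAt_integral_Iic {g : ℝ → ℝ} (hg : Continuous g)
    (hi : ∀ t, IntegrableOn g (Iic t)) (t : ℝ) :
    HasDerivAt (fun t => ∫ u in Iic t, g u) (g t) t := by
  have h : (fun t => ∫ u in Iic t, g u) = fun t => (∫ u in Iic 0, g u) + ∫ u in (0 : ℝ)..t, g u := by
    ext t
    rw [← intervalIntegral.integral_Iic_sub_Iic (hi 0) (hi t)]
    ring
  rw [h]
  exact (hg.integral_hasStrictDerivAt 0 t).hasDerivAt.const_add _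

/-- Substituting `u = t - s` moves the dependence on `t` out of the integrand, so that a merely
continuous `F` can be handled by the fundamental theorem of calculus. -/
theorem laplaceTransform_backward_eq (a : ℝ) (F : ℝ → ℝ) (t : ℝ) :
    laplaceTransform a (fun s => F (t - s))
      = Real.exp (-a * t) * ∫ u in Iic t, Real.exp (a * u) * F u := by
  have hp := (Measure.measurePreserving_sub_left volume t).setIntegral_preimage_emb
    (MeasurableEquiv.subLeft t).measurableEmbedding
    (fun u => Real.exp (-a * (t - u)) * F u) (Iio t)
  have hs : (fun x => t - x) ⁻¹' Iio t = Ioi 0 := by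
    ext x; simp
  rw [hs] at hp
  unfold laplaceTransform
  rw [integral_Iic_eq_integral_Iio, ← integral_const_mul]
  simp only [sub_sub_cancel] at hp
  rw [hp]
  refine integral_congr_ae (Eventually.of_forall fun u => ?_)
  simp only
  rw [← mul_assoc, ← Real.exp_add]
  ring_nf

theorem hasDerivAt_laplaceTransform_backward {a M : ℝ} {F : ℝ → ℝ} (ha : 0 < a) (hF : Continuous F)
    (hM : ∀ s, |F s| ≤ M) (t : ℝ) :
    HasDerivAt (fun t => laplaceTransform a (fun s => F (t - s)))
      (F t - a * laplaceTransform a (fun s => F (t - s))) t := by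
  have hi : ∀ t, IntegrableOn (fun u => Real.exp (a * u) * F u) (Iic t) := by
    intro t
    refine Integrable.mono' ((integrableOn_exp_mul_Iic ha t).mul_const M) ?_ ?_
    · exact (Continuous.aestronglyMeasurable (by fun_prop))
    · refine Eventually.of_forall fun s => ?_
      rw [norm_mul, Real.norm_eq_abs, Real.abs_exp, Real.norm_eq_abs]
      exact mul_le_mul_of_nonneg_left (hM s) (Real.exp_pos _).le
  simp only [laplaceTransform_backward_eq]
  have h1 := hasDerivAt_integral_Iic (g := fun u => Real.exp (a * u) * F u) (by fun_prop) hi t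
  have h2 : HasDerivAt (fun t : ℝ => Real.exp (-a * t)) (Real.exp (-a * t) * -a) t := by
    simpa using ((hasDerivAt_id t).const_mul (-a)).exp
  refine (h2.mul h1).congr_deriv ?_
  have : Real.exp (-a * t) * (Real.exp (a * t) * F t) = F t := by
    rw [← mul_assoc, ← Real.exp_add]; simp
  rw [this]; ring

theorem hasDerivAt_laplaceTransform_forward {a M : ℝ} {F : ℝ → ℝ} (ha : 0 < a) (hF : Continuous F)
    (hM : ∀ s, |F s| ≤ M) (t : ℝ) :
    HasDerivAt (fun t => laplaceTransform a (fun s => F (t + s)))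
      (a * laplaceTransform a (fun s => F (t + s)) - F t) t := by
  have h := hasDerivAt_laplaceTransform_backward (F := fun u => F (-u)) ha (by fun_prop)
    (fun s => hM (-s)) (-t)
  have h' := h.comp t (hasDerivAt_neg t)
  have e : ∀ t, laplaceTransform a (fun s => F (-(-t - s))) = laplaceTransform a (fun s => F (t + s)) := by
    intro t; congr 1; ext s; congr 1; ring
  simp only [Function.comp_def, e, neg_neg] at h'
  refine h'.congr_deriv ?_
  ring

/-! ### The Green operator of `y'' - c y' - β y`. -/

/-- The absolute value of the negative root of `z² - c z - β = 0`. -/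
noncomputable def backwardRate (c β : ℝ) : ℝ := (√(c ^ 2 + 4 * β) - c) / 2

/-- The positive root of `z² - c z - β = 0`. -/
noncomputable def forwardRate (c β : ℝ) : ℝ := (√(c ^ 2 + 4 * β) + c) / 2

/-- The bounded solution of `y'' - c y' - β y = -F`. -/
noncomputable def green (c β : ℝ) (F : ℝ → ℝ) (t : ℝ) : ℝ :=
  (laplaceTransform (backwardRate c β) (fun s => F (t - s))
    + laplaceTransform (forwardRate c β) (fun s => F (t + s))) / √(c ^ 2 + 4 * β)

/-- The derivative of `green`. -/
noncomputable def greenDeriv (c β : ℝ) (F : ℝ → ℝ) (t : ℝ) : ℝ :=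
  (forwardRate c β * laplaceTransform (forwardRate c β) (fun s => F (t + s))
    - backwardRate c β * laplaceTransform (backwardRate c β) (fun s => F (t - s))) / √(c ^ 2 + 4 * β)

section rates

variable {c β : ℝ}

theorem sqrt_rate_sq (hβ : 0 < β) : √(c ^ 2 + 4 * β) ^ 2 = c ^ 2 + 4 * β :=
  Real.sq_sqrt (by positivity)

theorem abs_lt_sqrt_rate (hβ : 0 < β) : |c| < √(c ^ 2 + 4 * β) := by
  rw [← Real.sqrt_sq_eq_abs]
  exact Real.sqrt_lt_sqrt (sq_nonneg c) (by linarith)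

theorem backwardRate_pos (hβ : 0 < β) : 0 < backwardRate c β := by
  have := (abs_lt.1 (abs_lt_sqrt_rate (c := c) hβ)).2
  unfold backwardRate; linarith

theorem forwardRate_pos (hβ : 0 < β) : 0 < forwardRate c β := by
  have := (abs_lt.1 (abs_lt_sqrt_rate (c := c) hβ)).1
  unfold forwardRate; linarith

theorem sqrt_rate_pos (hβ : 0 < β) : 0 < √(c ^ 2 + 4 * β) := Real.sqrt_pos.2 (by positivity)

end rates

section green

variable {c β M N : ℝ} {F G : ℝ → ℝ}

theorem hasDerivAt_green (hβ : 0 < β) (hF : Continuous F) (hM : ∀ s, |F s| ≤ M) (t : ℝ) :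
    HasDerivAt (green c β F) (greenDeriv c β F t) t := by
  have h1 := hasDerivAt_laplaceTransform_backward (backwardRate_pos (c := c) hβ) hF hM t
  have h2 := hasDerivAt_laplaceTransform_forward (forwardRate_pos (c := c) hβ) hF hM t
  refine ((h1.add h2).div_const _).congr_deriv ?_
  unfold greenDeriv; ring

theorem hasDerivAt_greenDeriv (hβ : 0 < β) (hF : Continuous F) (hM : ∀ s, |F s| ≤ M) (t : ℝ) :
    HasDerivAt (greenDeriv c β F) (c * greenDeriv c β F t + β * green c β F t - F t) t := by
  have h1 := hasDerivAt_laplaceTransform_backward (backwardRate_pos (c := c) hβ) hF hM t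
  have h2 := hasDerivAt_laplaceTransform_forward (forwardRate_pos (c := c) hβ) hF hM t
  refine (((h2.const_mul (forwardRate c β)).sub (h1.const_mul (backwardRate c β))).div_const
    _).congr_deriv ?_
  have hS := sqrt_rate_pos (c := c) hβ
  have hS2 := sqrt_rate_sq (c := c) hβ
  unfold greenDeriv green
  generalize laplaceTransform (backwardRate c β) (fun s => F (t - s)) = A
  generalize laplaceTransform (forwardRate c β) (fun s => F (t + s)) = B
  unfold forwardRate backwardRate
  generalize √(c ^ 2 + 4 * β) = S at *
  field_simp
  have : β = (S ^ 2 - c ^ 2) / 4 := by linarith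
  subst this
  ring

theorem continuous_green (hβ : 0 < β) (hF : Continuous F) (hM : ∀ s, |F s| ≤ M) :
    Continuous (green c β F) :=
  continuous_iff_continuousAt.2 fun t => (hasDerivAt_green hβ hF hM t).continuousAt

theorem contDiff_green (hβ : 0 < β) (hF : Continuous F) (hM : ∀ s, |F s| ≤ M) :
    ContDiff ℝ 2 (green c β F) := by
  have h1 := fun t => hasDerivAt_green (c := c) hβ hF hM t
  have h2 := fun t => hasDerivAt_greenDeriv (c := c) hβ hF hM t
  have e1 : deriv (green c β F) = greenDeriv c β F := funext fun t => (h1 t).deriv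
  have e2 : deriv (greenDeriv c β F) = fun t => c * greenDeriv c β F t + β * green c β F t - F t :=
    funext fun t => (h2 t).deriv
  have c0 : Continuous (green c β F) := continuous_green hβ hF hM
  have c1 : Continuous (greenDeriv c β F) :=
    continuous_iff_continuousAt.2 fun t => (h2 t).continuousAt
  rw [show (2 : WithTop ℕ∞) = 1 + 1 by norm_num, contDiff_succ_iff_deriv]
  refine ⟨fun t => (h1 t).differentiableAt, by simp, ?_⟩
  rw [e1, contDiff_one_iff_deriv, e2]
  exact ⟨fun t => (h2 t).differentiableAt, by fun_prop⟩

/-- The two base points serve two purposes: `t = u` gives order preservation, and `F = G` with `t ≤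
u` gives preservation of monotonicity. -/
theorem green_mono (hβ : 0 < β) (hF : Continuous F) (hG : Continuous G) (hM : ∀ s, |F s| ≤ M)
    (hN : ∀ s, |G s| ≤ N) {t u : ℝ} (hFG : ∀ s, F (t + s) ≤ G (u + s)) :
    green c β F t ≤ green c β G u := by
  refine div_le_div_of_nonneg_right (add_le_add ?_ ?_) (Real.sqrt_nonneg _)
  · exact laplaceTransform_mono (backwardRate_pos hβ) (by fun_prop) (by fun_prop) (fun s => hM _)
      (fun s => hN _) (fun s => by simpa [sub_eq_add_neg] using hFG (-s))
  · exact laplaceTransform_mono (forwardRate_pos hβ) (by fun_prop) (by fun_prop) (fun s => hM _)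
      (fun s => hN _) (fun s => hFG s)

theorem green_const (hβ : 0 < β) (k t : ℝ) : green c β (fun _ => k) t = k / β := by
  have hS := sqrt_rate_pos (c := c) hβ
  have hS2 := sqrt_rate_sq (c := c) hβ
  have h1 := backwardRate_pos (c := c) hβ
  have h2 := forwardRate_pos (c := c) hβ
  unfold green
  rw [laplaceTransform_const h1, laplaceTransform_const h2]
  have e : backwardRate c β * forwardRate c β = β := by
    unfold backwardRate forwardRate; nlinarith
  have e2 : backwardRate c β + forwardRate c β = √(c ^ 2 + 4 * β) := by
    unfold backwardRate forwardRate; ring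
  rw [← e2]
  nth_rewrite 5 [← e]
  field_simp
  ring

theorem abs_greenDeriv_le (hβ : 0 < β) (hF : Continuous F) (hM : ∀ s, |F s| ≤ M) (t : ℝ) :
    |greenDeriv c β F t| ≤ 2 * M / √(c ^ 2 + 4 * β) := by
  have h1 := backwardRate_pos (c := c) hβ
  have h2 := forwardRate_pos (c := c) hβ
  have hS := sqrt_rate_pos (c := c) hβ
  have a1 := abs_laplaceTransform_le h1 (g := fun s => F (t - s)) (by fun_prop) (fun s => hM _)
  have a2 := abs_laplaceTransform_le h2 (g := fun s => F (t + s)) (by fun_prop) (fun s => hM _)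
  unfold greenDeriv
  rw [abs_div, abs_of_pos hS]
  refine div_le_div_of_nonneg_right ((abs_sub _ _).trans ?_) hS.le
  rw [abs_mul, abs_mul, abs_of_pos h1, abs_of_pos h2]
  rw [le_div_iff₀ h1] at a1
  rw [le_div_iff₀ h2] at a2
  linarith

theorem abs_green_sub_le (hβ : 0 < β) (hF : Continuous F) (hM : ∀ s, |F s| ≤ M) (t u : ℝ) :
    |green c β F t - green c β F u| ≤ 2 * M / √(c ^ 2 + 4 * β) * |t - u| := by
  have := Convex.norm_image_sub_le_of_norm_hasDerivWithin_le (s := univ) (f := green c β F)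
    (fun x _ => (hasDerivAt_green hβ hF hM x).hasDerivWithinAt)
    (fun x _ => abs_greenDeriv_le (c := c) hβ hF hM x) convex_univ (mem_univ u) (mem_univ t)
  simpa using this

theorem tendsto_green {ι : Type*} {l : Filter ι} [l.IsCountablyGenerated]
    {c : ι → ℝ} {c₁ t₁ : ℝ} {F : ι → ℝ → ℝ} {F₁ : ℝ → ℝ} {t : ι → ℝ} (hβ : 0 < β) {C : ℝ}
    (hc0 : ∀ i, 0 ≤ c i) (hcC : ∀ i, c i ≤ C) (hc : Tendsto c l (𝓝 c₁))
    (hF : ∀ i, Continuous (F i)) (hM : ∀ i s, |F i s| ≤ M)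
    (hF₁ : ∀ s, Tendsto (fun i => F i (t i + s)) l (𝓝 (F₁ (t₁ + s)))) :
    Tendsto (fun i => green (c i) β (F i) (t i)) l (𝓝 (green c₁ β F₁ t₁)) := by
  have hS : Tendsto (fun i => √(c i ^ 2 + 4 * β)) l (𝓝 (√(c₁ ^ 2 + 4 * β))) :=
    ((hc.pow 2).add_const _).sqrt
  have hbR : Tendsto (fun i => backwardRate (c i) β) l (𝓝 (backwardRate c₁ β)) :=
    (hS.sub hc).div_const _
  have hfR : Tendsto (fun i => forwardRate (c i) β) l (𝓝 (forwardRate c₁ β)) :=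
    (hS.add hc).div_const _
  -- The backward rate decreases with the speed, so its value at the largest speed `C` is a uniform
  -- positive lower bound.
  have key : ∀ i, backwardRate C β ≤ backwardRate (c i) β := by
    intro i
    have h0 := hc0 i
    have h1 := hcC i
    have hS1 := sqrt_rate_pos (c := c i) hβ
    have hS2 := sqrt_rate_pos (c := C) hβ
    have q1 := sqrt_rate_sq (c := c i) hβ
    have q2 := sqrt_rate_sq (c := C) hβ
    have p1 := (abs_lt.1 (abs_lt_sqrt_rate (c := c i) hβ)).2
    unfold backwardRate
    have : √(C ^ 2 + 4 * β) ≤ √(c i ^ 2 + 4 * β) + (C - c i) := by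
      refine abs_le_of_sq_le_sq' ?_ (by linarith) |>.2
      rw [q2]; nlinarith
    linarith
  have key2 : ∀ i, √(4 * β) / 2 ≤ forwardRate (c i) β := by
    intro i
    have : √(4 * β) ≤ √(c i ^ 2 + 4 * β) := Real.sqrt_le_sqrt (by nlinarith [sq_nonneg (c i)])
    unfold forwardRate; linarith [hc0 i]
  refine Tendsto.div (Tendsto.add ?_ ?_) hS (sqrt_rate_pos hβ).ne'
  · refine tendsto_laplaceTransform (M := M) (backwardRate_pos (c := C) hβ) key hbR (fun i => ?_)
      (fun i s => hM i _) (fun s => by simpa [sub_eq_add_neg] using hF₁ (-s))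
    exact (hF i).comp (by fun_prop)
  · refine tendsto_laplaceTransform (M := M) (a₀ := √(4 * β) / 2) (by positivity) key2 hfR
      (fun i => ?_) (fun i s => hM i _) hF₁
    exact (hF i).comp (by fun_prop)

theorem green_sub (hβ : 0 < β) (hF : Continuous F) (hG : Continuous G) (hM : ∀ s, |F s| ≤ M)
    (hN : ∀ s, |G s| ≤ N) (t : ℝ) :
    green c β (fun s => F s - G s) t = green c β F t - green c β G t := by
  have key : ∀ a, 0 < a → ∀ f g : ℝ → ℝ, Continuous f → Continuous g → (∀ s, |f s| ≤ M) →
      (∀ s, |g s| ≤ N) → laplaceTransform a (fun s => f s - g s)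
        = laplaceTransform a f - laplaceTransform a g := by
    intro a ha f g hf hg h1 h2
    unfold laplaceTransform
    rw [← integral_sub (integrableOn_laplaceTransform ha hf h1)
      (integrableOn_laplaceTransform ha hg h2)]
    simp only [mul_sub]
  unfold green
  rw [key _ (backwardRate_pos hβ) (fun s => F (t - s)) (fun s => G (t - s)) (by fun_prop)
    (by fun_prop) (fun s => hM _) (fun s => hN _), key _ (forwardRate_pos hβ) (fun s => F (t + s))
    (fun s => G (t + s)) (by fun_prop) (by fun_prop) (fun s => hM _) (fun s => hN _)]
  ring

theorem eqOn_zero_of_laplaceTransform_eq_zero {a : ℝ} (ha : 0 < a) (hF : Continuous F)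
    (hM : ∀ s, |F s| ≤ M) (h0 : ∀ s, 0 ≤ F s) (hz : laplaceTransform a F = 0) {s : ℝ}
    (hs : 0 < s) : F s = 0 := by
  have e4 := (setIntegral_eq_zero_iff_of_nonneg_ae
    (Eventually.of_forall fun s => mul_nonneg (Real.exp_pos _).le (h0 _))
    (integrableOn_laplaceTransform ha hF hM)).1 hz
  have e5 : EqOn (fun s => Real.exp (-a * s) * F s) 0 (Ioi 0) :=
    Measure.eqOn_open_of_ae_eq e4 isOpen_Ioi (by fun_prop) (by fun_prop)
  simpa using e5 hs

/-- A strong maximum principle: the kernel is strictly positive, so the source vanishes on both open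
half-lines at `t`. -/
theorem eq_zero_of_green_eq_zero (hβ : 0 < β) (hF : Continuous F) (hM : ∀ s, |F s| ≤ M)
    (h0 : ∀ s, 0 ≤ F s) {t : ℝ} (ht : green c β F t = 0) {s : ℝ} (hs : s ≠ t) : F s = 0 := by
  have h1 := backwardRate_pos (c := c) hβ
  have h2 := forwardRate_pos (c := c) hβ
  have hS := sqrt_rate_pos (c := c) hβ
  have hz : ∀ a, ∀ g : ℝ → ℝ, (∀ s, 0 ≤ g s) → 0 ≤ laplaceTransform a g := fun a g hg =>
    integral_nonneg fun s => mul_nonneg (Real.exp_pos _).le (hg s)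
  have e1 := hz (backwardRate c β) (fun s => F (t - s)) (fun s => h0 _)
  have e2 := hz (forwardRate c β) (fun s => F (t + s)) (fun s => h0 _)
  unfold green at ht
  rw [div_eq_zero_iff, or_iff_left hS.ne'] at ht
  rcases hs.lt_or_gt with hs | hs
  · simpa using eqOn_zero_of_laplaceTransform_eq_zero h1 (F := fun s => F (t - s)) (by fun_prop)
      (fun s => hM _) (fun s => h0 _) (by linarith) (sub_pos.2 hs)
  · simpa using eqOn_zero_of_laplaceTransform_eq_zero h2 (F := fun s => F (t + s)) (by fun_prop)
      (fun s => hM _) (fun s => h0 _) (by linarith) (sub_pos.2 hs)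

end green

/-! ### Maximum principle and comparison with nonsmooth sub- and supersolutions. -/

/-- If `v2 > 0`, the second-derivative test makes `t₀` also a local minimum; then `V` is constant
near `t₀`, which forces `v2 = 0`. -/
theorem IsLocalMax.second_derivative_nonpos {V V1 : ℝ → ℝ} {v2 t₀ : ℝ} (hmax : IsLocalMax V t₀)
    (h1 : ∀ᶠ t in 𝓝 t₀, HasDerivAt V (V1 t) t) (h2 : HasDerivAt V1 v2 t₀) :
    V1 t₀ = 0 ∧ v2 ≤ 0 := by
  have hz : V1 t₀ = 0 := hmax.hasDerivAt_eq_zero h1.self_of_nhds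
  refine ⟨hz, ?_⟩
  by_contra! hpos
  have hd : deriv V =ᶠ[𝓝 t₀] V1 := h1.mono fun t ht => ht.deriv
  have hdd : deriv (deriv V) t₀ = v2 := by rw [hd.deriv_eq, h2.deriv]
  have hmin := isLocalMin_of_deriv_deriv_pos (by rw [hdd]; exact hpos)
    (by rw [hd.self_of_nhds, hz]) h1.self_of_nhds.continuousAt
  have hc : V =ᶠ[𝓝 t₀] fun _ => V t₀ := by
    filter_upwards [hmax, hmin] with t ha hb using le_antisymm ha hb
  have hc1 : V1 =ᶠ[𝓝 t₀] fun _ => 0 := by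
    filter_upwards [hc.eventuallyEq_nhds, hd] with t ha hb
    rw [← hb, ha.deriv_eq, deriv_const]
  have := h2.unique ((hasDerivAt_const t₀ (0 : ℝ)).congr_of_eventuallyEq hc1)
  linarith

/-- A maximum principle on the line for `W'' - c W' - β W ≥ 0`, where the inequality is
tested on functions that touch `W` from below. -/
theorem nonpos_of_touching {c β M : ℝ} (hc : 0 ≤ c) (hβ : 2 + c ≤ β) {W : ℝ → ℝ}
    (hW : Continuous W) (hM : ∀ t, W t ≤ M)
    (H : ∀ t₀, 0 < W t₀ → ∃ V V1 : ℝ → ℝ, ∃ v2 : ℝ, (∀ᶠ t in 𝓝 t₀, V t ≤ W t) ∧ V t₀ = W t₀ ∧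
      (∀ᶠ t in 𝓝 t₀, HasDerivAt V (V1 t) t) ∧ HasDerivAt V1 v2 t₀ ∧
      β * W t₀ ≤ v2 - c * V1 t₀) (t : ℝ) : W t ≤ 0 := by
  by_contra! ht
  have hgt : 0 < 1 + t ^ 2 := by positivity
  -- Penalizing by `ε (1 + s²)` makes the supremum attained on the noncompact line while keeping it
  -- positive.
  obtain ⟨ε, hε, hεt⟩ : ∃ ε, 0 < ε ∧ ε * (1 + t ^ 2) < W t :=
    ⟨W t / (2 * (1 + t ^ 2)), by positivity, by field_simp; linarith⟩
  have hlim : Tendsto (fun s : ℝ => M - ε * (1 + s ^ 2)) (cocompact ℝ) atBot := by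
    have h0 : Tendsto (fun s : ℝ => s ^ 2) (cocompact ℝ) atTop := by
      have := (tendsto_pow_atTop (α := ℝ) two_ne_zero).comp (tendsto_norm_cocompact_atTop (E := ℝ))
      refine this.congr fun s => ?_
      simp
    have h1 : Tendsto (fun s : ℝ => ε * (1 + s ^ 2)) (cocompact ℝ) atTop :=
      (tendsto_atTop_add_const_left _ 1 h0).const_mul_atTop hε
    simpa [sub_eq_add_neg] using
      tendsto_atBot_add_const_left _ M (tendsto_neg_atTop_atBot.comp h1)
  obtain ⟨t₀, ht₀⟩ := Continuous.exists_forall_ge' (f := fun s => W s - ε * (1 + s ^ 2))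
    (by fun_prop) t ((hlim.eventually_le_atBot (W t - ε * (1 + t ^ 2))).mono fun s hs =>
      le_trans (by linarith [hM s]) hs)
  have hpos : 0 < W t₀ - ε * (1 + t₀ ^ 2) := lt_of_lt_of_le (by linarith) (ht₀ t)
  obtain ⟨V, V1, v2, hV, hV0, hd1, hd2, hle⟩ := H t₀ (lt_trans (by positivity) (sub_pos.1 hpos))
  have hmax : IsLocalMax (fun s => V s - ε * (1 + s ^ 2)) t₀ := by
    filter_upwards [hV] with s hs
    have := ht₀ s
    rw [hV0]; linarith
  obtain ⟨e1, e2⟩ := hmax.second_derivative_nonpos (V1 := fun s => V1 s - ε * (2 * s))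
    (v2 := v2 - ε * 2)
    (hd1.mono fun s hs => hs.sub ((((hasDerivAt_pow 2 s).const_add 1).const_mul ε).congr_deriv
      (by simp)))
    (hd2.sub ((((hasDerivAt_id t₀).const_mul 2).const_mul ε).congr_deriv (by simp)))
  -- At the maximum, `β W ≤ 2 ε - 2 c ε t₀`. This square gives `-2 c t₀ ≤ c (1 + t₀²)`, so the bound
  -- is at most `(2 + c) ε (1 + t₀²) ≤ β ε (1 + t₀²)`, contradicting `W > ε (1 + t₀²)`.
  have hg : 0 ≤ c * (1 + t₀) ^ 2 := by positivity
  nlinarith [mul_le_mul_of_nonneg_right hβ (show 0 ≤ ε * (1 + t₀ ^ 2) by positivity),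
    mul_nonneg hε.le hg, mul_pos (show 0 < β by linarith) hpos, mul_nonneg hε.le hc, mul_nonneg hε.le (mul_nonneg hc (sq_nonneg t₀)), mul_nonneg hε.le (sq_nonneg t₀)]

/-- `U'' - c U' + n ≤ 0` at `t₀`, tested on a function that touches `U` from above. -/
def IsSuperAt (c : ℝ) (U : ℝ → ℝ) (n t₀ : ℝ) : Prop :=
  ∃ V V1 : ℝ → ℝ, ∃ v2 : ℝ, (∀ᶠ t in 𝓝 t₀, U t ≤ V t) ∧ U t₀ = V t₀ ∧
    (∀ᶠ t in 𝓝 t₀, HasDerivAt V (V1 t) t) ∧ HasDerivAt V1 v2 t₀ ∧ v2 - c * V1 t₀ + n ≤ 0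

/-- `U'' - c U' + n ≥ 0` at `t₀`, tested on a function that touches `U` from below. -/
def IsSubAt (c : ℝ) (U : ℝ → ℝ) (n t₀ : ℝ) : Prop :=
  ∃ V V1 : ℝ → ℝ, ∃ v2 : ℝ, (∀ᶠ t in 𝓝 t₀, V t ≤ U t) ∧ U t₀ = V t₀ ∧
    (∀ᶠ t in 𝓝 t₀, HasDerivAt V (V1 t) t) ∧ HasDerivAt V1 v2 t₀ ∧ 0 ≤ v2 - c * V1 t₀ + n

section comparison

variable {c β M N : ℝ} {F U n : ℝ → ℝ}

theorem abs_green_le (hβ : 0 < β) (hF : Continuous F) (hM : ∀ s, |F s| ≤ M) (t : ℝ) :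
    |green c β F t| ≤ M / β := by
  rw [abs_le, ← neg_div, ← green_const (c := c) hβ (-M) t, ← green_const (c := c) hβ M t]
  exact ⟨green_mono hβ continuous_const hF (fun _ => le_rfl) hM fun s => (abs_le.1 (hM _)).1,
    green_mono hβ hF continuous_const hM (fun _ => le_rfl) fun s => (abs_le.1 (hM _)).2⟩

/-- Since `green'' - c green' = β green - F`, subtracting the inequality for the test function shows
that `W = green - U` satisfies `β W ≤ W'' - c W'` in the touching sense. -/
theorem green_le_of_isSuperAt (hc : 0 ≤ c) (hβ : 2 + c ≤ β) (hF : Continuous F)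
    (hM : ∀ s, |F s| ≤ M) (hU : Continuous U) (hN : ∀ t, |U t| ≤ N)
    (hn : ∀ t, F t ≤ β * U t + n t) (hs : ∀ t, IsSuperAt c U (n t) t) (t : ℝ) :
    green c β F t ≤ U t := by
  have hβ0 : 0 < β := by linarith
  refine sub_nonpos.1 (nonpos_of_touching (M := M / β + N) hc hβ (W := fun t => green c β F t - U t)
    ((continuous_green hβ0 hF hM).sub hU) (fun t => ?_) (fun t₀ _ => ?_) t)
  · have h1 := (abs_le.1 (abs_green_le (c := c) hβ0 hF hM t)).2
    have h2 := (abs_le.1 (hN t)).1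
    linarith
  · obtain ⟨V, V1, v2, hV, hV0, hd1, hd2, hle⟩ := hs t₀
    refine ⟨fun t => green c β F t - V t, fun t => greenDeriv c β F t - V1 t, _,
      hV.mono fun t ht => by linarith, by simp only [hV0],
      hd1.mono fun t ht => (hasDerivAt_green hβ0 hF hM t).sub ht,
      (hasDerivAt_greenDeriv hβ0 hF hM t₀).sub hd2, ?_⟩
    linarith [hn t₀]

theorem le_green_of_isSubAt (hc : 0 ≤ c) (hβ : 2 + c ≤ β) (hF : Continuous F)
    (hM : ∀ s, |F s| ≤ M) (hU : Continuous U) (hN : ∀ t, |U t| ≤ N)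
    (hn : ∀ t, β * U t + n t ≤ F t) (hs : ∀ t, IsSubAt c U (n t) t) (t : ℝ) :
    U t ≤ green c β F t := by
  have hβ0 : 0 < β := by linarith
  refine sub_nonpos.1 (nonpos_of_touching (M := M / β + N) hc hβ (W := fun t => U t - green c β F t)
    (hU.sub (continuous_green hβ0 hF hM)) (fun t => ?_) (fun t₀ _ => ?_) t)
  · have h1 := (abs_le.1 (abs_green_le (c := c) hβ0 hF hM t)).1
    have h2 := (abs_le.1 (hN t)).2
    linarith
  · obtain ⟨V, V1, v2, hV, hV0, hd1, hd2, hle⟩ := hs t₀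
    refine ⟨fun t => V t - green c β F t, fun t => V1 t - greenDeriv c β F t, _,
      hV.mono fun t ht => by linarith, by simp only [hV0],
      hd1.mono fun t ht => ht.sub (hasDerivAt_green hβ0 hF hM t),
      hd2.sub (hasDerivAt_greenDeriv hβ0 hF hM t₀), ?_⟩
    linarith [hn t₀]

end comparison

/-! ### Cooperative reaction terms and monotone iteration. -/

/-- The reaction term of the first equation, made monotone by adding `β φ`. -/
noncomputable def sourcePhi (r β x y : ℝ) : ℝ := x * (β + 1 - r - x + r * y)

/-- The reaction term of the second equation, made monotone by adding `β ψ`. -/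
noncomputable def sourcePsi (b β x y : ℝ) : ℝ := β * y + b * x * (1 - y)

section source

variable {r b β x y x' y' : ℝ}

/-- The difference quotient in `x` is `β + 1 - r - x - x' + r y`, nonnegative on the unit square
once `β ≥ 2`. -/
theorem sourcePhi_mono (hr0 : 0 < r) (hr1 : r ≤ 1) (hβ : 2 ≤ β) (hx : 0 ≤ x) (hxx : x ≤ x')
    (hx' : x' ≤ 1) (hy : 0 ≤ y) (hyy : y ≤ y') : sourcePhi r β x y ≤ sourcePhi r β x' y' := by
  unfold sourcePhi
  nlinarith [mul_nonneg (sub_nonneg.2 hxx) (mul_nonneg hr0.le hy),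
    mul_nonneg (mul_nonneg hr0.le (hx.trans hxx)) (sub_nonneg.2 hyy),
    mul_nonneg (sub_nonneg.2 hxx) (show 0 ≤ β + 1 - r - x - x' by linarith)]

theorem sourcePsi_mono (hb : 0 < b) (hβ : b ≤ β) (hxx : x ≤ x')
    (hx' : x' ≤ 1) (hyy : y ≤ y') (hy' : y' ≤ 1) :
    sourcePsi b β x y ≤ sourcePsi b β x' y' := by
  unfold sourcePsi
  have h1 : b * x ≤ b := by nlinarith
  nlinarith [mul_nonneg (sub_nonneg.2 hyy) (show 0 ≤ β - b * x by linarith),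
    mul_nonneg (mul_nonneg hb.le (sub_nonneg.2 hxx)) (sub_nonneg.2 hy')]

theorem abs_sourcePhi_le (hr0 : 0 < r) (hr1 : r ≤ 1) (hβ : 2 ≤ β) (hx : 0 ≤ x)
    (hx' : x ≤ 1) (hy : 0 ≤ y) (hy' : y ≤ 1) : |sourcePhi r β x y| ≤ β := by
  have h1 := sourcePhi_mono hr0 hr1 hβ le_rfl hx hx' le_rfl hy
  have h2 := sourcePhi_mono hr0 hr1 hβ hx hx' le_rfl hy hy'
  rw [abs_of_nonneg (by simpa [sourcePhi] using h1)]
  exact h2.trans (le_of_eq (by simp only [sourcePhi]; ring))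

theorem abs_sourcePsi_le (hb : 0 < b) (hβ : b ≤ β) (hx : 0 ≤ x)
    (hx' : x ≤ 1) (hy : 0 ≤ y) (hy' : y ≤ 1) : |sourcePsi b β x y| ≤ β := by
  have h1 := sourcePsi_mono hb hβ hx hx' hy hy'
  have h2 := sourcePsi_mono hb hβ hx' le_rfl hy' le_rfl
  rw [abs_of_nonneg (by simpa [sourcePsi] using h1)]
  exact h2.trans (by simp [sourcePsi])

theorem continuous_sourcePhi {φ ψ : ℝ → ℝ} (hφ : Continuous φ) (hψ : Continuous ψ) (d : ℝ) :
    Continuous fun t => sourcePhi r β (φ t) (ψ (t - d)) := by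
  unfold sourcePhi; fun_prop

theorem continuous_sourcePsi {φ ψ : ℝ → ℝ} (hφ : Continuous φ) (hψ : Continuous ψ) :
    Continuous fun t => sourcePsi b β (φ t) (ψ t) := by
  unfold sourcePsi; fun_prop

end source

/-- A monotone pair `(φ, ψ)` with values in `[0, 1]`, solving the integral form of
`φ'' - c φ' + φ (1 - r - φ + r ψ(· - d)) = 0`, `ψ'' - c ψ' + b φ (1 - ψ) = 0`. -/
structure IsProfile (r b c d β : ℝ) (φ ψ : ℝ → ℝ) : Prop where
  cont_phi : Continuous φ
  cont_psi : Continuous ψ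
  mono_phi : Monotone φ
  mono_psi : Monotone ψ
  phi_nonneg : ∀ t, 0 ≤ φ t
  psi_nonneg : ∀ t, 0 ≤ ψ t
  phi_le_one : ∀ t, φ t ≤ 1
  psi_le_one : ∀ t, ψ t ≤ 1
  eq_phi : ∀ t, φ t = green c β (fun t => sourcePhi r β (φ t) (ψ (t - d))) t
  eq_psi : ∀ t, ψ t = green c β (fun t => sourcePsi b β (φ t) (ψ t)) t

/-- A monotone upper solution. -/
structure IsUpperPair (r b c d : ℝ) (Φ Ψ : ℝ → ℝ) : Prop where
  cont_phi : Continuous Φ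
  cont_psi : Continuous Ψ
  mono_phi : Monotone Φ
  mono_psi : Monotone Ψ
  phi_nonneg : ∀ t, 0 ≤ Φ t
  psi_nonneg : ∀ t, 0 ≤ Ψ t
  phi_le_one : ∀ t, Φ t ≤ 1
  psi_le_one : ∀ t, Ψ t ≤ 1
  super_phi : ∀ t, IsSuperAt c Φ (Φ t * (1 - r - Φ t + r * Ψ (t - d))) t
  super_psi : ∀ t, IsSuperAt c Ψ (b * Φ t * (1 - Ψ t)) t

/-- A lower solution. -/
structure IsLowerPair (r b c d : ℝ) (Φ Ψ : ℝ → ℝ) : Prop where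
  cont_phi : Continuous Φ
  cont_psi : Continuous Ψ
  phi_nonneg : ∀ t, 0 ≤ Φ t
  psi_nonneg : ∀ t, 0 ≤ Ψ t
  sub_phi : ∀ t, IsSubAt c Φ (Φ t * (1 - r - Φ t + r * Ψ (t - d))) t
  sub_psi : ∀ t, IsSubAt c Ψ (b * Φ t * (1 - Ψ t)) t

/-- One step of the monotone iteration. -/
noncomputable def iterStep (r b c d β : ℝ) (u : (ℝ → ℝ) × (ℝ → ℝ)) : (ℝ → ℝ) × (ℝ → ℝ) :=
  (green c β (fun t => sourcePhi r β (u.1 t) (u.2 (t - d))),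
    green c β (fun t => sourcePsi b β (u.1 t) (u.2 t)))

/-- Continuous monotone pairs between a lower and an upper solution. -/
structure IsBetween (L U u : (ℝ → ℝ) × (ℝ → ℝ)) : Prop where
  cont_phi : Continuous u.1
  cont_psi : Continuous u.2
  mono_phi : Monotone u.1
  mono_psi : Monotone u.2
  ge_phi : ∀ t, L.1 t ≤ u.1 t
  ge_psi : ∀ t, L.2 t ≤ u.2 t
  le_phi : ∀ t, u.1 t ≤ U.1 t
  le_psi : ∀ t, u.2 t ≤ U.2 t

section iteration

variable {r b c d β : ℝ}

theorem iterStep_lipschitz (hr0 : 0 < r) (hr1 : r ≤ 1) (hb : 0 < b) (hc : 0 ≤ c)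
    (hβ : 2 + c + b ≤ β) {u : (ℝ → ℝ) × (ℝ → ℝ)} (h1 : Continuous u.1) (h2 : Continuous u.2)
    (p1 : ∀ t, 0 ≤ u.1 t) (p2 : ∀ t, 0 ≤ u.2 t) (q1 : ∀ t, u.1 t ≤ 1) (q2 : ∀ t, u.2 t ≤ 1)
    (t s : ℝ) :
    |(iterStep r b c d β u).1 t - (iterStep r b c d β u).1 s| ≤ β * |t - s| ∧
    |(iterStep r b c d β u).2 t - (iterStep r b c d β u).2 s| ≤ β * |t - s| := by
  have hβ0 : 0 < β := by linarith
  have hk : 2 * β / √(c ^ 2 + 4 * β) ≤ β := by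
    have : 2 ≤ √(c ^ 2 + 4 * β) := Real.le_sqrt_of_sq_le (by nlinarith [sq_nonneg c])
    rw [div_le_iff₀ (by linarith)]
    nlinarith
  constructor
  · refine (abs_green_sub_le (M := β) hβ0 (continuous_sourcePhi h1 h2 d)
      (fun s => abs_sourcePhi_le hr0 hr1 (by linarith) (p1 _) (q1 _) (p2 _) (q2 _)) t s).trans
      (mul_le_mul_of_nonneg_right hk (abs_nonneg _))
  · refine (abs_green_sub_le (M := β) hβ0 (continuous_sourcePsi h1 h2)
      (fun s => abs_sourcePsi_le hb (by linarith) (p1 _) (q1 _) (p2 _) (q2 _)) t s).trans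
      (mul_le_mul_of_nonneg_right hk (abs_nonneg _))

theorem IsProfile.lipschitz (hr0 : 0 < r) (hr1 : r ≤ 1) (hb : 0 < b) (hc : 0 ≤ c)
    (hβ : 2 + c + b ≤ β) {φ ψ : ℝ → ℝ} (hp : IsProfile r b c d β φ ψ) (t s : ℝ) :
    |φ t - φ s| ≤ β * |t - s| ∧ |ψ t - ψ s| ≤ β * |t - s| := by
  have h := iterStep_lipschitz (d := d) hr0 hr1 hb hc hβ (u := (φ, ψ)) hp.cont_phi hp.cont_psi hp.phi_nonneg
    hp.psi_nonneg hp.phi_le_one hp.psi_le_one t s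
  simp only [iterStep] at h
  rwa [← hp.eq_phi, ← hp.eq_phi, ← hp.eq_psi, ← hp.eq_psi] at h

variable {L U : (ℝ → ℝ) × (ℝ → ℝ)}

theorem iterStep_mono (hr0 : 0 < r) (hr1 : r ≤ 1) (hb : 0 < b) (hc : 0 ≤ c)
    (hβ : 2 + c + b ≤ β) (hL : IsLowerPair r b c d L.1 L.2) (hU : IsUpperPair r b c d U.1 U.2)
    {u v : (ℝ → ℝ) × (ℝ → ℝ)} (hu : IsBetween L U u) (hv : IsBetween L U v) {t s : ℝ}
    (h1 : ∀ x, u.1 (t + x) ≤ v.1 (s + x)) (h2 : ∀ x, u.2 (t + x) ≤ v.2 (s + x)) :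
    (iterStep r b c d β u).1 t ≤ (iterStep r b c d β v).1 s ∧
    (iterStep r b c d β u).2 t ≤ (iterStep r b c d β v).2 s := by
  have hβ0 : 0 < β := by linarith
  have pu1 := fun t => (hL.phi_nonneg t).trans (hu.ge_phi t)
  have pu2 := fun t => (hL.psi_nonneg t).trans (hu.ge_psi t)
  have pv1 := fun t => (hL.phi_nonneg t).trans (hv.ge_phi t)
  have pv2 := fun t => (hL.psi_nonneg t).trans (hv.ge_psi t)
  have qu1 := fun t => (hu.le_phi t).trans (hU.phi_le_one t)
  have qu2 := fun t => (hu.le_psi t).trans (hU.psi_le_one t)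
  have qv1 := fun t => (hv.le_phi t).trans (hU.phi_le_one t)
  have qv2 := fun t => (hv.le_psi t).trans (hU.psi_le_one t)
  have a1 := hu.cont_phi
  have a2 := hu.cont_psi
  have a3 := hv.cont_phi
  have a4 := hv.cont_psi
  constructor
  · refine green_mono (M := β) (N := β) hβ0 (continuous_sourcePhi a1 a2 d)
      (continuous_sourcePhi a3 a4 d)
      (fun s => abs_sourcePhi_le hr0 hr1 (by linarith) (pu1 _) (qu1 _) (pu2 _) (qu2 _))
      (fun s => abs_sourcePhi_le hr0 hr1 (by linarith) (pv1 _) (qv1 _) (pv2 _) (qv2 _))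
      (fun x => sourcePhi_mono hr0 hr1 (by linarith) (pu1 _) (h1 x) (qv1 _) (pu2 _) ?_)
    simpa [add_sub_assoc] using h2 (x - d)
  · exact green_mono (M := β) (N := β) hβ0 (continuous_sourcePsi a1 a2)
      (continuous_sourcePsi a3 a4)
      (fun s => abs_sourcePsi_le hb (by linarith) (pu1 _) (qu1 _) (pu2 _) (qu2 _))
      (fun s => abs_sourcePsi_le hb (by linarith) (pv1 _) (qv1 _) (pv2 _) (qv2 _))
      (fun x => sourcePsi_mono hb (by linarith) (h1 x) (qv1 _) (h2 x) (qv2 _))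

/-- The bounds by `L` and `U` come from comparison for `green`; monotonicity comes from order
preservation applied to translates of one function. -/
theorem IsBetween.iterStep (hr0 : 0 < r) (hr1 : r ≤ 1) (hb : 0 < b) (hc : 0 ≤ c)
    (hβ : 2 + c + b ≤ β) (hL : IsLowerPair r b c d L.1 L.2) (hU : IsUpperPair r b c d U.1 U.2)
    {u : (ℝ → ℝ) × (ℝ → ℝ)} (hu : IsBetween L U u) :
    IsBetween L U (iterStep r b c d β u) := by
  have hβ0 : 0 < β := by linarith
  have pu1 := fun t => (hL.phi_nonneg t).trans (hu.ge_phi t)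
  have pu2 := fun t => (hL.psi_nonneg t).trans (hu.ge_psi t)
  have qu1 := fun t => (hu.le_phi t).trans (hU.phi_le_one t)
  have qu2 := fun t => (hu.le_psi t).trans (hU.psi_le_one t)
  have a1 := hu.cont_phi
  have a2 := hu.cont_psi
  have c1 : Continuous fun t => sourcePhi r β (u.1 t) (u.2 (t - d)) :=
    continuous_sourcePhi a1 a2 d
  have c2 : Continuous fun t => sourcePsi b β (u.1 t) (u.2 t) :=
    continuous_sourcePsi a1 a2
  have m1 : ∀ t, |sourcePhi r β (u.1 t) (u.2 (t - d))| ≤ β := fun s =>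
    abs_sourcePhi_le hr0 hr1 (by linarith) (pu1 _) (qu1 _) (pu2 _) (qu2 _)
  have m2 : ∀ t, |sourcePsi b β (u.1 t) (u.2 t)| ≤ β := fun s =>
    abs_sourcePsi_le hb (by linarith) (pu1 _) (qu1 _) (pu2 _) (qu2 _)
  refine ⟨continuous_green hβ0 c1 m1, continuous_green hβ0 c2 m2, fun t s hts => ?_,
    fun t s hts => ?_, ?_, ?_, ?_, ?_⟩
  · exact (iterStep_mono hr0 hr1 hb hc hβ hL hU hu hu (fun x => hu.mono_phi (by linarith))
      (fun x => hu.mono_psi (by linarith))).1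
  · exact (iterStep_mono hr0 hr1 hb hc hβ hL hU hu hu (fun x => hu.mono_phi (by linarith))
      (fun x => hu.mono_psi (by linarith))).2
  · refine le_green_of_isSubAt (N := 1) hc (by linarith) c1 m1 hL.cont_phi (fun t => ?_)
      (fun t => ?_) hL.sub_phi
    · rw [abs_of_nonneg (hL.phi_nonneg t)]; exact (hu.ge_phi t).trans (qu1 t)
    · refine le_trans (le_of_eq ?_) (sourcePhi_mono hr0 hr1 (by linarith) (hL.phi_nonneg t)
        (hu.ge_phi t) (qu1 t) (hL.psi_nonneg _) (hu.ge_psi _))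
      unfold sourcePhi; ring
  · refine le_green_of_isSubAt (N := 1) hc (by linarith) c2 m2 hL.cont_psi (fun t => ?_)
      (fun t => ?_) hL.sub_psi
    · rw [abs_of_nonneg (hL.psi_nonneg t)]; exact (hu.ge_psi t).trans (qu2 t)
    · exact (sourcePsi_mono hb (by linarith)
        (hu.ge_phi t) (qu1 t) (hu.ge_psi _) (qu2 _))
  · refine green_le_of_isSuperAt (N := 1) hc (by linarith) c1 m1 hU.cont_phi (fun t => ?_)
      (fun t => ?_) hU.super_phi
    · rw [abs_of_nonneg (hU.phi_nonneg t)]; exact hU.phi_le_one t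
    · refine (sourcePhi_mono hr0 hr1 (by linarith) (pu1 t)
        (hu.le_phi t) (hU.phi_le_one t) (pu2 _) (hu.le_psi _)).trans (le_of_eq ?_)
      unfold sourcePhi; ring
  · refine green_le_of_isSuperAt (N := 1) hc (by linarith) c2 m2 hU.cont_psi (fun t => ?_)
      (fun t => ?_) hU.super_psi
    · rw [abs_of_nonneg (hU.psi_nonneg t)]; exact hU.psi_le_one t
    · exact (sourcePsi_mono hb (by linarith)
        (hu.le_phi t) (hU.phi_le_one t) (hu.le_psi _) (hU.psi_le_one _))

theorem continuous_of_abs_sub_le {f : ℝ → ℝ} {K : ℝ}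
    (hf : ∀ t s, |f t - f s| ≤ K * |t - s|) : Continuous f := by
  have hK : 0 ≤ K := by
    have := (abs_nonneg _).trans (hf 1 0)
    simpa using this
  exact (LipschitzWith.of_dist_le_mul (K := ⟨K, hK⟩) fun t s => hf t s).continuous

/-- Between an ordered pair of lower and upper solutions there is a profile. -/
theorem exists_isProfile (hr0 : 0 < r) (hr1 : r ≤ 1) (hb : 0 < b) (hc : 0 ≤ c)
    (hβ : 2 + c + b ≤ β) (hL : IsLowerPair r b c d L.1 L.2) (hU : IsUpperPair r b c d U.1 U.2)
    (hLU1 : ∀ t, L.1 t ≤ U.1 t) (hLU2 : ∀ t, L.2 t ≤ U.2 t) :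
    ∃ φ ψ : ℝ → ℝ, IsProfile r b c d β φ ψ ∧ (∀ t, L.1 t ≤ φ t) ∧ (∀ t, L.2 t ≤ ψ t) ∧
      (∀ t, φ t ≤ U.1 t) ∧ (∀ t, ψ t ≤ U.2 t) := by
  have hβ0 : 0 < β := by linarith
  obtain ⟨u, hu0, hsucc⟩ : ∃ u : ℕ → (ℝ → ℝ) × (ℝ → ℝ), u 0 = U ∧
      ∀ n, u (n + 1) = iterStep r b c d β (u n) :=
    ⟨fun n => (iterStep r b c d β)^[n] U, rfl, fun n => Function.iterate_succ_apply' _ _ _⟩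
  have hbt : ∀ n, IsBetween L U (u n) := by
    intro n
    induction n with
    | zero => rw [hu0]; exact ⟨hU.cont_phi, hU.cont_psi, hU.mono_phi, hU.mono_psi, hLU1, hLU2,
        fun _ => le_rfl, fun _ => le_rfl⟩
    | succ n ih => rw [hsucc]; exact ih.iterStep hr0 hr1 hb hc hβ hL hU
  have hdec : ∀ n, (∀ t, (u (n + 1)).1 t ≤ (u n).1 t) ∧ (∀ t, (u (n + 1)).2 t ≤ (u n).2 t) := by
    intro n
    induction n with
    | zero => rw [hu0]; exact ⟨(hbt 1).le_phi, (hbt 1).le_psi⟩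
    | succ n ih =>
      have h := fun t => iterStep_mono (t := t) (s := t) hr0 hr1 hb hc hβ hL hU (hbt (n + 1)) (hbt n)
        (fun x => ih.1 _) (fun x => ih.2 _)
      rw [← hsucc, ← hsucc] at h
      exact ⟨fun t => (h t).1, fun t => (h t).2⟩
  have pu1 := fun n t => (hL.phi_nonneg t).trans ((hbt n).ge_phi t)
  have pu2 := fun n t => (hL.psi_nonneg t).trans ((hbt n).ge_psi t)
  have qu1 := fun n t => ((hbt n).le_phi t).trans (hU.phi_le_one t)
  have qu2 := fun n t => ((hbt n).le_psi t).trans (hU.psi_le_one t)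
  have l1 : ∀ t, Tendsto (fun n => (u n).1 t) atTop (𝓝 (⨅ n, (u n).1 t)) := fun t =>
    tendsto_atTop_ciInf (antitone_nat_of_succ_le fun n => (hdec n).1 t)
      ⟨0, by rintro _ ⟨n, rfl⟩; exact pu1 n t⟩
  have l2 : ∀ t, Tendsto (fun n => (u n).2 t) atTop (𝓝 (⨅ n, (u n).2 t)) := fun t =>
    tendsto_atTop_ciInf (antitone_nat_of_succ_le fun n => (hdec n).2 t)
      ⟨0, by rintro _ ⟨n, rfl⟩; exact pu2 n t⟩
  generalize hφ : (fun t => ⨅ n, (u n).1 t) = φ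
  generalize hψ : (fun t => ⨅ n, (u n).2 t) = ψ
  have hφ' : ∀ t, (⨅ n, (u n).1 t) = φ t := fun t => congrFun hφ t
  have hψ' : ∀ t, (⨅ n, (u n).2 t) = ψ t := fun t => congrFun hψ t
  simp only [hφ'] at l1
  simp only [hψ'] at l2
  -- The bound `β` does not depend on `n`, so the pointwise limit is continuous. It starts at the
  -- first iterate because `U` itself is only assumed continuous.
  have lip : ∀ n t s, |(u (n + 1)).1 t - (u (n + 1)).1 s| ≤ β * |t - s| ∧
      |(u (n + 1)).2 t - (u (n + 1)).2 s| ≤ β * |t - s| := by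
    intro n t s
    rw [hsucc]
    exact iterStep_lipschitz hr0 hr1 hb hc hβ (hbt n).cont_phi (hbt n).cont_psi (pu1 n) (pu2 n)
      (qu1 n) (qu2 n) t s
  have l1' := fun t => (l1 t).comp (tendsto_add_atTop_nat 1)
  have l2' := fun t => (l2 t).comp (tendsto_add_atTop_nat 1)
  refine ⟨φ, ψ, ⟨?_, ?_, ?_, ?_, ?_, ?_, ?_, ?_, ?_, ?_⟩, ?_, ?_, ?_, ?_⟩
  · exact continuous_of_abs_sub_le fun t s => le_of_tendsto ((l1' t).sub (l1' s)).abs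
      (Eventually.of_forall fun n => (lip n t s).1)
  · exact continuous_of_abs_sub_le fun t s => le_of_tendsto ((l2' t).sub (l2' s)).abs
      (Eventually.of_forall fun n => (lip n t s).2)
  · exact fun t s hts => le_of_tendsto_of_tendsto' (l1 t) (l1 s) fun n => (hbt n).mono_phi hts
  · exact fun t s hts => le_of_tendsto_of_tendsto' (l2 t) (l2 s) fun n => (hbt n).mono_psi hts
  · exact fun t => ge_of_tendsto' (l1 t) fun n => pu1 n t
  · exact fun t => ge_of_tendsto' (l2 t) fun n => pu2 n t
  · exact fun t => le_of_tendsto' (l1 t) fun n => qu1 n t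
  · exact fun t => le_of_tendsto' (l2 t) fun n => qu2 n t
  · intro t
    refine tendsto_nhds_unique (l1' t) ?_
    simp only [Function.comp_def, hsucc]
    refine tendsto_green (c := fun _ => c) (t := fun _ => t)
      (F := fun n t => sourcePhi r β ((u n).1 t) ((u n).2 (t - d)))
      (F₁ := fun t => sourcePhi r β (φ t) (ψ (t - d))) (M := β) hβ0 (fun _ => hc)
      (fun _ => le_rfl) tendsto_const_nhds (fun n => continuous_sourcePhi (hbt n).cont_phi (hbt n).cont_psi d)
      (fun n s => abs_sourcePhi_le hr0 hr1 (by linarith) (pu1 _ _) (qu1 _ _) (pu2 _ _) (qu2 _ _))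
      (fun s => ?_)
    exact (l1 _).mul ((tendsto_const_nhds.sub (l1 _)).add ((l2 _).const_mul r))
  · intro t
    refine tendsto_nhds_unique (l2' t) ?_
    simp only [Function.comp_def, hsucc]
    refine tendsto_green (c := fun _ => c) (t := fun _ => t)
      (F := fun n t => sourcePsi b β ((u n).1 t) ((u n).2 t))
      (F₁ := fun t => sourcePsi b β (φ t) (ψ t)) (M := β) hβ0 (fun _ => hc)
      (fun _ => le_rfl) tendsto_const_nhds (fun n => continuous_sourcePsi (hbt n).cont_phi (hbt n).cont_psi)
      (fun n s => abs_sourcePsi_le hb (by linarith) (pu1 _ _) (qu1 _ _) (pu2 _ _) (qu2 _ _))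
      (fun s => ?_)
    exact ((l2 _).const_mul β).add (((l1 _).const_mul b).mul (tendsto_const_nhds.sub (l2 _)))
  · exact fun t => ge_of_tendsto' (l1 t) fun n => (hbt n).ge_phi t
  · exact fun t => ge_of_tendsto' (l2 t) fun n => (hbt n).ge_psi t
  · exact fun t => le_of_tendsto' (l1 t) fun n => (hbt n).le_phi t
  · exact fun t => le_of_tendsto' (l2 t) fun n => (hbt n).le_psi t

end iteration

/-! ### The Laplacian of plane waves. -/

section planeWave

variable {n : ℕ} {f f1 f2 : ℝ → ℝ}

theorem laplacian_planeWave (hf : ∀ t, HasDerivAt f (f1 t) t) (hf1 : ∀ t, HasDerivAt f1 (f2 t) t)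
    {ν : EuclideanSpace ℝ (Fin n)} (hν : ‖ν‖ = 1) (k : ℝ) (x : EuclideanSpace ℝ (Fin n)) :
    Laplacian.laplacian (fun x => f (⟪ν, x⟫_ℝ + k)) x = f2 (⟪ν, x⟫_ℝ + k) := by
  have hin : ∀ x, HasFDerivAt (fun x => ⟪ν, x⟫_ℝ + k) (innerSL ℝ ν) x := fun x =>
    ((innerSL ℝ ν).hasFDerivAt (x := x)).add_const k
  have h1 : fderiv ℝ (fun x => f (⟪ν, x⟫_ℝ + k)) = fun x => f1 (⟪ν, x⟫_ℝ + k) • innerSL ℝ ν :=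
    funext fun x => ((hf _).comp_hasFDerivAt x (hin x)).fderiv
  have h2 : fderiv ℝ (fderiv ℝ (fun x => f (⟪ν, x⟫_ℝ + k))) x
      = (f2 (⟪ν, x⟫_ℝ + k) • innerSL ℝ ν).smulRight (innerSL ℝ ν) := by
    rw [h1]
    exact (((hf1 _).comp_hasFDerivAt x (hin x)).smul_const (innerSL ℝ ν)).fderiv
  rw [InnerProductSpace.laplacian_eq_iteratedFDeriv_stdOrthonormalBasis]
  simp only [iteratedFDeriv_two_apply, h2]
  simp only [Matrix.cons_val_zero, Matrix.cons_val_one, ContinuousLinearMap.smulRight_apply,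
    smul_apply, innerSL_apply_apply, smul_eq_mul, mul_assoc, ← Finset.mul_sum]
  -- By Parseval the squared coordinates of `ν` add up to one, which leaves exactly `f2`.
  have h3 := OrthonormalBasis.sum_sq_norm_inner_left (stdOrthonormalBasis ℝ (EuclideanSpace ℝ (Fin n))) ν
  rw [hν] at h3
  simp only [Real.norm_eq_abs, sq_abs] at h3
  simp only [← sq]
  rw [h3]; ring

end planeWave

/-! ### Limits and strict bounds of profiles; profiles are fronts. -/

section profile

variable {r b h c d β : ℝ} {φ ψ : ℝ → ℝ}

theorem IsProfile.continuous_sourcePhi (hp : IsProfile r b c d β φ ψ) :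
    Continuous fun t => sourcePhi r β (φ t) (ψ (t - d)) :=
  _root_.continuous_sourcePhi hp.cont_phi hp.cont_psi d

theorem IsProfile.continuous_sourcePsi (hp : IsProfile r b c d β φ ψ) :
    Continuous fun t => sourcePsi b β (φ t) (ψ t) :=
  _root_.continuous_sourcePsi hp.cont_phi hp.cont_psi

theorem IsProfile.abs_sourcePhi_le (hp : IsProfile r b c d β φ ψ) (hr0 : 0 < r) (hr1 : r ≤ 1)
    (hβ : 2 ≤ β) (t : ℝ) : |sourcePhi r β (φ t) (ψ (t - d))| ≤ β :=
  _root_.abs_sourcePhi_le hr0 hr1 hβ (hp.phi_nonneg _) (hp.phi_le_one _) (hp.psi_nonneg _)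
    (hp.psi_le_one _)

theorem IsProfile.abs_sourcePsi_le (hp : IsProfile r b c d β φ ψ) (hb : 0 < b)
    (hβ : b ≤ β) (t : ℝ) : |sourcePsi b β (φ t) (ψ t)| ≤ β :=
  _root_.abs_sourcePsi_le hb hβ (hp.phi_nonneg _) (hp.phi_le_one _) (hp.psi_nonneg _)
    (hp.psi_le_one _)

/-- Limits of a profile are equilibria. -/
theorem IsProfile.limit_eq (hp : IsProfile r b c d β φ ψ) (hr0 : 0 < r) (hr1 : r ≤ 1) (hb : 0 < b)
    (hc : 0 ≤ c) (hβ : 2 + c + b ≤ β) {l : Filter ℝ} [l.IsCountablyGenerated] [l.NeBot]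
    (hl : ∀ s, Tendsto (fun t => t + s) l l) {x y : ℝ} (hx : Tendsto φ l (𝓝 x))
    (hy : Tendsto ψ l (𝓝 y)) : x * (1 - r - x + r * y) = 0 ∧ b * x * (1 - y) = 0 := by
  have hβ0 : 0 < β := by linarith
  have hx' := fun s => hx.comp (hl s)
  have hy' := fun s => hy.comp (hl s)
  simp only [Function.comp_def] at hx' hy'
  -- Translates of the source converge to a constant, on which `green` is division by `β`. The same
  -- limit passage applies at either end of the line.
  have h1 : Tendsto φ l (𝓝 (sourcePhi r β x y / β)) := by
    rw [← green_const (c := c) hβ0 _ 0]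
    refine Tendsto.congr (fun t => (hp.eq_phi t).symm) ?_
    refine tendsto_green (c := fun _ => c) (t := fun t => t)
      (F := fun _ t => sourcePhi r β (φ t) (ψ (t - d))) (F₁ := fun _ => sourcePhi r β x y)
      (M := β) hβ0 (fun _ => hc) (fun _ => le_rfl) tendsto_const_nhds
      (fun _ => hp.continuous_sourcePhi) (fun _ => hp.abs_sourcePhi_le hr0 hr1 (by linarith))
      (fun s => ?_)
    have e := hy' (s - d)
    simp only [← add_sub_assoc] at e
    exact (hx' s).mul ((tendsto_const_nhds.sub (hx' s)).add (e.const_mul r))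
  have h2 : Tendsto ψ l (𝓝 (sourcePsi b β x y / β)) := by
    rw [← green_const (c := c) hβ0 _ 0]
    refine Tendsto.congr (fun t => (hp.eq_psi t).symm) ?_
    refine tendsto_green (c := fun _ => c) (t := fun t => t)
      (F := fun _ t => sourcePsi b β (φ t) (ψ t)) (F₁ := fun _ => sourcePsi b β x y)
      (M := β) hβ0 (fun _ => hc) (fun _ => le_rfl) tendsto_const_nhds
      (fun _ => hp.continuous_sourcePsi) (fun _ => hp.abs_sourcePsi_le hb (by linarith))
      (fun s => ?_)
    exact ((hy' s).const_mul β).add (((hx' s).const_mul b).mul (tendsto_const_nhds.sub (hy' s)))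
  have e1 := tendsto_nhds_unique hx h1
  have e2 := tendsto_nhds_unique hy h2
  rw [eq_div_iff hβ0.ne'] at e1 e2
  unfold sourcePhi at e1
  unfold sourcePsi at e2
  constructor <;> linarith

theorem IsProfile.phi_pos (hp : IsProfile r b c d β φ ψ) (hr0 : 0 < r) (hr1 : r ≤ 1)
    (hβ : 2 ≤ β) (hne : ∃ t, 0 < φ t) (t : ℝ) : 0 < φ t := by
  have hβ0 : 0 < β := by linarith
  refine (hp.phi_nonneg t).lt_of_ne fun h0 => ?_
  obtain ⟨s, hs⟩ := hne
  have hst : s ≠ t := by rintro rfl; linarith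
  have hF : ∀ t, 0 ≤ sourcePhi r β (φ t) (ψ (t - d)) := fun t => by
    simpa [sourcePhi] using sourcePhi_mono hr0 hr1 hβ le_rfl (hp.phi_nonneg t) (hp.phi_le_one t)
      le_rfl (hp.psi_nonneg (t - d))
  have := eq_zero_of_green_eq_zero hβ0 hp.continuous_sourcePhi (hp.abs_sourcePhi_le hr0 hr1 hβ) hF
    (h0 ▸ hp.eq_phi t).symm hst
  unfold sourcePhi at this
  have hpos : 0 < φ s * (β + 1 - r - φ s + r * ψ (s - d)) := by
    refine mul_pos hs ?_
    nlinarith [hp.phi_le_one s, mul_nonneg hr0.le (hp.psi_nonneg (s - d))]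
  linarith

/-- Since `1 - ψ` is `green` applied to `(β - b φ) (1 - ψ)`, with a positive factor as `b < β`, a
single zero would force `1 - ψ` to vanish elsewhere too. -/
theorem IsProfile.psi_lt_one (hp : IsProfile r b c d β φ ψ) (hb : 0 < b)
    (hβ : b < β) (hne : ∃ t, ψ t < 1) (t : ℝ) : ψ t < 1 := by
  have hβ0 : 0 < β := by linarith
  refine (hp.psi_le_one t).lt_of_ne fun h0 => ?_
  obtain ⟨s, hs⟩ := hne
  have hst : s ≠ t := by rintro rfl; linarith
  have hG := green_sub (c := c) (M := |β|) (F := fun _ => β) hβ0 continuous_const hp.continuous_sourcePsi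
    (fun _ => le_rfl) (hp.abs_sourcePsi_le hb hβ.le) t
  rw [green_const hβ0, ← hp.eq_psi, h0, div_self hβ0.ne', sub_self] at hG
  have e : ∀ t, β - sourcePsi b β (φ t) (ψ t) = (β - b * φ t) * (1 - ψ t) := fun t => by
    unfold sourcePsi; ring
  have hk : ∀ t, 0 < β - b * φ t := fun t => by nlinarith [hp.phi_le_one t]
  have := eq_zero_of_green_eq_zero (M := |β| + β) hβ0 (continuous_const.sub hp.continuous_sourcePsi)
    (fun t => (abs_sub _ _).trans (add_le_add le_rfl (hp.abs_sourcePsi_le hb hβ.le t)))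
    (fun t => by rw [Pi.sub_apply, e]; exact mul_nonneg (hk t).le (by linarith [hp.psi_le_one t])) hG hst
  rw [Pi.sub_apply, e] at this
  have := mul_pos (hk s) (sub_pos.2 hs)
  linarith

/-- A profile vanishing at `-∞`, with nontrivial `φ`, is a front. -/
theorem IsProfile.isPositiveMonotoneFront (hp : IsProfile r b c (c * h) β φ ψ) (hr0 : 0 < r)
    (hr1 : r ≤ 1) (hb : 0 < b) (hc : 0 ≤ c) (hβ : 2 + c + b ≤ β) (hφ : Tendsto φ atBot (𝓝 0))
    (hψ : Tendsto ψ atBot (𝓝 0)) (hne : ∃ t, 0 < φ t) :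
    IsPositiveMonotoneFront r b h c φ (fun t => 1 - ψ t) := by
  have hβ0 : 0 < β := by linarith
  have c1 := hp.continuous_sourcePhi
  have c2 := hp.continuous_sourcePsi
  have m1 := hp.abs_sourcePhi_le hr0 hr1 (by linarith)
  have m2 := hp.abs_sourcePsi_le hb (by linarith)
  have eφ : φ = green c β (fun t => sourcePhi r β (φ t) (ψ (t - c * h))) := funext hp.eq_phi
  have eψ : ψ = green c β (fun t => sourcePsi b β (φ t) (ψ t)) := funext hp.eq_psi
  have dφ : ∀ t, HasDerivAt φ _ t := fun t => by
    have := hasDerivAt_green (c := c) hβ0 c1 m1 t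
    rwa [← eφ] at this
  have dψ : ∀ t, HasDerivAt ψ _ t := fun t => by
    have := hasDerivAt_green (c := c) hβ0 c2 m2 t
    rwa [← eψ] at this
  have d2φ := hasDerivAt_greenDeriv (c := c) hβ0 c1 m1
  have d2ψ := hasDerivAt_greenDeriv (c := c) hβ0 c2 m2
  rw [← eφ] at d2φ
  rw [← eψ] at d2ψ
  have C1 : ContDiff ℝ 2 φ := by rw [eφ]; exact contDiff_green hβ0 c1 m1
  have C2 : ContDiff ℝ 2 ψ := by rw [eψ]; exact contDiff_green hβ0 c2 m2
  have hpos := hp.phi_pos hr0 hr1 (by linarith) hne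
  have hlt := hp.psi_lt_one hb (by linarith) ((hψ.eventually_lt_const one_pos).exists)
  obtain ⟨L1, hL1⟩ : ∃ L, Tendsto φ atTop (𝓝 L) :=
    ⟨_, tendsto_atTop_ciSup hp.mono_phi ⟨1, by rintro _ ⟨t, rfl⟩; exact hp.phi_le_one t⟩⟩
  obtain ⟨L2, hL2⟩ : ∃ L, Tendsto ψ atTop (𝓝 L) :=
    ⟨_, tendsto_atTop_ciSup hp.mono_psi ⟨1, by rintro _ ⟨t, rfl⟩; exact hp.psi_le_one t⟩⟩
  -- The only equilibrium with positive first component and the relation `b x (1 - y) = 0` is `(1,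
  -- 1)`.
  obtain ⟨q1, q2⟩ := hp.limit_eq hr0 hr1 hb hc hβ (l := atTop)
    (fun s => tendsto_atTop_add_const_right _ s tendsto_id) hL1 hL2
  have hL1pos : 0 < L1 := (hpos 0).trans_le (hp.mono_phi.ge_of_tendsto hL1 0)
  have hL2e : L2 = 1 := by
    have := (mul_eq_zero.1 q2).resolve_left (mul_pos hb hL1pos).ne'
    linarith
  subst hL2e
  have hL1e : L1 = 1 := by
    have := (mul_eq_zero.1 q1).resolve_left hL1pos.ne'
    linarith
  subst hL1e
  refine ⟨C1, contDiff_const.sub C2, fun n ν hν => ?_, hpos, fun t => sub_pos.2 (hlt t),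
    hp.mono_phi, fun t s hts => by have := hp.mono_psi hts; linarith, hφ,
    by simpa using (tendsto_const_nhds (x := (1:ℝ))).sub hψ, hL1,
    by simpa using (tendsto_const_nhds (x := (1:ℝ))).sub hL2⟩
  have lin : ∀ (x : EuclideanSpace ℝ (Fin n)) t, HasDerivAt (fun t => ⟪ν, x⟫_ℝ + c * t) c t :=
    fun x t => by simpa using ((hasDerivAt_id t).const_mul c).const_add ⟪ν, x⟫_ℝ
  have t1 := fun x t => (dφ (⟪ν, x⟫_ℝ + c * t)).comp t (lin x t)
  have t2 := fun x t => ((dψ (⟪ν, x⟫_ℝ + c * t)).const_sub 1).comp t (lin x t)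
  have sm : ∀ t, ContDiff ℝ 2 fun x : EuclideanSpace ℝ (Fin n) => ⟪ν, x⟫_ℝ + c * t := fun t =>
    (contDiff_const.inner ℝ contDiff_id).add contDiff_const
  refine ⟨fun x t => (t1 x t).differentiableAt, fun x t => (t2 x t).differentiableAt,
    fun t => C1.comp (sm t), fun t => (contDiff_const.sub C2).comp (sm t), fun t x => ?_,
    fun t x => ?_⟩
  · rw [laplacian_planeWave dφ d2φ hν]
    refine (t1 x t).deriv.trans ?_
    rw [show ⟪ν, x⟫_ℝ + c * (t - h) = ⟪ν, x⟫_ℝ + c * t - c * h by ring]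
    unfold sourcePhi
    ring
  · rw [laplacian_planeWave (fun t => (dψ t).const_sub 1) (fun t => (d2ψ t).neg) hν]
    refine (t2 x t).deriv.trans ?_
    unfold sourcePsi
    ring

end profile

/-! ### Gluing upper solutions and cutting off lower solutions. -/

/-- `P` up to `x₁`, `min P Φ` on `(x₁, x₂]`, and `min Φ 1` beyond. -/
noncomputable def glue (P Φ : ℝ → ℝ) (x₁ x₂ t : ℝ) : ℝ :=
  if t ≤ x₁ then P t else if t ≤ x₂ then min (P t) (Φ t) else min (Φ t) 1

/-- Conditions under which `glue P Φ x₁ x₂` is continuous and monotone. -/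
structure IsGlueable (P Φ : ℝ → ℝ) (x₁ x₂ : ℝ) : Prop where
  lt : x₁ < x₂
  cont_left : ContinuousOn P (Iic x₂)
  cont_right : Continuous Φ
  mono_left : MonotoneOn P (Iic x₂)
  mono_right : Monotone Φ
  left_nonneg : ∀ t ≤ x₂, 0 ≤ P t
  right_nonneg : ∀ t, 0 ≤ Φ t
  left_le_one : P x₂ ≤ 1
  right_le_one : Φ x₂ ≤ 1
  lt_at_left : P x₁ < Φ x₁
  lt_at_right : Φ x₂ < P x₂

namespace IsGlueable

variable {P Φ : ℝ → ℝ} {x₁ x₂ : ℝ} (H : IsGlueable P Φ x₁ x₂)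
include H

theorem continuous_glue : Continuous (glue P Φ x₁ x₂) := by
  have hP : Continuous fun t => P (min t x₂) :=
    H.cont_left.comp_continuous (by fun_prop) fun t => mem_Iic.2 (min_le_right _ _)
  have hΦ := H.cont_right
  have e : glue P Φ x₁ x₂ = fun t => if t ≤ x₁ then P (min t x₂) else
      if t ≤ x₂ then min (P (min t x₂)) (Φ t) else min (Φ t) 1 := by
    ext t
    unfold glue
    split_ifs with h1 h2
    · rw [min_eq_left (h1.trans H.lt.le)]
    · rw [min_eq_left h2]
    · rfl
  rw [e]
  refine Continuous.if_le hP (Continuous.if_le (hP.min hΦ) (hΦ.min continuous_const) continuous_id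
    continuous_const ?_) continuous_id continuous_const ?_
  · rintro t rfl
    rw [min_self, min_eq_right H.lt_at_right.le, min_eq_left H.right_le_one]
  · rintro t rfl
    rw [if_pos H.lt.le, min_eq_left H.lt.le, min_eq_left H.lt_at_left.le]

theorem le_one_of_le {t : ℝ} (ht : t ≤ x₂) : P t ≤ 1 :=
  (H.mono_left ht self_mem_Iic ht).trans H.left_le_one

omit H in
theorem glue_le_left {t : ℝ} (ht : t ≤ x₂) : glue P Φ x₁ x₂ t ≤ P t := by
  unfold glue
  split_ifs
  exacts [le_rfl, min_le_left _ _]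

theorem glue_le_right {t : ℝ} (ht : x₁ ≤ t) : glue P Φ x₁ x₂ t ≤ Φ t := by
  unfold glue
  split_ifs with h1
  · rw [le_antisymm h1 ht]; exact H.lt_at_left.le
  exacts [min_le_right _ _, min_le_left _ _]

theorem glue_le_one (t : ℝ) : glue P Φ x₁ x₂ t ≤ 1 := by
  rcases le_or_gt t x₂ with h | h
  · exact (IsGlueable.glue_le_left h).trans (H.le_one_of_le h)
  · unfold glue
    rw [if_neg (by linarith [H.lt]), if_neg h.not_ge]
    exact min_le_right _ _

theorem glue_nonneg (t : ℝ) : 0 ≤ glue P Φ x₁ x₂ t := by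
  unfold glue
  split_ifs with h1 h2
  · exact H.left_nonneg t (h1.trans H.lt.le)
  · exact le_min (H.left_nonneg t h2) (H.right_nonneg t)
  · exact le_min (H.right_nonneg t) zero_le_one

/-- The strict inequalities at `x₁` and `x₂` ensure that an active branch never becomes active only
at the edge of its range; it therefore bounds the glued function from above in a neighbourhood. -/
theorem glue_cases (t : ℝ) : (t < x₂ ∧ glue P Φ x₁ x₂ t = P t) ∨
    (x₁ < t ∧ glue P Φ x₁ x₂ t = Φ t ∧ Φ t ≤ 1) ∨ (x₂ < t ∧ glue P Φ x₁ x₂ t = 1) := by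
  have hlt := H.lt
  rcases le_or_gt t x₁ with h1 | h1
  · exact Or.inl ⟨by linarith, if_pos h1⟩
  rcases le_or_gt t x₂ with h2 | h2
  · have e : glue P Φ x₁ x₂ t = min (P t) (Φ t) := by
      unfold glue; rw [if_neg h1.not_ge, if_pos h2]
    rcases le_or_gt (Φ t) (P t) with h3 | h3
    · rw [min_eq_right h3] at e
      exact Or.inr (Or.inl ⟨h1, e, h3.trans (H.le_one_of_le h2)⟩)
    · rw [min_eq_left h3.le] at e
      refine Or.inl ⟨h2.lt_of_ne ?_, e⟩
      rintro rfl
      exact (H.lt_at_right.trans h3).false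
  · have e : glue P Φ x₁ x₂ t = min (Φ t) 1 := by
      unfold glue; rw [if_neg h1.not_ge, if_neg h2.not_ge]
    rcases le_or_gt (Φ t) 1 with h3 | h3
    · rw [min_eq_left h3] at e
      exact Or.inr (Or.inl ⟨h1, e, h3⟩)
    · rw [min_eq_right h3.le] at e
      exact Or.inr (Or.inr ⟨h2, e⟩)

theorem monotone_glue : Monotone (glue P Φ x₁ x₂) := by
  intro s t hst
  have hlt := H.lt
  rcases H.glue_cases t with ⟨ht, e⟩ | ⟨ht, e, -⟩ | ⟨-, e⟩
  · rw [e]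
    exact (IsGlueable.glue_le_left (hst.trans ht.le)).trans (H.mono_left (hst.trans ht.le) ht.le hst)
  · rw [e]
    rcases le_or_gt x₁ s with hs | hs
    · exact (H.glue_le_right hs).trans (H.mono_right hst)
    · exact (IsGlueable.glue_le_left (by linarith)).trans ((H.mono_left (show s ≤ x₂ by linarith) hlt.le hs.le).trans
        (H.lt_at_left.le.trans (H.mono_right ht.le)))
  · rw [e]; exact H.glue_le_one s

/-- A minimum of supersolutions is a supersolution in the touching sense, since the active branch is
itself a test function. No condition on derivative jumps is needed. -/
theorem isSuperAt_glue {P1 P2 Φ1 Φ2 : ℝ → ℝ} {c n t₀ : ℝ}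
    (dP : ∀ t < x₂, HasDerivAt P (P1 t) t ∧ HasDerivAt P1 (P2 t) t)
    (dΦ : ∀ t, HasDerivAt Φ (Φ1 t) t ∧ HasDerivAt Φ1 (Φ2 t) t)
    (hP : t₀ < x₂ → glue P Φ x₁ x₂ t₀ = P t₀ → P2 t₀ - c * P1 t₀ + n ≤ 0)
    (hΦ : x₁ < t₀ → glue P Φ x₁ x₂ t₀ = Φ t₀ → Φ t₀ ≤ 1 → Φ2 t₀ - c * Φ1 t₀ + n ≤ 0)
    (h1 : glue P Φ x₁ x₂ t₀ = 1 → n ≤ 0) : IsSuperAt c (glue P Φ x₁ x₂) n t₀ := by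
  rcases H.glue_cases t₀ with ⟨ht, e⟩ | ⟨ht, e, e1⟩ | ⟨-, e⟩
  · exact ⟨P, P1, P2 t₀, (eventually_lt_nhds ht).mono fun t h => IsGlueable.glue_le_left (le_of_lt h), e,
      (eventually_lt_nhds ht).mono fun t h => (dP t h).1, (dP t₀ ht).2, hP ht e⟩
  · exact ⟨Φ, Φ1, Φ2 t₀, (eventually_gt_nhds ht).mono fun t h => H.glue_le_right (le_of_lt h), e,
      Eventually.of_forall fun t => (dΦ t).1, (dΦ t₀).2, hΦ ht e e1⟩
  · exact ⟨fun _ => 1, fun _ => 0, 0, Eventually.of_forall H.glue_le_one, e,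
      Eventually.of_forall fun t => hasDerivAt_const _ _, hasDerivAt_const _ _, by
        simpa using h1 e⟩

end IsGlueable

/-- The positive part of `f`, cut off at `x`. -/
noncomputable def cutoff (f : ℝ → ℝ) (x t : ℝ) : ℝ := if t ≤ x then max 0 (f t) else 0

section cutoff

variable {f f1 f2 : ℝ → ℝ} {x : ℝ}

theorem cutoff_nonneg (t : ℝ) : 0 ≤ cutoff f x t := by
  unfold cutoff; split_ifs
  exacts [le_max_left _ _, le_rfl]

theorem le_cutoff {t : ℝ} (ht : t ≤ x) : f t ≤ cutoff f x t := by
  unfold cutoff; rw [if_pos ht]; exact le_max_right _ _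

theorem continuous_cutoff (hf : ContinuousOn f (Iic x)) (hx : f x ≤ 0) : Continuous (cutoff f x) := by
  have hP : Continuous fun t => f (min t x) :=
    hf.comp_continuous (by fun_prop) fun t => mem_Iic.2 (min_le_right _ _)
  have e : cutoff f x = fun t => if t ≤ x then max 0 (f (min t x)) else 0 := by
    ext t
    unfold cutoff
    split_ifs with h1
    · rw [min_eq_left h1]
    · rfl
  rw [e]
  refine Continuous.if_le (continuous_const.max hP) continuous_const continuous_id continuous_const ?_
  rintro t rfl
  rw [min_self, max_eq_left hx]

theorem cutoff_cases (hx : f x ≤ 0) (t : ℝ) :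
    cutoff f x t = 0 ∨ (t < x ∧ 0 < f t ∧ cutoff f x t = f t) := by
  unfold cutoff
  split_ifs with h
  · rcases le_or_gt (f t) 0 with h0 | h0
    · exact Or.inl (max_eq_left h0)
    · refine Or.inr ⟨h.lt_of_ne ?_, h0, max_eq_right h0.le⟩
      rintro rfl; linarith
  · exact Or.inl rfl

/-- Dually, a maximum with the subsolution `0` is a subsolution: the active branch touches from
below. -/
theorem isSubAt_cutoff {c n t₀ : ℝ} (hx : f x ≤ 0)
    (df : ∀ t < x, HasDerivAt f (f1 t) t ∧ HasDerivAt f1 (f2 t) t)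
    (h0 : cutoff f x t₀ = 0 → 0 ≤ n)
    (h1 : t₀ < x → 0 < f t₀ → cutoff f x t₀ = f t₀ → 0 ≤ f2 t₀ - c * f1 t₀ + n) :
    IsSubAt c (cutoff f x) n t₀ := by
  rcases cutoff_cases hx t₀ with e | ⟨ht, hp, e⟩
  · exact ⟨fun _ => 0, fun _ => 0, 0, Eventually.of_forall cutoff_nonneg, e,
      Eventually.of_forall fun t => hasDerivAt_const _ _, hasDerivAt_const _ _, by
        simpa using h0 e⟩
  · exact ⟨f, f1, f2 t₀, (eventually_lt_nhds ht).mono fun t h => le_cutoff (le_of_lt h), e,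
      (eventually_lt_nhds ht).mono fun t h => (df t h).1, (df t₀ ht).2, h1 ht hp e⟩

end cutoff

/-! ### From local pairs near `-∞` to global upper and lower solutions. -/

/-- The pair `(p, q)`, with derivatives `p1, p2, q1, q2`, is at `t` twice differentiable and
positive. -/
structure IsSmoothPairAt (p p1 p2 q q1 q2 : ℝ → ℝ) (t : ℝ) : Prop where
  dp : HasDerivAt p (p1 t) t
  dp1 : HasDerivAt p1 (p2 t) t
  dq : HasDerivAt q (q1 t) t
  dq1 : HasDerivAt q1 (q2 t) t
  p_pos : 0 < p t
  q_pos : 0 < q t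

/-- The pair `(p, q)` is at `t` a non-decreasing upper solution. -/
structure IsUpperPairAt (r b c d : ℝ) (p p1 p2 q q1 q2 : ℝ → ℝ) (t : ℝ) : Prop
    extends IsSmoothPairAt p p1 p2 q q1 q2 t where
  p1_nonneg : 0 ≤ p1 t
  q1_nonneg : 0 ≤ q1 t
  super_p : p2 t - c * p1 t + p t * (1 - r - p t + r * q (t - d)) ≤ 0
  super_q : q2 t - c * q1 t + b * p t * (1 - q t) ≤ 0

/-- The pair `(p, q)` is at `t` a lower solution. -/
structure IsLowerPairAt (r b c d : ℝ) (p p1 p2 q q1 q2 : ℝ → ℝ) (t : ℝ) : Prop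
    extends IsSmoothPairAt p p1 p2 q q1 q2 t where
  sub_p : 0 ≤ p2 t - c * p1 t + p t * (1 - r - p t + r * q (t - d))
  sub_q : 0 ≤ q2 t - c * q1 t + b * p t * (1 - q t)

/-- For `y ≤ 1`, replacing `ψ` by `y` gives a function affine in `y`, nonpositive at `y = 0` by `hC`
and at `y = 1` by `hB`. For `y > 1` the bound `ψ ≤ 1` takes over. -/
theorem pushed_reaction_nonpos {r C B y ψ : ℝ} (hr : 0 < r) (hC : 1 - r ≤ C) (hB : 1 - C ≤ B)
    (hB0 : 0 ≤ B) (hy : 0 ≤ y) (h1 : ψ ≤ y) (h2 : ψ ≤ 1) : 1 - r - C - B * y + r * ψ ≤ 0 := by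
  rcases le_or_gt y 1 with hy1 | hy1
  · nlinarith [mul_nonneg (sub_nonneg.2 hC) (sub_nonneg.2 hy1), mul_nonneg hy (sub_nonneg.2 hB),
      mul_nonneg hr.le (sub_nonneg.2 h1)]
  · nlinarith [mul_nonneg hr.le (sub_nonneg.2 h2), mul_nonneg hB0 (sub_nonneg.2 hy1.le)]

/-- The added exponential contributes the strictly negative linear term `-A e (μ (c - μ) - (1 -
r))`. By `hs` this gap, divided by `A e`, exceeds the coefficients of the cross terms; `k = p / A`
measures `p e'` in units of `A e`. -/
theorem perturbed_super_phi {r c μ A p p1 p2 q e e' ψ k : ℝ} (hr0 : 0 < r) (hr1 : r ≤ 1)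
    (hA : 0 < A) (hp : 0 < p) (hq : 0 < q) (he : 0 < e) (he' : 0 < e') (hee : e' ≤ e)
    (hk : k * A = p) (hψ : ψ ≤ q + e') (hs : q + e' + k ≤ μ * (c - μ) - (1 - r))
    (hsup : p2 - c * p1 + p * (1 - r - p + r * q) ≤ 0) :
    p2 + A * (μ * (μ * e)) - c * (p1 + A * (μ * e)) + (p + A * e) * (1 - r - (p + A * e) + r * ψ)
      ≤ 0 := by
  have hP : 0 < p + A * e := by positivity
  have k1 : (p + A * e) * (r * ψ) ≤ (p + A * e) * (r * (q + e')) :=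
    mul_le_mul_of_nonneg_left (mul_le_mul_of_nonneg_left hψ hr0.le) hP.le
  have k3 := mul_le_mul_of_nonneg_left hs (mul_nonneg hA.le he.le)
  have k4 : p * e' ≤ p * e := by gcongr
  have k5 : A * e * k = e * p := by rw [← hk]; ring
  have k6 : r * (A * e * (q + e') + p * e') ≤ A * e * (q + e') + p * e' :=
    mul_le_of_le_one_left (by positivity) hr1
  have k7 : 0 < A * e * p := by positivity
  have k8 : 0 ≤ (A * e) ^ 2 := sq_nonneg _
  linarith

theorem perturbed_sub_phi {r c μ A p p1 p2 q e e' ψ k : ℝ} (hr0 : 0 < r) (hr1 : r ≤ 1)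
    (hA : 0 < A) (hp : 0 < p) (hq : 0 < q) (he : 0 < e) (he' : 0 < e') (hee : e' ≤ e)
    (hpe : 0 < p - A * e)
    (hk : k * A = p) (hψ : q - e' ≤ ψ) (hs : q + k ≤ μ * (c - μ) - (1 - r))
    (hsub : 0 ≤ p2 - c * p1 + p * (1 - r - p + r * q)) :
    0 ≤ p2 - A * (μ * (μ * e)) - c * (p1 - A * (μ * e))
      + (p - A * e) * (1 - r - (p - A * e) + r * ψ) := by
  have k1 : (p - A * e) * (r * (q - e')) ≤ (p - A * e) * (r * ψ) :=
    mul_le_mul_of_nonneg_left (mul_le_mul_of_nonneg_left hψ hr0.le) hpe.le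
  have k3 := mul_le_mul_of_nonneg_left hs (mul_nonneg hA.le he.le)
  have k4 : p * e' ≤ p * e := by gcongr
  have k5 : A * e * k = e * p := by rw [← hk]; ring
  have k6 : r * (A * e * q + p * e') ≤ A * e * q + p * e' :=
    mul_le_of_le_one_left (by positivity) hr1
  have k7 : 0 ≤ r * (A * e * e') := by positivity
  have k8 : 0 < A * e * p := by positivity
  have k9 : 0 < A * e * (p - A * e) := by positivity
  linarith

/-- The choice `A b = μ (c - μ)` cancels the terms linear in `e` alone; all remaining products have
the favourable sign. -/
theorem perturbed_super_psi {b c μ A p q q1 q2 e φ : ℝ} (hb : 0 < b)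
    (hA : 0 < A) (hAb : A * b = μ * (c - μ)) (hp : 0 < p) (hq : 0 < q) (he : 0 < e)
    (hφ : φ ≤ p + A * e) (hq1 : q + e ≤ 1)
    (hsup : q2 - c * q1 + b * p * (1 - q) ≤ 0) :
    q2 + μ * (μ * e) - c * (q1 + μ * e) + b * φ * (1 - (q + e)) ≤ 0 := by
  have k1 : b * φ * (1 - (q + e)) ≤ b * (p + A * e) * (1 - (q + e)) := by
    have : 0 ≤ 1 - (q + e) := by linarith
    gcongr
  have k2 : A * b * e = μ * (c - μ) * e := by rw [← hAb]
  have k3 : 0 < b * p * e := by positivity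
  have k4 : 0 < b * (A * e) * (q + e) := by positivity
  linarith

/-- The linear terms cancel as for the upper solution. Where `p < A e` the lower bound on `φ` is
negative and useless, and positivity of `φ` replaces it. -/
theorem perturbed_sub_psi {b c μ A p q q1 q2 e φ : ℝ} (hb : 0 < b)
    (hA : 0 < A) (hAb : A * b = μ * (c - μ)) (hp : 0 < p) (hq : 0 < q) (he : 0 < e)
    (hφ : p - A * e ≤ φ) (hφ0 : 0 ≤ φ) (hq1 : q ≤ 1)
    (hsub : 0 ≤ q2 - c * q1 + b * p * (1 - q)) :
    0 ≤ q2 - μ * (μ * e) - c * (q1 - μ * e) + b * φ * (1 - (q - e)) := by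
  have k2 : A * b * e = μ * (c - μ) * e := by rw [← hAb]
  have k3 : p * (1 - q) - A * e ≤ φ * (1 - (q - e)) := by
    rcases le_or_gt (A * e) p with hle | hle
    · have : (p - A * e) * (1 - (q - e)) ≤ φ * (1 - (q - e)) := by
        have : 0 ≤ 1 - (q - e) := by linarith
        gcongr
      have k4 : 0 ≤ (p - A * e) * e := mul_nonneg (sub_nonneg.2 hle) he.le
      have k5 : 0 < A * e * q := by positivity
      linarith
    · have : 0 ≤ φ * (1 - (q - e)) := mul_nonneg hφ0 (by linarith)
      have : 0 < p * q := by positivity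
      linarith
  have := mul_le_mul_of_nonneg_left k3 hb.le
  linarith

section localPairs

variable {r b c h κ μ A T x₁ x₂ : ℝ} {p p1 p2 q q1 q2 : ℝ → ℝ}

/-- `κ e^{μ (t - T)}`. -/
noncomputable def expAt (κ μ T t : ℝ) : ℝ := κ * Real.exp (μ * (t - T))

theorem hasDerivAt_expAt (κ μ T t : ℝ) : HasDerivAt (expAt κ μ T) (expAt (μ * κ) μ T t) t := by
  have := (((hasDerivAt_id t).sub_const T).const_mul μ).exp.const_mul κ
  refine this.congr_deriv ?_
  simp only [expAt, id]
  ring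

theorem expAt_mul (a κ μ T t : ℝ) : expAt (a * κ) μ T t = a * expAt κ μ T t := by
  unfold expAt; ring

theorem expAt_pos (hκ : 0 < κ) (μ T t : ℝ) : 0 < expAt κ μ T t :=
  mul_pos hκ (Real.exp_pos _)

theorem expAt_mono (hκ : 0 < κ) (hμ : 0 ≤ μ) (T : ℝ) : Monotone (expAt κ μ T) := fun s t hst =>
  mul_le_mul_of_nonneg_left (Real.exp_le_exp.2 (by gcongr)) hκ.le

theorem continuous_expAt : Continuous (expAt κ μ T) := by
  unfold expAt; fun_prop

/-- The global upper solution. -/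
theorem isUpperPair_glue (hr0 : 0 < r) (hr1 : r ≤ 1) (hb : 0 < b) (hc : 0 < c) (hh : 0 ≤ h)
    (hκ : 0 < κ) (hμ : 0 < μ) (hA : A * b = μ * (c - μ)) (hA0 : 0 < A)
    (hlin : 1 - r < c ^ 2 / 4) (hnl : 1 ≤ c ^ 2 / 4 * (1 + 1 / bPrime b h c))
    (hloc : ∀ t ≤ x₂, IsUpperPairAt r b c (c * h) p p1 p2 q q1 q2 t)
    (hx : x₁ < x₂)
    (l1 : p x₁ + A * expAt κ μ T x₁ < c ^ 2 / (4 * b) * expAt κ (c / 2) T x₁)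
    (l2 : q x₁ + expAt κ μ T x₁ < expAt κ (c / 2) T x₁)
    (r1 : c ^ 2 / (4 * b) * expAt κ (c / 2) T x₂ < p x₂ + A * expAt κ μ T x₂)
    (r2 : expAt κ (c / 2) T x₂ < q x₂ + expAt κ μ T x₂)
    (o1 : p x₂ + A * expAt κ μ T x₂ ≤ 1) (o2 : q x₂ + expAt κ μ T x₂ ≤ 1)
    (s1 : q x₂ + expAt κ μ T x₂ + p x₂ / A ≤ μ * (c - μ) - (1 - r))
    (s2 : q x₂ + expAt κ μ T x₂ ≤ c ^ 2 / 4 - (1 - r)) :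
    IsUpperPair r b c (c * h)
      (glue (fun t => p t + A * expAt κ μ T t) (fun t => c ^ 2 / (4 * b) * expAt κ (c / 2) T t)
        x₁ x₂)
      (glue (fun t => q t + expAt κ μ T t) (fun t => expAt κ (c / 2) T t) x₁ x₂) ∧
    ∀ t ≤ x₁, glue (fun t => p t + A * expAt κ μ T t)
        (fun t => c ^ 2 / (4 * b) * expAt κ (c / 2) T t) x₁ x₂ t = p t + A * expAt κ μ T t ∧
      glue (fun t => q t + expAt κ μ T t) (fun t => expAt κ (c / 2) T t) x₁ x₂ t
        = q t + expAt κ μ T t := by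
  have hd : 0 ≤ c * h := by positivity
  have mp : MonotoneOn p (Iic x₂) := monotoneOn_of_hasDerivWithinAt_nonneg (convex_Iic _)
    (fun t ht => (hloc t ht).dp.continuousAt.continuousWithinAt)
    (fun t ht => (hloc t (mem_Iic.1 (interior_subset ht))).dp.hasDerivWithinAt)
    (fun t ht => (hloc t (mem_Iic.1 (interior_subset ht))).p1_nonneg)
  have mq : MonotoneOn q (Iic x₂) := monotoneOn_of_hasDerivWithinAt_nonneg (convex_Iic _)
    (fun t ht => (hloc t ht).dq.continuousAt.continuousWithinAt)
    (fun t ht => (hloc t (mem_Iic.1 (interior_subset ht))).dq.hasDerivWithinAt)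
    (fun t ht => (hloc t (mem_Iic.1 (interior_subset ht))).q1_nonneg)
  have me := expAt_mono (κ := κ) (μ := μ) hκ hμ.le T
  have ms := expAt_mono (κ := κ) (μ := c / 2) hκ (by positivity) T
  have pe := expAt_pos hκ μ T
  have ps := expAt_pos hκ (c / 2) T
  have mono_e : ∀ t, expAt κ μ T (t - c * h) ≤ expAt κ μ T t := fun t => me (by linarith)
  have hE := hasDerivAt_expAt κ μ T
  have hS := hasDerivAt_expAt κ (c / 2) T
  simp only [expAt_mul] at hE hS
  have hE2 := fun t => (hE t).const_mul μ
  have hS2 := fun t => (hS t).const_mul (c / 2)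
  have G1 : IsGlueable (fun t => p t + A * expAt κ μ T t)
      (fun t => c ^ 2 / (4 * b) * expAt κ (c / 2) T t) x₁ x₂ := by
    refine ⟨hx, ?_, by have := @continuous_expAt κ (c / 2) T; fun_prop, ?_, ?_, ?_, ?_, o1, by linarith, l1, r1⟩
    · exact ContinuousOn.add (fun t ht => (hloc t ht).dp.continuousAt.continuousWithinAt)
        (continuous_expAt.const_mul A).continuousOn
    · exact fun s hs t ht hst => add_le_add (mp hs ht hst) (mul_le_mul_of_nonneg_left (me hst) hA0.le)
    · exact fun s t hst => mul_le_mul_of_nonneg_left (ms hst) (by positivity)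
    · exact fun t ht => add_nonneg (hloc t ht).p_pos.le (mul_nonneg hA0.le (pe t).le)
    · exact fun t => mul_nonneg (by positivity) (ps t).le
  have G2 : IsGlueable (fun t => q t + expAt κ μ T t)
      (fun t => expAt κ (c / 2) T t) x₁ x₂ := by
    refine ⟨hx, ?_, continuous_expAt, ?_, ms, ?_, fun t => (ps t).le, o2, by linarith, l2, r2⟩
    · exact ContinuousOn.add (fun t ht => (hloc t ht).dq.continuousAt.continuousWithinAt)
        continuous_expAt.continuousOn
    · exact fun s hs t ht hst => add_le_add (mq hs ht hst) (me hst)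
    · exact fun t ht => add_nonneg (hloc t ht).q_pos.le (pe t).le
  refine ⟨⟨G1.continuous_glue, G2.continuous_glue, G1.monotone_glue, G2.monotone_glue,
    G1.glue_nonneg, G2.glue_nonneg, G1.glue_le_one, G2.glue_le_one, fun t => ?_, fun t => ?_⟩,
    fun t ht => ⟨if_pos ht, if_pos ht⟩⟩
  · refine G1.isSuperAt_glue (P1 := fun t => p1 t + A * (μ * expAt κ μ T t))
      (P2 := fun t => p2 t + A * (μ * (μ * expAt κ μ T t)))
      (Φ1 := fun t => c ^ 2 / (4 * b) * (c / 2 * expAt κ (c / 2) T t))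
      (Φ2 := fun t => c ^ 2 / (4 * b) * (c / 2 * (c / 2 * expAt κ (c / 2) T t)))
      (fun t ht => ⟨(hloc t ht.le).dp.add ((hE t).const_mul A), (hloc t ht.le).dp1.add
        ((hE2 t).const_mul A)⟩)
      (fun t => ⟨(hS t).const_mul _, (hS2 t).const_mul _⟩) (fun ht e => ?_) (fun ht e e1 => ?_)
      (fun e => ?_)
    · rw [e]
      have hth : t - c * h ≤ x₂ := by linarith
      have hq1 : q (t - c * h) ≤ q x₂ := mq hth self_mem_Iic hth
      have hp1 : p t ≤ p x₂ := mp ht.le self_mem_Iic ht.le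
      have hqp := (hloc _ hth).q_pos
      have hpp := (hloc _ ht.le).p_pos
      have hsup := (hloc t ht.le).super_p
      have he := mono_e t
      have hpe := pe t
      have hex := me ht.le
      refine perturbed_super_phi hr0 hr1 hA0 hpp hqp hpe (pe _) he (k := p t / A)
        (div_mul_cancel₀ _ hA0.ne') (IsGlueable.glue_le_left hth) ?_ hsup
      have : p t / A ≤ p x₂ / A := by gcongr
      linarith
    · rw [e]
      have hps := ps t
      have key : 1 - r - c ^ 2 / 4 - c ^ 2 / (4 * b) * expAt κ (c / 2) T t
          + r * glue (fun t => q t + expAt κ μ T t) (fun t => expAt κ (c / 2) T t) x₁ x₂ (t - c * h)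
          ≤ 0 := by
        have h4b : 0 < c ^ 2 / (4 * b) * expAt κ (c / 2) T t := by positivity
        -- If the delayed point lies to the right of `x₁`, `ψ` there is bounded by both the
        -- exponential and `1`. Otherwise it is bounded by the left branch at `x₂`, which is small
        -- by `s2`.
        rcases le_or_gt x₁ (t - c * h) with hx1 | hx1
        · have g1 := G2.glue_le_right hx1
          have g2 := G2.glue_le_one (t - c * h)
          -- A delay `c h` at rate `c / 2` costs the factor `e^{-c² h / 2}`, which turns `b` into
          -- `b'`.
          have hE : expAt κ (c / 2) T (t - c * h) = Real.exp (-(c ^ 2 * h / 2)) * expAt κ (c / 2) T t := by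
            unfold expAt
            rw [mul_left_comm, ← Real.exp_add]
            ring_nf
          rw [hE] at g1
          unfold bPrime at hnl
          have hEp := Real.exp_pos (-(c ^ 2 * h / 2))
          generalize Real.exp (-(c ^ 2 * h / 2)) = E at *
          generalize expAt κ (c / 2) T t = s at *
          generalize glue (fun t => q t + expAt κ μ T t) (fun t => expAt κ (c / 2) T t) x₁ x₂ (t - c * h) = ψ at *
          have e1 : c ^ 2 / (4 * b) * s = c ^ 2 / 4 * (1 / (b * E)) * (E * s) := by field_simp
          rw [e1]
          have e2 : 1 - c ^ 2 / 4 ≤ c ^ 2 / 4 * (1 / (b * E)) := by linarith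
          have hB0 : 0 ≤ c ^ 2 / 4 * (1 / (b * E)) := by positivity
          generalize c ^ 2 / 4 * (1 / (b * E)) = B at *
          have hEs : 0 < E * s := by positivity
          generalize E * s = y at *
          exact pushed_reaction_nonpos hr0 hlin.le e2 hB0 hEs.le g1 g2
        · have g2 := G2.mono_left (show t - c * h ≤ x₂ by linarith) (self_mem_Iic) (show t - c * h ≤ x₂ by linarith)
          have g0 := G2.glue_nonneg (t - c * h)
          have g3 : glue (fun t => q t + expAt κ μ T t) (fun t => expAt κ (c / 2) T t) x₁ x₂
              (t - c * h) ≤ q x₂ + expAt κ μ T x₂ :=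
            le_trans (IsGlueable.glue_le_left (show t - c * h ≤ x₂ by linarith)) g2
          have : r * glue (fun t => q t + expAt κ μ T t) (fun t => expAt κ (c / 2) T t) x₁ x₂ (t - c * h)
            ≤ 1 * glue (fun t => q t + expAt κ μ T t) (fun t => expAt κ (c / 2) T t) x₁ x₂ (t - c * h) := by
              gcongr
          linarith
      have h4b : 0 < c ^ 2 / (4 * b) * expAt κ (c / 2) T t := by positivity
      have := mul_nonneg h4b.le (sub_nonneg.2 key)
      linarith
    · rw [e]
      have := mul_le_mul_of_nonneg_left (G2.glue_le_one (t - c * h)) hr0.le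
      linarith
  · refine G2.isSuperAt_glue (P1 := fun t => q1 t + μ * expAt κ μ T t)
      (P2 := fun t => q2 t + μ * (μ * expAt κ μ T t))
      (Φ1 := fun t => c / 2 * expAt κ (c / 2) T t)
      (Φ2 := fun t => c / 2 * (c / 2 * expAt κ (c / 2) T t))
      (fun t ht => ⟨(hloc t ht.le).dq.add (hE t), (hloc t ht.le).dq1.add (hE2 t)⟩)
      (fun t => ⟨hS t, hS2 t⟩) (fun ht e => ?_) (fun ht e e1 => ?_)
      (fun e => ?_)
    · rw [e]
      have hq1 := G2.le_one_of_le ht.le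
      have hsup := (hloc t ht.le).super_q
      have hpp := (hloc _ ht.le).p_pos
      have hqp := (hloc _ ht.le).q_pos
      have hpe := pe t
      exact perturbed_super_psi hb hA0 hA hpp hqp hpe (IsGlueable.glue_le_left ht.le) hq1 hsup
    · rw [e]
      have hp := G1.glue_le_right ht.le
      have hps := ps t
      beta_reduce at hp
      generalize glue (fun t => p t + A * expAt κ μ T t)
        (fun t => c ^ 2 / (4 * b) * expAt κ (c / 2) T t) x₁ x₂ t = φ at *
      generalize expAt κ (c / 2) T t = s at *
      have k1 : b * φ * (1 - s) ≤ b * (c ^ 2 / (4 * b) * s) * (1 - s) := by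
        have : 0 ≤ 1 - s := by linarith
        gcongr
      have k2 : b * (c ^ 2 / (4 * b) * s) = c ^ 2 / 4 * s := by field_simp
      rw [k2] at k1
      have := mul_nonneg (sq_nonneg c) (sq_nonneg s)
      linarith
    · rw [e]; simp

/-- The global lower solution. -/
theorem isLowerPair_cutoff (hr0 : 0 < r) (hr1 : r ≤ 1) (hb : 0 < b) (hc : 0 < c) (hh : 0 ≤ h)
    (hκ : 0 < κ) (hμ : 0 < μ) (hA : A * b = μ * (c - μ)) (hA0 : 0 < A)
    (hloc : ∀ t ≤ x₁, IsLowerPairAt r b c (c * h) p p1 p2 q q1 q2 t)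
    (l1 : p x₁ ≤ A * expAt κ μ T x₁) (l2 : q x₁ ≤ expAt κ μ T x₁) (o : ∀ t ≤ x₁, q t ≤ 1)
    (s1 : ∀ t ≤ x₁, q (t - c * h) + p t / A ≤ μ * (c - μ) - (1 - r)) :
    IsLowerPair r b c (c * h) (cutoff (fun t => p t - A * expAt κ μ T t) x₁)
      (cutoff (fun t => q t - expAt κ μ T t) x₁) := by
  have hd : 0 ≤ c * h := by positivity
  have me := expAt_mono (κ := κ) (μ := μ) hκ hμ.le T
  have pe := expAt_pos hκ μ T
  have mono_e : ∀ t, expAt κ μ T (t - c * h) ≤ expAt κ μ T t := fun t => me (by linarith)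
  have hE := hasDerivAt_expAt κ μ T
  simp only [expAt_mul] at hE
  have hE2 := fun t => (hE t).const_mul μ
  refine ⟨continuous_cutoff ?_ (by linarith), continuous_cutoff ?_ (by linarith), cutoff_nonneg,
    cutoff_nonneg, fun t => ?_, fun t => ?_⟩
  · exact ContinuousOn.sub (fun t ht => (hloc t ht).dp.continuousAt.continuousWithinAt)
      (continuous_expAt.const_mul A).continuousOn
  · exact ContinuousOn.sub (fun t ht => (hloc t ht).dq.continuousAt.continuousWithinAt)
      continuous_expAt.continuousOn
  · refine isSubAt_cutoff (f1 := fun t => p1 t - A * (μ * expAt κ μ T t))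
      (f2 := fun t => p2 t - A * (μ * (μ * expAt κ μ T t))) (by linarith)
      (fun t ht => ⟨(hloc t ht.le).dp.sub ((hE t).const_mul A), (hloc t ht.le).dp1.sub
        ((hE2 t).const_mul A)⟩) (fun e => by rw [e]; simp) (fun ht hp e => ?_)
    rw [e]
    have hth : t - c * h ≤ x₁ := by linarith
    have hq := le_cutoff (f := fun t => q t - expAt κ μ T t) hth
    have hqp := (hloc _ hth).q_pos
    have hpp := (hloc _ ht.le).p_pos
    have hsub := (hloc t ht.le).sub_p
    have he := mono_e t
    have hpe := pe t
    have hs := s1 t ht.le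
    have hpeh := pe (t - c * h)
    exact perturbed_sub_phi hr0 hr1 hA0 hpp hqp hpe hpeh he hp (k := p t / A)
      (div_mul_cancel₀ _ hA0.ne') hq hs hsub
  · refine isSubAt_cutoff (f1 := fun t => q1 t - μ * expAt κ μ T t)
      (f2 := fun t => q2 t - μ * (μ * expAt κ μ T t)) (by linarith)
      (fun t ht => ⟨(hloc t ht.le).dq.sub (hE t), (hloc t ht.le).dq1.sub (hE2 t)⟩)
      (fun e => by rw [e]; simpa using mul_nonneg hb.le (cutoff_nonneg t)) (fun ht hp e => ?_)
    rw [e]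
    have hφ := le_cutoff (f := fun t => p t - A * expAt κ μ T t) ht.le
    have hφ0 := cutoff_nonneg (f := fun t => p t - A * expAt κ μ T t) (x := x₁) t
    have hpp := (hloc _ ht.le).p_pos
    have hqp := (hloc _ ht.le).q_pos
    have hsub := (hloc t ht.le).sub_q
    have hpe := pe t
    have hq1 := o t ht.le
    exact perturbed_sub_psi hb hA0 hA hpp hqp hpe hφ hφ0 hq1 hsub

end localPairs

/-- Positivity of a finite minimum, as an existence statement. -/
theorem exists_pos_le_four {a b c d : ℝ} (ha : 0 < a) (hb : 0 < b) (hc : 0 < c) (hd : 0 < d) :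
    ∃ x, 0 < x ∧ x ≤ a ∧ x ≤ b ∧ x ≤ c ∧ x ≤ d :=
  ⟨min (min a b) (min c d), lt_min (lt_min ha hb) (lt_min hc hd),
    (min_le_left _ _).trans (min_le_left _ _), (min_le_left _ _).trans (min_le_right _ _),
    (min_le_right _ _).trans (min_le_left _ _), (min_le_right _ _).trans (min_le_right _ _)⟩

set_option maxHeartbeats 400000 in
/-- From upper and lower solutions near `-∞` to a front with the same behaviour at `-∞`. -/
theorem exists_profile_of_local {r b c h β : ℝ} (hr0 : 0 < r) (hr1 : r ≤ 1) (hb : 0 < b)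
    (hc : 0 < c) (hh : 0 ≤ h) (hβ : 2 + c + b ≤ β)
    (hlin : 1 - r < c ^ 2 / 4) (hnl : 1 ≤ c ^ 2 / 4 * (1 + 1 / bPrime b h c))
    {p p1 p2 q q1 q2 P P1 P2 Q Q1 Q2 : ℝ → ℝ}
    (hU : ∀ᶠ t in atBot, IsUpperPairAt r b c (c * h) P P1 P2 Q Q1 Q2 t)
    (hL : ∀ᶠ t in atBot, IsLowerPairAt r b c (c * h) p p1 p2 q q1 q2 t)
    (hpP : ∀ᶠ t in atBot, p t ≤ P t) (hqQ : ∀ᶠ t in atBot, q t ≤ Q t)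
    (hP0 : Tendsto P atBot (𝓝 0)) (hQ0 : Tendsto Q atBot (𝓝 0))
    (hp : ∀ᶠ t in atBot, Real.exp (c / 2 * t) ≤ p t) :
    ∃ φ ψ : ℝ → ℝ, IsProfile r b c (c * h) β φ ψ ∧ Tendsto φ atBot (𝓝 0) ∧ Tendsto ψ atBot (𝓝 0) ∧
      (∃ t, 0 < φ t) ∧ ∃ C μ : ℝ, c / 2 < μ ∧ ∀ᶠ t in atBot,
        p t - C * Real.exp (μ * t) ≤ φ t ∧ φ t ≤ P t + C * Real.exp (μ * t) ∧
        q t - C * Real.exp (μ * t) ≤ ψ t ∧ ψ t ≤ Q t + C * Real.exp (μ * t) := by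
  have hg : 0 < c ^ 2 / 4 - (1 - r) := by linarith
  -- With `μ = c / 2 + δ` one has `μ (c - μ) = c² / 4 - δ²`; a small `δ` keeps this above `1 - r`.
  obtain ⟨δ, hδ, hδc, hδ1, hδg, -⟩ := exists_pos_le_four (show 0 < c / 4 by linarith) one_pos
    (half_pos hg) one_pos
  have hδ2 : δ ^ 2 < c ^ 2 / 4 - (1 - r) := by nlinarith
  obtain ⟨μ, hμ⟩ : ∃ μ, μ = c / 2 + δ := ⟨_, rfl⟩
  have hm : μ * (c - μ) = c ^ 2 / 4 - δ ^ 2 := by rw [hμ]; ring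
  obtain ⟨A, hA⟩ : ∃ A, A = μ * (c - μ) / b := ⟨_, rfl⟩
  have hμ0 : 0 < μ := by linarith
  have hAb : A * b = μ * (c - μ) := by rw [hA]; field_simp
  have hA0 : 0 < A := by rw [hA]; exact div_pos (mul_pos hμ0 (by linarith)) hb
  obtain ⟨B, hB⟩ : ∃ B, B = c ^ 2 / (4 * b) := ⟨_, rfl⟩
  have hAB : A < B := by
    rw [hA, hB, hm, div_lt_div_iff₀ hb (by positivity)]
    nlinarith [mul_pos hb (sq_pos_of_pos hδ)]
  have hB0 : 0 < B := hA0.trans hAB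
  -- After time `τ` past `T`, `A e^{μ τ}` has overtaken `B e^{c τ / 2}`, by `e^{δ τ} ≥ 1 + δ τ`. At
  -- `T - 1` the order is the opposite, so the gluing crossing lies in between.
  obtain ⟨τ, hτ⟩ : ∃ τ, τ = B / A / δ := ⟨_, rfl⟩
  have hτ0 : 0 < τ := by rw [hτ]; positivity
  have hcross : B * Real.exp (c / 2 * τ) ≤ A * Real.exp (μ * τ) := by
    have e1 : Real.exp (μ * τ) = Real.exp (δ * τ) * Real.exp (c / 2 * τ) := by
      rw [← Real.exp_add, hμ]; ring_nf
    have e2 : B / A ≤ Real.exp (δ * τ) := by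
      have : δ * τ = B / A := by rw [hτ]; field_simp
      rw [this]
      linarith [Real.add_one_le_exp (B / A)]
    rw [e1, ← mul_assoc]
    rw [div_le_iff₀ hA0] at e2
    gcongr
    linarith
  have hexp : Real.exp (-μ) < Real.exp (-(c / 2)) := Real.exp_lt_exp.2 (by linarith)
  have hexp' : Real.exp (c / 2 * τ) < Real.exp (μ * τ) :=
    Real.exp_lt_exp.2 (by nlinarith)
  have hem := Real.exp_pos (-μ)
  have hgap : A * Real.exp (-μ) < B * Real.exp (-(c / 2)) := by gcongr
  -- Room, in units of `κ`, for the local pair: at `T - 1` it must fit between the two exponentials,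
  -- and stay below the perturbation so that the lower solution is cut off there.
  obtain ⟨η, hη, hη1, hη2, hη3, hη4⟩ := exists_pos_le_four (sub_pos.2 hgap) (sub_pos.2 hexp)
    (mul_pos hA0 hem) hem
  -- `D` collects every contribution at `x₂` per unit of `κ`; with `κ = ω / D` all smallness
  -- conditions follow from `ω ≤ 1` and from `ω` not exceeding the two spectral gaps.
  obtain ⟨D, hD⟩ : ∃ D, D = η + η / A + (A + B + 1) * Real.exp (μ * τ) := ⟨_, rfl⟩
  have hD0 : 0 < D := by rw [hD]; positivity
  have hmr : 0 < μ * (c - μ) - (1 - r) := by linarith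
  obtain ⟨ω, hω, hω1, hω2, hω3, -⟩ := exists_pos_le_four one_pos hg hmr one_pos
  obtain ⟨κ, hκ⟩ : ∃ κ, κ = ω / D := ⟨_, rfl⟩
  have hκ0 : 0 < κ := by rw [hκ]; positivity
  have hκD : κ * η + κ * η / A + (A + B + 1) * (κ * Real.exp (μ * τ)) = ω := by
    have : κ * D = ω := by rw [hκ]; field_simp
    rw [← this, hD]; ring
  have hκη : 0 < κ * η := by positivity
  -- The amplitude `κ` is fixed first; `x₂` is then taken so far left that the local pair is below
  -- `κ η`, and `T` is placed accordingly.
  obtain ⟨x₂, hx₂⟩ := eventually_atBot.1 (hU.and (hL.and (hpP.and (hqQ.and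
    ((hP0.eventually_lt_const hκη).and (hQ0.eventually_lt_const hκη))))))
  obtain ⟨T, hT⟩ : ∃ T, T = x₂ - τ := ⟨_, rfl⟩
  obtain ⟨x₁, hx₁⟩ : ∃ x₁, x₁ = T - 1 := ⟨_, rfl⟩
  have hx12 : x₁ < x₂ := by linarith
  have v1 : ∀ k ρ, expAt k ρ T x₁ = k * Real.exp (-ρ) := fun k ρ => by
    unfold expAt; rw [hx₁]; ring_nf
  have v2 : ∀ k ρ, expAt k ρ T x₂ = k * Real.exp (ρ * τ) := fun k ρ => by
    unfold expAt; rw [hT]; ring_nf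
  have at2 := hx₂ x₂ le_rfl
  have at1 := hx₂ x₁ hx12.le
  obtain ⟨u2, -, -, -, u5, u6⟩ := at2
  obtain ⟨w1, w2, w3, w4, w5, w6⟩ := at1
  have n1 : 0 < κ * Real.exp (μ * τ) := by positivity
  have n2 : 0 < κ * η / A := by positivity
  have n3 : P x₂ / A < κ * η / A := by gcongr
  have n4 : 0 < A * (κ * Real.exp (μ * τ)) := by positivity
  have n5 : 0 < B * (κ * Real.exp (μ * τ)) := by positivity
  have hup := isUpperPair_glue (κ := κ) (μ := μ) (A := A) (T := T) (x₁ := x₁) (x₂ := x₂) hr0 hr1 hb hc hh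
    hκ0 hμ0 hAb hA0 hlin hnl (fun t ht => (hx₂ t ht).1) hx12
    (by rw [v1, v1, ← hB]; linarith [mul_le_mul_of_nonneg_left hη1 hκ0.le])
    (by rw [v1, v1]; linarith [mul_le_mul_of_nonneg_left hη2 hκ0.le])
    (by rw [v2, v2, ← hB]; linarith [u2.p_pos, mul_le_mul_of_nonneg_left hcross hκ0.le])
    (by rw [v2, v2]; linarith [u2.q_pos, mul_lt_mul_of_pos_left hexp' hκ0])
    (by rw [v2]; linarith) (by rw [v2]; linarith) (by rw [v2]; linarith) (by rw [v2]; linarith)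
  have hle : ∀ t ≤ x₁, p t ≤ P t ∧ q t ≤ Q t := fun t ht =>
    ⟨(hx₂ t (ht.trans hx12.le)).2.2.1, (hx₂ t (ht.trans hx12.le)).2.2.2.1⟩
  have hlow := isLowerPair_cutoff (κ := κ) (μ := μ) (A := A) (T := T) (x₁ := x₁) hr0 hr1 hb hc hh
    hκ0 hμ0 hAb hA0 (fun t ht => (hx₂ t (ht.trans hx12.le)).2.1)
    (by rw [v1]; linarith [mul_le_mul_of_nonneg_left hη3 hκ0.le])
    (by rw [v1]; linarith [mul_le_mul_of_nonneg_left hη4 hκ0.le])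
    (fun t ht => by
      have := (hx₂ t (ht.trans hx12.le)).2.2.2.2.2
      linarith [(hle t ht).2])
    (fun t ht => by
      have hd : 0 ≤ c * h := by positivity
      have a1 := (hx₂ t (ht.trans hx12.le)).2.2.2.2.1
      have a2 := (hx₂ (t - c * h) (by linarith)).2.2.2.2.2
      have a3 := (hle (t - c * h) (by linarith)).2
      have a4 : p t / A ≤ κ * η / A := by
        have := (hle t ht).1
        gcongr
        linarith
      linarith)
  obtain ⟨hup, heq⟩ := hup
  have hpe : ∀ t, 0 < expAt κ μ T t := expAt_pos hκ0 μ T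
  have hLU1 : ∀ t, cutoff (fun t => p t - A * expAt κ μ T t) x₁ t ≤
      glue (fun t => P t + A * expAt κ μ T t) (fun t => c ^ 2 / (4 * b) * expAt κ (c / 2) T t)
        x₁ x₂ t := by
    intro t
    rcases cutoff_cases (f := fun t => p t - A * expAt κ μ T t) (x := x₁) (by
      rw [v1]; linarith [mul_le_mul_of_nonneg_left hη3 hκ0.le]) t with e | ⟨ht, hf, e⟩
    · rw [e]; exact hup.phi_nonneg t
    · rw [e, (heq t ht.le).1]
      have := mul_pos hA0 (hpe t)
      have := (hle t ht.le).1
      linarith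
  have hLU2 : ∀ t, cutoff (fun t => q t - expAt κ μ T t) x₁ t ≤
      glue (fun t => Q t + expAt κ μ T t) (fun t => expAt κ (c / 2) T t) x₁ x₂ t := by
    intro t
    rcases cutoff_cases (f := fun t => q t - expAt κ μ T t) (x := x₁) (by
      rw [v1]; linarith [mul_le_mul_of_nonneg_left hη4 hκ0.le]) t with e | ⟨ht, hf, e⟩
    · rw [e]; exact hup.psi_nonneg t
    · rw [e, (heq t ht.le).2]
      have := hpe t
      have := (hle t ht.le).2
      linarith
  obtain ⟨φ, ψ, hprof, g1, g2, g3, g4⟩ := exists_isProfile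
    (L := (cutoff (fun t => p t - A * expAt κ μ T t) x₁, cutoff (fun t => q t - expAt κ μ T t) x₁))
    (U := (glue (fun t => P t + A * expAt κ μ T t)
      (fun t => c ^ 2 / (4 * b) * expAt κ (c / 2) T t) x₁ x₂,
      glue (fun t => Q t + expAt κ μ T t) (fun t => expAt κ (c / 2) T t) x₁ x₂))
    hr0 hr1 hb hc.le hβ hlow hup hLU1 hLU2
  obtain ⟨K, hK⟩ : ∃ K, K = κ * Real.exp (-(μ * T)) := ⟨_, rfl⟩
  have hK0 : 0 < K := by rw [hK]; positivity
  have hexpAt : ∀ t, expAt κ μ T t = K * Real.exp (μ * t) := fun t => by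
    unfold expAt
    rw [hK, mul_assoc, ← Real.exp_add]; ring_nf
  have hbd : ∀ t ≤ x₁, p t - (A + 1) * K * Real.exp (μ * t) ≤ φ t ∧
      φ t ≤ P t + (A + 1) * K * Real.exp (μ * t) ∧
      q t - (A + 1) * K * Real.exp (μ * t) ≤ ψ t ∧ ψ t ≤ Q t + (A + 1) * K * Real.exp (μ * t) := by
    intro t ht
    have a1 := (le_cutoff (f := fun t => p t - A * expAt κ μ T t) ht).trans (g1 t)
    have a2 := (le_cutoff (f := fun t => q t - expAt κ μ T t) ht).trans (g2 t)
    have a3 := (g3 t).trans_eq (heq t ht).1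
    have a4 := (g4 t).trans_eq (heq t ht).2
    have b1 : 0 < K * Real.exp (μ * t) := by positivity
    have b2 : 0 < A * (K * Real.exp (μ * t)) := by positivity
    simp only [hexpAt] at a1 a2 a3 a4
    refine ⟨?_, ?_, ?_, ?_⟩ <;> linarith
  have hexp0 : Tendsto (fun t => (A + 1) * K * Real.exp (μ * t)) atBot (𝓝 0) := by
    have := (Real.tendsto_exp_atBot.comp (tendsto_id.const_mul_atBot hμ0)).const_mul ((A + 1) * K)
    simpa using this
  refine ⟨φ, ψ, hprof, ?_, ?_, ?_, (A + 1) * K, μ, by linarith, eventually_atBot.2 ⟨x₁, hbd⟩⟩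
  · refine tendsto_of_tendsto_of_tendsto_of_le_of_le' tendsto_const_nhds
      (by simpa using hP0.add hexp0) (Eventually.of_forall hprof.phi_nonneg)
      (eventually_atBot.2 ⟨x₁, fun t ht => (hbd t ht).2.1⟩)
  · refine tendsto_of_tendsto_of_tendsto_of_le_of_le' tendsto_const_nhds
      (by simpa using hQ0.add hexp0) (Eventually.of_forall hprof.psi_nonneg)
      (eventually_atBot.2 ⟨x₁, fun t ht => (hbd t ht).2.2.2⟩)
  -- The lower solution is positive far to the left, because `p ≥ e^{c t / 2}` beats a multiple of
  -- `e^{μ t}` with `μ = c / 2 + δ`.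
  · have hexpδ : Tendsto (fun t => (A + 1) * K * Real.exp (δ * t)) atBot (𝓝 0) := by
      have := (Real.tendsto_exp_atBot.comp (tendsto_id.const_mul_atBot hδ)).const_mul ((A + 1) * K)
      simpa using this
    obtain ⟨t, ht, ht1, ht2⟩ := ((hexpδ.eventually_lt_const one_pos).and
      (hp.and (eventually_le_atBot x₁))).exists
    refine ⟨t, lt_of_lt_of_le ?_ (hbd t ht2).1⟩
    have e1 : Real.exp (μ * t) = Real.exp (δ * t) * Real.exp (c / 2 * t) := by
      rw [← Real.exp_add, hμ]; ring_nf
    rw [e1]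
    have := mul_pos (sub_pos.2 ht) (Real.exp_pos (c / 2 * t))
    linarith

/-! ### Exponential pairs for `r < 1`. -/

section expSum

/-- `x e^{λ t} + y e^{σ t}`. -/
noncomputable def expSum (l s x y t : ℝ) : ℝ := x * Real.exp (l * t) + y * Real.exp (s * t)

theorem hasDerivAt_expSum (l s x y t : ℝ) :
    HasDerivAt (expSum l s x y) (expSum l s (x * l) (y * s) t) t := by
  have h : ∀ k z : ℝ, HasDerivAt (fun t => z * Real.exp (k * t)) (z * k * Real.exp (k * t)) t :=
    fun k z => by
      refine (((hasDerivAt_id t).const_mul k).exp.const_mul z).congr_deriv ?_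
      simp only [id]; ring
  exact (h l x).add (h s y)

end expSum

section noncritical

variable {r b c d l s k D m : ℝ}

/-- The `e^{l t}` part solves the linearized system. The `e^{s t}` part gains `(m - (1 - r)) e^{s
t}` in the first equation, which absorbs quadratic terms of size `e^{2 l t}` because `s < 2 l`. In
the second, `D m = b + 1` leaves a surplus of one `e^{s t}`. -/
theorem eventually_isUpperPairAt_expSum (hr0 : 0 < r) (hr1 : r ≤ 1) (hb : 0 < b) (hd : 0 ≤ d)
    (hl : 0 < l) (hls : l < s) (hs2 : s < 2 * l) (hlc : l * (c - l) = 1 - r)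
    (hm : s * (c - s) = m) (hm1 : 1 - r < m) (hk : k * (1 - r) = b) (hk0 : 0 < k)
    (hD : D * m = b + 1) (hD0 : 0 < D) :
    ∀ᶠ t in atBot, IsUpperPairAt r b c d (expSum l s 1 1) (expSum l s (1 * l) (1 * s))
      (expSum l s (1 * l * l) (1 * s * s)) (expSum l s k D) (expSum l s (k * l) (D * s))
      (expSum l s (k * l * l) (D * s * s)) t := by
  have hexp : ∀ a, 0 < a → Tendsto (fun t => Real.exp (a * t)) atBot (𝓝 0) := fun a ha =>
    Real.tendsto_exp_atBot.comp (tendsto_id.const_mul_atBot ha)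
  have hδ : 0 < (m - (1 - r)) / (2 * (k + D)) := div_pos (by linarith) (by positivity)
  filter_upwards [(hexp _ (sub_pos.2 hls)).eventually_lt_const one_pos,
    (hexp _ (sub_pos.2 hs2)).eventually_lt_const hδ] with t h1 h2
  obtain ⟨X, hX⟩ : ∃ X, X = Real.exp (l * t) := ⟨_, rfl⟩
  obtain ⟨Y, hY⟩ : ∃ Y, Y = Real.exp (s * t) := ⟨_, rfl⟩
  have hX0 : 0 < X := hX ▸ Real.exp_pos _
  have hY0 : 0 < Y := hY ▸ Real.exp_pos _
  have hYX : Y ≤ X := by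
    have : Y = Real.exp ((s - l) * t) * X := by rw [hX, hY, ← Real.exp_add]; ring_nf
    rw [this]; exact mul_le_of_le_one_left hX0.le h1.le
  have hXY : X * X * (2 * (k + D)) ≤ (m - (1 - r)) * Y := by
    have : X * X = Real.exp ((2 * l - s) * t) * Y := by
      rw [hX, hY, ← Real.exp_add, ← Real.exp_add]; ring_nf
    rw [this]
    rw [lt_div_iff₀ (by positivity)] at h2
    nlinarith
  have hQ : expSum l s k D (t - d) ≤ k * X + D * Y := by
    unfold expSum
    rw [hX, hY]
    have hs : 0 < s := by linarith
    gcongr <;> linarith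
  refine ⟨⟨hasDerivAt_expSum .., hasDerivAt_expSum .., hasDerivAt_expSum ..,
    hasDerivAt_expSum .., ?_, ?_⟩, ?_, ?_, ?_, ?_⟩
  · unfold expSum; positivity
  · unfold expSum; positivity
  · unfold expSum
    have hs : 0 < s := by linarith
    positivity
  · unfold expSum
    have hs : 0 < s := by linarith
    positivity
  · generalize expSum l s k D (t - d) = q at *
    unfold expSum
    rw [← hX, ← hY]
    have e1 : (X + Y) * (r * q) ≤ (X + Y) * (k * X + D * Y) := by
      have : r * q ≤ r * (k * X + D * Y) := mul_le_mul_of_nonneg_left hQ hr0.le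
      have h3 : r * (k * X + D * Y) ≤ k * X + D * Y := mul_le_of_le_one_left (by positivity) hr1
      exact mul_le_mul_of_nonneg_left (this.trans h3) (by positivity)
    have e2 : (X + Y) * (k * X + D * Y) ≤ (X + X) * (k * X + D * X) := by gcongr
    have e3 : l * (c - l) * X = (1 - r) * X := by rw [hlc]
    have e4 : s * (c - s) * Y = m * Y := by rw [hm]
    have e5 : 0 ≤ (X + Y) ^ 2 := sq_nonneg _
    linarith
  · unfold expSum
    rw [← hX, ← hY]
    have e3 : k * (l * (c - l)) * X = b * X := by rw [hlc, hk]
    have e4 : D * (s * (c - s)) * Y = (b + 1) * Y := by rw [hm, hD]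
    have e5 : 0 < b * (X + Y) * (k * X + D * Y) := by positivity
    linarith

/-- The reversed sign of the `e^{s t}` part yields a positive surplus; it pays for `φ²` and `b φ ψ`,
while the delayed term is simply discarded as nonnegative. -/
theorem eventually_isLowerPairAt_expSum (hr0 : 0 < r) (hb : 0 < b) (hd : 0 ≤ d)
    (hls : l < s) (hs2 : s < 2 * l) (hlc : l * (c - l) = 1 - r)
    (hm : s * (c - s) = m) (hm1 : 1 - r < m) (hk : k * (1 - r) = b) (hk0 : 0 < k)
    (hD : D * m = b + 1) (hD0 : 0 < D) :
    ∀ᶠ t in atBot, IsLowerPairAt r b c d (expSum l s 1 (-1)) (expSum l s (1 * l) (-1 * s))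
      (expSum l s (1 * l * l) (-1 * s * s)) (expSum l s k (-D)) (expSum l s (k * l) (-D * s))
      (expSum l s (k * l * l) (-D * s * s)) t := by
  have hexp : ∀ a, 0 < a → Tendsto (fun t => Real.exp (a * t)) atBot (𝓝 0) := fun a ha =>
    Real.tendsto_exp_atBot.comp (tendsto_id.const_mul_atBot ha)
  have hδ : 0 < m - (1 - r) := by linarith
  have hbk : 0 < 1 / (b * k) := by positivity
  have hkD : 0 < k / D := by positivity
  obtain ⟨N, hN⟩ := eventually_atBot.1 ((((hexp _ (sub_pos.2 hls)).eventually_lt_const one_pos).and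
    ((hexp _ (sub_pos.2 hls)).eventually_lt_const hkD)).and
    (((hexp _ (sub_pos.2 hs2)).eventually_lt_const hδ).and
    ((hexp _ (sub_pos.2 hs2)).eventually_lt_const hbk)))
  have hpos : ∀ t ≤ N, 0 < expSum l s 1 (-1) t ∧ 0 < expSum l s k (-D) t := by
    intro t ht
    obtain ⟨⟨h1, h2⟩, -⟩ := hN t ht
    have : Real.exp (s * t) = Real.exp ((s - l) * t) * Real.exp (l * t) := by
      rw [← Real.exp_add]; ring_nf
    unfold expSum
    rw [this]
    rw [lt_div_iff₀ hD0] at h2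
    have hX := Real.exp_pos (l * t)
    have h3 := mul_pos (sub_pos.2 h1) hX
    have h4 := mul_pos (sub_pos.2 h2) hX
    constructor <;> linarith
  refine eventually_atBot.2 ⟨N, fun t ht => ?_⟩
  obtain ⟨-, h3, h4⟩ := hN t ht
  obtain ⟨X, hX⟩ : ∃ X, X = Real.exp (l * t) := ⟨_, rfl⟩
  obtain ⟨Y, hY⟩ : ∃ Y, Y = Real.exp (s * t) := ⟨_, rfl⟩
  have hX0 : 0 < X := hX ▸ Real.exp_pos _
  have hY0 : 0 < Y := hY ▸ Real.exp_pos _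
  have hXX : X * X = Real.exp ((2 * l - s) * t) * Y := by
    rw [hX, hY, ← Real.exp_add, ← Real.exp_add]; ring_nf
  have hXY : X * X ≤ (m - (1 - r)) * Y := by
    rw [hXX]; gcongr
  have hXY2 : b * k * (X * X) ≤ Y := by
    rw [hXX]
    rw [lt_div_iff₀ (by positivity)] at h4
    have := mul_pos (sub_pos.2 h4) hY0
    linarith
  have hq := (hpos (t - d) (by linarith)).2
  refine ⟨⟨hasDerivAt_expSum .., hasDerivAt_expSum .., hasDerivAt_expSum ..,
    hasDerivAt_expSum .., (hpos t ht).1, (hpos t ht).2⟩, ?_, ?_⟩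
  · have hp := (hpos t ht).1
    generalize expSum l s k (-D) (t - d) = q at *
    unfold expSum at hp ⊢
    rw [← hX, ← hY] at hp ⊢
    have e1 : 0 < (1 * X + -1 * Y) * (r * q) := by positivity
    have e2 : (1 * X + -1 * Y) * (1 * X + -1 * Y) ≤ X * X :=
      mul_le_mul (by linarith) (by linarith) hp.le hX0.le
    have e3 : l * (c - l) * X = (1 - r) * X := by rw [hlc]
    have e4 : s * (c - s) * Y = m * Y := by rw [hm]
    linarith
  · have hp := (hpos t ht).1
    have hq := (hpos t ht).2
    unfold expSum at hp hq ⊢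
    rw [← hX, ← hY] at hp hq ⊢
    have e2 : (1 * X + -1 * Y) * (k * X + -D * Y) ≤ X * (k * X) :=
      mul_le_mul (by linarith) (by linarith [mul_pos hD0 hY0]) hq.le hX0.le
    have e2' := mul_le_mul_of_nonneg_left e2 hb.le
    have e3 : k * (l * (c - l)) * X = b * X := by rw [hlc, hk]
    have e4 : D * (s * (c - s)) * Y = (b + 1) * Y := by rw [hm, hD]
    linarith

end noncritical

theorem lam_mul_sub {r c : ℝ} (h : 0 ≤ c ^ 2 - 4 * (1 - r)) : lam r c * (c - lam r c) = 1 - r := by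
  have := Real.sq_sqrt h
  unfold lam
  nlinarith

/-- Fronts for `r < 1` at speeds larger than the linear speed. -/
theorem exists_profile_exponential {r b c h β : ℝ} (hr0 : 0 < r) (hr1 : r < 1) (hb : 0 < b)
    (hc : 0 < c) (hh : 0 ≤ h) (hβ : 2 + c + b ≤ β)
    (hlin : 1 - r < c ^ 2 / 4) (hnl : 1 ≤ c ^ 2 / 4 * (1 + 1 / bPrime b h c)) :
    ∃ φ ψ : ℝ → ℝ, IsProfile r b c (c * h) β φ ψ ∧ Tendsto φ atBot (𝓝 0) ∧ Tendsto ψ atBot (𝓝 0) ∧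
      (∃ t, 0 < φ t) ∧ HasExponentialAsymptotics r b c φ (fun t => 1 - ψ t) := by
  have hgap : 0 < c ^ 2 - 4 * (1 - r) := by linarith
  have hlc := lam_mul_sub hgap.le
  have hsq : 0 < √(c ^ 2 - 4 * (1 - r)) := Real.sqrt_pos.2 hgap
  have hl2 : lam r c < c / 2 := by unfold lam; linarith
  have hl0 : 0 < lam r c := by
    by_contra! hle
    nlinarith
  unfold HasExponentialAsymptotics
  generalize lam r c = l at *
  -- Then `l < s < min (2 l) (c / 2)`, so `s (c - s) > 1 - r`, and the error `e^{μ t}` with `μ > c /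
  -- 2` is negligible against `e^{s t}`.
  obtain ⟨ε, hε, hε1, hε2, -, -⟩ := exists_pos_le_four (half_pos hl0)
    (half_pos (sub_pos.2 hl2)) one_pos one_pos
  obtain ⟨s, hs⟩ : ∃ s, s = l + ε := ⟨_, rfl⟩
  obtain ⟨m, hm⟩ : ∃ m, s * (c - s) = m := ⟨_, rfl⟩
  have hm1 : 1 - r < m := by
    rw [← hm, ← hlc, hs]; nlinarith [mul_pos hε (show 0 < c - 2 * l - ε by linarith)]
  have hr : 0 < 1 - r := by linarith
  have hm0 : 0 < m := by linarith
  obtain ⟨k, hk⟩ : ∃ k, k = b / (1 - r) := ⟨_, rfl⟩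
  obtain ⟨D, hD⟩ : ∃ D, D = (b + 1) / m := ⟨_, rfl⟩
  have hk0 : 0 < k := by rw [hk]; positivity
  have hD0 : 0 < D := by rw [hD]; positivity
  have hk1 : k * (1 - r) = b := by rw [hk]; field_simp
  have hD1 : D * m = b + 1 := by rw [hD]; field_simp
  have hd : 0 ≤ c * h := by positivity
  have hexp : ∀ a, 0 < a → Tendsto (fun t => Real.exp (a * t)) atBot (𝓝 0) := fun a ha =>
    Real.tendsto_exp_atBot.comp (tendsto_id.const_mul_atBot ha)
  have hsum : ∀ x y, Tendsto (expSum l s x y) atBot (𝓝 0) := fun x y => by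
    have hs0 : 0 < s := by linarith
    have h := ((hexp l hl0).const_mul x).add ((hexp s hs0).const_mul y)
    rwa [mul_zero, mul_zero, add_zero] at h
  obtain ⟨φ, ψ, hp, h1, h2, h3, C, μ, hμ, hC⟩ := exists_profile_of_local hr0 hr1.le hb hc hh hβ hlin hnl
    (eventually_isUpperPairAt_expSum hr0 hr1.le hb hd hl0 (by linarith) (by linarith) hlc hm hm1
      hk1 hk0 hD1 hD0)
    (eventually_isLowerPairAt_expSum hr0 hb hd (by linarith) (by linarith) hlc hm hm1
      hk1 hk0 hD1 hD0)
    (Eventually.of_forall fun t => by unfold expSum; linarith [Real.exp_pos (s * t)])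
    (Eventually.of_forall fun t => by unfold expSum; nlinarith [Real.exp_pos (s * t)])
    (hsum _ _) (hsum _ _) (by
      filter_upwards [eventually_le_atBot 0, (hexp ε hε).eventually_lt_const one_half_pos]
        with t ht h1
      have e1 : Real.exp (s * t) = Real.exp (ε * t) * Real.exp (l * t) := by
        rw [← Real.exp_add, hs]; ring_nf
      have e2 : Real.exp (c / 2 * t) ≤ Real.exp (s * t) := Real.exp_le_exp.2 (by nlinarith)
      have e3 := mul_pos (sub_pos.2 h1) (Real.exp_pos (l * t))
      unfold expSum
      linarith)
  have hb1 : ∀ᶠ t in atBot, |C * Real.exp (μ * t)| ≤ |C| * Real.exp (s * t) := by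
    filter_upwards [eventually_le_atBot 0] with t ht
    rw [abs_mul, Real.abs_exp]
    have : Real.exp (μ * t) ≤ Real.exp (s * t) := Real.exp_le_exp.2 (by nlinarith)
    gcongr
  refine ⟨φ, ψ, hp, h1, h2, h3, ε, hε, IsBigO.of_bound (1 + |C|) ?_, IsBigO.of_bound (D + |C|) ?_⟩
  · filter_upwards [hC, hb1] with t ha hb1
    obtain ⟨a1, a2, -, -⟩ := ha
    rw [Real.norm_eq_abs, Real.norm_eq_abs, Real.abs_exp, ← hs, abs_le]
    obtain ⟨b1, b2⟩ := abs_le.1 hb1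
    unfold expSum at a1 a2
    constructor <;> linarith
  · filter_upwards [hC, hb1] with t ha hb1
    obtain ⟨-, -, a1, a2⟩ := ha
    rw [Real.norm_eq_abs, Real.norm_eq_abs, Real.abs_exp, ← hs, abs_le]
    obtain ⟨b1, b2⟩ := abs_le.1 hb1
    have e : b * Real.exp (l * t) / (1 - r) = k * Real.exp (l * t) := by rw [hk]; ring
    rw [e]
    unfold expSum at a1 a2
    constructor <;> linarith

/-! ### The slow solution for `r = 1`. -/

/-- Inversion of an increasing function with limit `-∞` at `0+`. -/
theorem exists_inverse_atBot {T T' : ℝ → ℝ} {x₀ : ℝ} (hx₀ : 0 < x₀)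
    (hd : ∀ x ∈ Ioc 0 x₀, HasDerivAt T (T' x) x) (hpos : ∀ x ∈ Ioc 0 x₀, 0 < T' x)
    (hlim : Tendsto T (𝓝[>] 0) atBot) :
    ∃ g : ℝ → ℝ, (∀ t < T x₀, 0 < g t ∧ g t < x₀ ∧ T (g t) = t ∧ HasDerivAt g (T' (g t))⁻¹ t) ∧
      StrictMonoOn T (Ioc 0 x₀) := by
  have hmono : StrictMonoOn T (Ioc 0 x₀) := by
    refine strictMonoOn_of_hasDerivWithinAt_pos (convex_Ioc 0 x₀)
      (fun x hx => (hd x hx).continuousAt.continuousWithinAt)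
      (fun x hx => (hd x (interior_subset hx)).hasDerivWithinAt)
      (fun x hx => hpos x (interior_subset hx))
  have hex : ∀ t, t < T x₀ → ∃ x, x ∈ Ioo 0 x₀ ∧ T x = t := by
    intro t ht
    obtain ⟨y, hy1, hy2, hy3⟩ := ((hlim.eventually_lt_atBot t).and
      ((eventually_mem_nhdsWithin).and (eventually_nhdsWithin_of_eventually_nhds
        (eventually_lt_nhds hx₀)))).exists
    have hsub : Icc y x₀ ⊆ Ioc 0 x₀ := fun z hz => ⟨lt_of_lt_of_le hy2 hz.1, hz.2⟩
    obtain ⟨x, hx, hxt⟩ := intermediate_value_Ioo hy3.le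
      (fun z hz => (hd z (hsub hz)).continuousAt.continuousWithinAt) ⟨hy1, ht⟩
    exact ⟨x, ⟨lt_trans hy2 hx.1, hx.2⟩, hxt⟩
  choose! g hg using hex
  have hgm : MonotoneOn g (Iio (T x₀)) := by
    intro s hs t ht hst
    have h1 := hg s hs
    have h2 := hg t ht
    refine (hmono.le_iff_le (Ioo_subset_Ioc_self h1.1) (Ioo_subset_Ioc_self h2.1)).1 ?_
    rw [h1.2, h2.2]; exact hst
  refine ⟨g, fun t ht => ⟨(hg t ht).1.1, (hg t ht).1.2, (hg t ht).2, ?_⟩, hmono⟩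
  have hin := Ioo_subset_Ioc_self (hg t ht).1
  refine HasDerivAt.of_local_left_inverse ?_ (hd _ hin) (hpos _ hin).ne'
    ((eventually_lt_nhds ht).mono fun s hs => (hg s hs).2)
  refine continuousAt_of_monotoneOn_of_image_mem_nhds hgm (Iio_mem_nhds ht) ?_
  refine mem_of_superset (Ioo_mem_nhds (hg t ht).1.1 (hg t ht).1.2) fun x hx => ?_
  have hx' : T x < T x₀ := hmono (Ioo_subset_Ioc_self hx) ⟨hx₀, le_rfl⟩ hx.2
  exact ⟨T x, hx', hmono.injOn (Ioo_subset_Ioc_self (hg _ hx').1) (Ioo_subset_Ioc_self hx)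
    (hg _ hx').2⟩

section slowManifold

variable {a b c d k C M x D E : ℝ}

/-- The time at which the slow solution has the value `x`. -/
noncomputable def slowTime (a c M x : ℝ) : ℝ := -2 * c / x + a * Real.log x - M * x

/-- The denominator of the vector field of the slow solution. -/
noncomputable def slowDen (a c M x : ℝ) : ℝ := 2 * c + x * (a - M * x)

theorem hasDerivAt_slowTime (hx : x ≠ 0) :
    HasDerivAt (slowTime a c M) (slowDen a c M x / x ^ 2) x := by
  have h := (((hasDerivAt_inv hx).const_mul (-2 * c)).add ((Real.hasDerivAt_log hx).const_mul a)).sub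
    ((hasDerivAt_id x).const_mul M)
  refine (h.congr_of_eventuallyEq (Eventually.of_forall fun y => ?_)).congr_deriv ?_
  · simp [slowTime, div_eq_mul_inv]
  · unfold slowDen; field_simp; ring

theorem tendsto_mul_slowTime : Tendsto (fun x => x * slowTime a c M x) (𝓝[>] 0) (𝓝 (-2 * c)) := by
  have h : Tendsto (fun x : ℝ => -2 * c + a * (x * Real.log x) - M * x * x) (𝓝 0) (𝓝 (-2 * c)) := by
    have : Continuous fun x : ℝ => -2 * c + a * (x * Real.log x) - M * x * x := by
      have := Real.continuous_mul_log
      fun_prop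
    simpa using this.tendsto 0
  refine (h.mono_left nhdsWithin_le_nhds).congr' ?_
  filter_upwards [self_mem_nhdsWithin] with x hx
  have hx' : x ≠ 0 := ne_of_gt hx
  unfold slowTime
  field_simp

theorem tendsto_slowTime (hc : 0 < c) : Tendsto (slowTime a c M) (𝓝[>] 0) atBot := by
  have h := (tendsto_inv_nhdsGT_zero (𝕜 := ℝ)).atTop_mul_neg (show -2 * c < 0 by linarith)
    (tendsto_mul_slowTime (a := a) (c := c) (M := M))
  refine h.congr' ?_
  filter_upwards [self_mem_nhdsWithin] with x hx
  have hx' : x ≠ 0 := ne_of_gt hx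
  field_simp

/-- The numerator of the residual of the second equation. -/
noncomputable def residualPsi (a c k M x : ℝ) : ℝ :=
  -2 * c ^ 2 * M + (a + 2 * c * (a - M * x) ^ 2 + 12 * c ^ 2 * (a - M * x) * (k - 1 / 2) - 8 * c ^ 3 * k
    + x * ((a - M * x) ^ 3 / 2 + 6 * c * (a - M * x) ^ 2 * (k - 1 / 2) - 12 * c ^ 2 * k * (a - M * x))
    + x ^ 2 * ((a - M * x) ^ 3 * (k - 1 / 2) - 6 * c * k * (a - M * x) ^ 2)
    - x ^ 3 * (k * (a - M * x) ^ 3))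

/-- The numerator of the residual of the first equation. -/
noncomputable def residualPhi (a b c d k C M x : ℝ) : ℝ :=
  -2 * c ^ 2 * M + (((a - M * x) + 12 * c * k + 6 * k * x * (a - M * x))
    + (a + 12 * c * k + 3 * k * a * x)
    + (-c * (a - M * x) ^ 2 - 12 * c ^ 2 * k * (a - M * x) - 3 * c * k * (a - M * x) ^ 2 * x)
    + (1 / 2 + x * k) * ((6 * c * (a - M * x) ^ 2 + x * (a - M * x) ^ 3)
      - d * (4 * c * (a - M * x) + x * (a - M * x) ^ 2) + C * (2 * c + x * (a - M * x)) ^ 3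
      - (6 * c ^ 2 * (a - M * x) + x * (6 * c * (a - M * x) ^ 2 + x * (a - M * x) ^ 3) / 2
        + k * (2 * c + x * (a - M * x)) ^ 3) / b)
    + k * (12 * c ^ 2 * (a - M * x) - 4 * c ^ 2 * d - 4 * c ^ 3 / b))

/-- Inserting `q' = q² / D` and `b φ = q² / 2 + k q³`, the order `x²` cancels because `D = 2 c` at
`0`, and `hk` cancels the order `x³`. At order `x⁴`, `M` enters as `-2 c² M`. -/
theorem residualPsi_eq (hD : D = slowDen a c M x) (hD0 : D ≠ 0)
    (hk : 4 * c + 2 * c ^ 2 * a + 8 * c ^ 3 * (k - 1 / 2) = 0) :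
    x ^ 3 * (4 * c + a * x) / D ^ 3 - c * (x ^ 2 / D) + (x ^ 2 / 2 + k * x ^ 3) * (1 - x)
      = x ^ 4 / D ^ 3 * residualPsi a c k M x := by
  have e1 : x ^ 2 / D = x ^ 2 * D ^ 2 / D ^ 3 := by field_simp
  have e2 : (x ^ 2 / 2 + k * x ^ 3) * (1 - x) = (x ^ 2 / 2 + k * x ^ 3) * (1 - x) * D ^ 3 / D ^ 3 := by
    field_simp
  rw [e1, e2, div_mul_eq_mul_div, ← mul_div_assoc, ← sub_div, ← add_div]
  congr 1
  rw [hD]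
  unfold residualPsi slowDen
  linear_combination x ^ 3 * hk

/-- The order `x³` cancels by the leading coefficients and `ha` cancels `x⁴`; `M` enters at order
`x⁵`, with the same negative sign as in the other equation. The term `C x³` stands for the Taylor
remainder of the delay. -/
theorem residualPhi_eq (hb : b ≠ 0) (hD : D = slowDen a c M x) (hD0 : D ≠ 0)
    (ha : 6 * c + 2 * c ^ 2 * a - 4 * c ^ 3 * k - 2 * c ^ 2 * d - 2 * c ^ 3 / b = 0) :
    ((1 / b + 6 * (k / b) * x) * (x ^ 2 / D) ^ 2
        + (x / b + 3 * (k / b) * x ^ 2) * (x ^ 3 * (4 * c + a * x) / D ^ 3))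
      - c * ((x / b + 3 * (k / b) * x ^ 2) * (x ^ 2 / D))
      + (x ^ 2 / (2 * b) + k / b * x ^ 3) * (x - d * (x ^ 2 / D) + C * x ^ 3
        - (x ^ 2 / (2 * b) + k / b * x ^ 3))
      = x ^ 5 / (b * D ^ 3) * residualPhi a b c d k C M x := by
  have e : ∀ X Y : ℝ, b * D ^ 3 * X = b * D ^ 3 * Y → X = Y := fun X Y h =>
    mul_left_cancel₀ (mul_ne_zero hb (pow_ne_zero 3 hD0)) h
  apply e
  have eR : b * D ^ 3 * (x ^ 5 / (b * D ^ 3) * residualPhi a b c d k C M x)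
      = x ^ 5 * residualPhi a b c d k C M x := by field_simp
  have eL : b * D ^ 3 * (((1 / b + 6 * (k / b) * x) * (x ^ 2 / D) ^ 2
        + (x / b + 3 * (k / b) * x ^ 2) * (x ^ 3 * (4 * c + a * x) / D ^ 3))
      - c * ((x / b + 3 * (k / b) * x ^ 2) * (x ^ 2 / D))
      + (x ^ 2 / (2 * b) + k / b * x ^ 3) * (x - d * (x ^ 2 / D) + C * x ^ 3
        - (x ^ 2 / (2 * b) + k / b * x ^ 3)))
      = x ^ 3 * ((1 + 6 * k * x) * x * D + (1 + 3 * k * x) * x * (4 * c + a * x)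
        - c * (1 + 3 * k * x) * D ^ 2 + (1 / 2 + k * x) * (D ^ 3 - d * x * D ^ 2 + C * x ^ 2 * D ^ 3
          - x * (1 / 2 + k * x) * D ^ 3 / b)) := by
    field_simp
  rw [eR, eL, hD]
  unfold residualPhi slowDen
  linear_combination x ^ 4 * ha

end slowManifold

section slowSolution

variable {a b c d k C M : ℝ}

/-- `q` is, near `-∞`, the slow solution with parameters `a, c, M`. -/
structure IsSlowSolution (a c M : ℝ) (q : ℝ → ℝ) : Prop where
  tendsto : Tendsto q atBot (𝓝[>] 0)
  slowTime_eq : ∀ᶠ t in atBot, slowTime a c M (q t) = t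
  hasDerivAt : ∀ᶠ t in atBot, HasDerivAt q (q t ^ 2 / slowDen a c M (q t)) t

theorem continuous_slowDen : Continuous (slowDen a c M) := by
  unfold slowDen; fun_prop

theorem slowDen_zero : slowDen a c M 0 = 2 * c := by simp [slowDen]

theorem eventually_slowDen (hc : 0 < c) : ∀ᶠ x in 𝓝[>] 0, c < slowDen a c M x :=
  (((continuous_slowDen (a := a) (c := c) (M := M)).tendsto 0).eventually_const_lt
    (by rw [slowDen_zero]; linarith)).filter_mono nhdsWithin_le_nhds

theorem exists_isSlowSolution (hc : 0 < c) : ∃ x₀ > 0, StrictMonoOn (slowTime a c M) (Ioc 0 x₀) ∧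
    ∃ q, IsSlowSolution a c M q := by
  obtain ⟨x₀, hx₀, hx⟩ := mem_nhdsGT_iff_exists_Ioc_subset.1 (eventually_slowDen (a := a) (M := M) hc)
  have hx₀' : 0 < x₀ := hx₀
  obtain ⟨g, hg, hmono⟩ := exists_inverse_atBot (T := slowTime a c M)
    (T' := fun x => slowDen a c M x / x ^ 2) hx₀'
    (fun x hx => hasDerivAt_slowTime hx.1.ne')
    (fun x h => div_pos (hc.trans (hx h)) (pow_pos h.1 2)) (tendsto_slowTime hc)
  refine ⟨x₀, hx₀', hmono, g, ⟨?_, ?_, ?_⟩⟩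
  · refine tendsto_nhdsWithin_iff.2 ⟨?_, ?_⟩
    · refine tendsto_order.2 ⟨fun y hy => ?_, fun y hy => ?_⟩
      · filter_upwards [eventually_lt_atBot (slowTime a c M x₀)] with t ht
        exact hy.trans (hg t ht).1
      · have hm : min y x₀ ∈ Ioc 0 x₀ := ⟨lt_min hy hx₀', min_le_right _ _⟩
        filter_upwards [eventually_lt_atBot (slowTime a c M x₀),
          eventually_lt_atBot (slowTime a c M (min y x₀))] with t ht ht'
        obtain ⟨h1, h2, h3, -⟩ := hg t ht
        rw [← h3, hmono.lt_iff_lt ⟨h1, h2.le⟩ hm] at ht'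
        exact ht'.trans_le (min_le_left _ _)
    · filter_upwards [eventually_lt_atBot (slowTime a c M x₀)] with t ht
      exact (hg t ht).1
  · filter_upwards [eventually_lt_atBot (slowTime a c M x₀)] with t ht
    exact (hg t ht).2.2.1
  · filter_upwards [eventually_lt_atBot (slowTime a c M x₀)] with t ht
    simpa only [inv_div] using (hg t ht).2.2.2

/-- At a fixed positive value, `slowTime` decreases as `M` grows, so its increasing inverse grows
with `M`. -/
theorem IsSlowSolution.le {M' x₀ : ℝ} {q q' : ℝ → ℝ} (hq : IsSlowSolution a c M q)
    (hq' : IsSlowSolution a c M' q') (hM : M ≤ M') (hx₀ : 0 < x₀)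
    (hmono : StrictMonoOn (slowTime a c M) (Ioc 0 x₀)) : ∀ᶠ t in atBot, q t ≤ q' t := by
  have hI : ∀ᶠ x in 𝓝[>] 0, x ∈ Ioc 0 x₀ := Ioc_mem_nhdsGT hx₀
  filter_upwards [hq.tendsto.eventually hI, hq'.tendsto.eventually hI, hq.slowTime_eq,
    hq'.slowTime_eq] with t h1 h2 h3 h4
  rw [← hmono.le_iff_le h1 h2, h3]
  have : M * q' t ≤ M' * q' t := mul_le_mul_of_nonneg_right hM h2.1.le
  unfold slowTime at h4 ⊢
  linarith

theorem IsSlowSolution.eventually_of_continuous {q : ℝ → ℝ} (hq : IsSlowSolution a c M q)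
    {f : ℝ → ℝ} (hf : Continuous f) {y : ℝ} (h : f 0 < y) : ∀ᶠ t in atBot, f (q t) < y :=
  hq.tendsto.eventually (((hf.tendsto 0).eventually_lt_const h).filter_mono nhdsWithin_le_nhds)

/-- The second derivative of the slow solution. -/
theorem IsSlowSolution.hasDerivAt_deriv {q : ℝ → ℝ} (hq : IsSlowSolution a c M q) (hc : 0 < c) :
    ∀ᶠ t in atBot, HasDerivAt (fun t => q t ^ 2 / slowDen a c M (q t))
      (q t ^ 3 * (4 * c + a * q t) / slowDen a c M (q t) ^ 3) t := by
  filter_upwards [hq.hasDerivAt, hq.tendsto.eventually (eventually_slowDen hc)] with t h1 h2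
  have hD : slowDen a c M (q t) ≠ 0 := (hc.trans h2).ne'
  have h3 : HasDerivAt (slowDen a c M) (a - 2 * M * q t) (q t) := by
    have := ((hasDerivAt_id (q t)).mul (((hasDerivAt_id (q t)).const_mul M).const_sub a)).const_add
      (2 * c)
    refine (this.congr_of_eventuallyEq (Eventually.of_forall fun y => ?_)).congr_deriv ?_
    · simp [slowDen]
    · simp; ring
  refine ((h1.pow 2).div (h3.comp t h1) hD).congr_deriv ?_
  simp only [Function.comp, Pi.pow_apply]
  field_simp
  unfold slowDen
  push_cast
  ring

/-- Two applications of the mean value theorem: convexity gives the tangent bound, and monotonicity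
of `q` lets the remainder be measured by `q t ^ 3` at the undelayed time. -/
theorem eventually_sub_of_convex {q q1 q2 : ℝ → ℝ} {B : ℝ} (hd : 0 ≤ d) (hB : 0 ≤ B)
    (h1 : ∀ᶠ t in atBot, HasDerivAt q (q1 t) t) (h2 : ∀ᶠ t in atBot, HasDerivAt q1 (q2 t) t)
    (hq : ∀ᶠ t in atBot, 0 ≤ q t) (hq1 : ∀ᶠ t in atBot, 0 ≤ q1 t) (hq2 : ∀ᶠ t in atBot, 0 ≤ q2 t)
    (hq3 : ∀ᶠ t in atBot, q2 t ≤ B * q t ^ 3) :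
    ∀ᶠ t in atBot, q t - d * q1 t ≤ q (t - d) ∧
      q (t - d) ≤ q t - d * q1 t + d ^ 2 * B * q t ^ 3 := by
  obtain ⟨N, hN⟩ := eventually_atBot.1 ((h1.and (h2.and hq)).and (hq1.and (hq2.and hq3)))
  refine eventually_atBot.2 ⟨N, fun t ht => ?_⟩
  rcases hd.eq_or_lt with rfl | hd
  · simp
  obtain ⟨ξ, hξ, e1⟩ := exists_hasDerivAt_eq_slope q q1 (show t - d < t by linarith)
    (fun s hs => (hN s (hs.2.trans ht)).1.1.continuousAt.continuousWithinAt)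
    (fun s hs => (hN s (hs.2.le.trans ht)).1.1)
  obtain ⟨η, hη, e2⟩ := exists_hasDerivAt_eq_slope q1 q2 hξ.2
    (fun s hs => (hN s (hs.2.trans ht)).1.2.1.continuousAt.continuousWithinAt)
    (fun s hs => (hN s (hs.2.le.trans ht)).1.2.1)
  have hξ1 := hξ.1
  have hξ2 := hξ.2
  rw [eq_div_iff (by linarith)] at e1 e2
  have hηN : η ≤ N := hη.2.le.trans ht
  have hmono : q η ≤ q t := by
    refine monotoneOn_of_hasDerivWithinAt_nonneg (convex_Icc η t)
      (fun s hs => (hN s (hs.2.trans ht)).1.1.continuousAt.continuousWithinAt)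
      (fun s hs => (hN s ((interior_subset hs).2.trans ht)).1.1.hasDerivWithinAt)
      (fun s hs => (hN s ((interior_subset hs).2.trans ht)).2.1)
      (left_mem_Icc.2 hη.2.le) (right_mem_Icc.2 hη.2.le) hη.2.le
  have h3 : q2 η ≤ B * q t ^ 3 := (hN η hηN).2.2.2.trans
    (mul_le_mul_of_nonneg_left (pow_le_pow_left₀ (hN η hηN).1.2.2 hmono 3) hB)
  have h4 : 0 ≤ q2 η * (t - ξ) := mul_nonneg (hN η hηN).2.2.1 (by linarith)
  have h5 : q2 η * (t - ξ) ≤ B * q t ^ 3 * d :=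
    mul_le_mul h3 (by linarith) (by linarith) (mul_nonneg hB (pow_nonneg (hN t ht).1.2.2 3))
  constructor <;> nlinarith

/-- The delayed slow solution. -/
theorem IsSlowSolution.eventually_sub {q : ℝ → ℝ} (hq : IsSlowSolution a c M q) (hc : 0 < c)
    (hd : 0 ≤ d) : ∀ᶠ t in atBot, q t - d * (q t ^ 2 / slowDen a c M (q t)) ≤ q (t - d) ∧
      q (t - d) ≤ q t - d * (q t ^ 2 / slowDen a c M (q t)) + d ^ 2 * (8 * c / c ^ 3) * q t ^ 3 := by
  have hpos : ∀ᶠ t in atBot, 0 < q t := hq.tendsto.eventually self_mem_nhdsWithin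
  have hD := hq.tendsto.eventually (eventually_slowDen (a := a) (M := M) hc)
  have ha1 : ∀ᶠ t in atBot, a * q t < 4 * c :=
    hq.eventually_of_continuous (f := fun x => a * x) (by fun_prop) (by simp; linarith)
  have ha2 : ∀ᶠ t in atBot, -(a * q t) < 4 * c :=
    hq.eventually_of_continuous (f := fun x => -(a * x)) (by fun_prop) (by simp; linarith)
  refine eventually_sub_of_convex hd (by positivity) hq.hasDerivAt (hq.hasDerivAt_deriv hc)
    (hpos.mono fun t h => h.le) ?_ ?_ ?_
  · filter_upwards [hD] with t h
    have := hc.trans h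
    positivity
  · filter_upwards [hD, hpos, ha2] with t h h1 h2
    have := hc.trans h
    exact div_nonneg (mul_nonneg (by positivity) (by linarith)) (by positivity)
  · filter_upwards [hD, hpos, ha1, ha2] with t h h1 h2 h3
    -- The constant `8 c / c³` comes from `4 c + a q ≤ 8 c` and from the denominator exceeding `c`.
    rw [mul_div_assoc, mul_comm]
    refine mul_le_mul_of_nonneg_right ?_ (by positivity)
    refine div_le_div₀ (by positivity) (by linarith) (by positivity) ?_
    exact pow_le_pow_left₀ hc.le h.le 3

theorem IsSlowSolution.tendsto_mul {q : ℝ → ℝ} (hq : IsSlowSolution a c M q) :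
    Tendsto (fun t => t * q t) atBot (𝓝 (-2 * c)) := by
  refine ((tendsto_mul_slowTime (a := a) (c := c) (M := M)).comp hq.tendsto).congr' ?_
  filter_upwards [hq.slowTime_eq] with t h
  simp only [Function.comp, h, mul_comm]

theorem tendsto_id_mul_log_sq : Tendsto (fun x : ℝ => x * Real.log x ^ 2) (𝓝[>] 0) (𝓝 0) := by
  have h := (tendsto_log_mul_rpow_nhdsGT_zero (r := 1 / 2) (by norm_num)).pow 2
  rw [zero_pow two_ne_zero] at h
  refine h.congr' ?_
  filter_upwards [self_mem_nhdsWithin] with x hx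
  have hx' : 0 ≤ x := le_of_lt hx
  rw [mul_pow, ← Real.rpow_natCast (x ^ (1 / 2 : ℝ)), ← Real.rpow_mul hx']
  norm_num
  ring

theorem tendsto_id_mul_log : Tendsto (fun x : ℝ => x * Real.log x) (𝓝[>] 0) (𝓝 0) := by
  simpa using (Real.continuous_mul_log.tendsto 0).mono_left (nhdsWithin_le_nhds (s := Ioi 0))

/-- The asymptotics of the slow solution. -/
theorem IsSlowSolution.tendsto_asymptotics {q : ℝ → ℝ} (hq : IsSlowSolution a c M q) (hc : 0 < c) :
    Tendsto (fun t => t ^ 2 * q t + 2 * c * t - 2 * c * a * Real.log (-t)) atBot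
      (𝓝 (-2 * c * a * Real.log (2 * c))) := by
  have h1 := hq.tendsto_mul
  have h2 : Tendsto (fun t => Real.log (-(t * q t))) atBot (𝓝 (Real.log (2 * c))) := by
    have := h1.neg.log (by simp; positivity)
    simpa using this
  have h0 : Tendsto q atBot (𝓝 0) := hq.tendsto.mono_right nhdsWithin_le_nhds
  have h3 := tendsto_id_mul_log_sq.comp hq.tendsto
  have h4 := tendsto_id_mul_log.comp hq.tendsto
  have h5 := (((h3.const_mul (a ^ 2)).sub ((h0.mul h4).const_mul (a * M))).sub
    (h2.const_mul (2 * c * a))).sub ((h1.mul h0).const_mul M)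
  have e : a ^ 2 * 0 - a * M * (0 * 0) - 2 * c * a * Real.log (2 * c) - M * (-2 * c * 0)
      = -2 * c * a * Real.log (2 * c) := by ring
  rw [e] at h5
  refine h5.congr' ?_
  filter_upwards [hq.slowTime_eq, hq.tendsto.eventually self_mem_nhdsWithin, eventually_lt_atBot 0]
    with t h6 h7 h8
  have h7' : 0 < q t := h7
  have e1 : Real.log (-(t * q t)) = Real.log (-t) + Real.log (q t) := by
    rw [← Real.log_mul (by linarith) h7'.ne']; ring_nf
  -- This is the implicit equation multiplied by `q`. Used a second time on `t · (t q)`, it leaves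
  -- only the convergent quantities `q log² q`, `q log q`, `q` and `log (-t q)`.
  have e2 : t * q t = -2 * c + a * (q t * Real.log (q t)) - M * q t ^ 2 := by
    generalize q t = x at h6 h7'
    rw [← h6]
    unfold slowTime
    field_simp
  simp only [Function.comp]
  rw [e1]
  linear_combination (-t - a * Real.log (q t)) * e2

end slowSolution

/-! ### Local upper and lower pairs built on slow solutions. -/

section slowPair

variable {a b c d k C M : ℝ} {q : ℝ → ℝ}

/-- The first component attached to a slow solution. -/
noncomputable def slowPhi (b k : ℝ) (q : ℝ → ℝ) (t : ℝ) : ℝ := q t ^ 2 / (2 * b) + k / b * q t ^ 3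

/-- The derivative of a slow solution. -/
noncomputable def slowPsi₁ (a c M : ℝ) (q : ℝ → ℝ) (t : ℝ) : ℝ := q t ^ 2 / slowDen a c M (q t)

/-- The second derivative of a slow solution. -/
noncomputable def slowPsi₂ (a c M : ℝ) (q : ℝ → ℝ) (t : ℝ) : ℝ :=
  q t ^ 3 * (4 * c + a * q t) / slowDen a c M (q t) ^ 3

/-- The derivative of `slowPhi`. -/
noncomputable def slowPhi₁ (a b c k M : ℝ) (q : ℝ → ℝ) (t : ℝ) : ℝ :=
  (q t / b + 3 * (k / b) * q t ^ 2) * slowPsi₁ a c M q t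

/-- The second derivative of `slowPhi`. -/
noncomputable def slowPhi₂ (a b c k M : ℝ) (q : ℝ → ℝ) (t : ℝ) : ℝ :=
  (1 / b + 6 * (k / b) * q t) * slowPsi₁ a c M q t ^ 2
    + (q t / b + 3 * (k / b) * q t ^ 2) * slowPsi₂ a c M q t

theorem IsSlowSolution.isSmoothPairAt (hq : IsSlowSolution a c M q) (hc : 0 < c) (hb : 0 < b) :
    ∀ᶠ t in atBot, IsSmoothPairAt (slowPhi b k q) (slowPhi₁ a b c k M q) (slowPhi₂ a b c k M q)
      q (slowPsi₁ a c M q) (slowPsi₂ a c M q) t := by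
  filter_upwards [hq.hasDerivAt, hq.hasDerivAt_deriv hc, hq.tendsto.eventually self_mem_nhdsWithin,
    hq.eventually_of_continuous (f := fun x => -(k * x)) (y := 1 / 2) (by fun_prop) (by simp)]
    with t h1 h2 h3 h4
  have h3' : 0 < q t := h3
  have hb' : b ≠ 0 := hb.ne'
  refine ⟨?_, ?_, h1, h2, ?_, h3⟩
  · refine (((h1.pow 2).div_const (2 * b)).add ((h1.pow 3).const_mul (k / b))).congr_deriv ?_
    unfold slowPhi₁ slowPsi₁
    field_simp
    push_cast
    ring
  · refine ((((h1.div_const b).add ((h1.pow 2).const_mul (3 * (k / b)))).mul h2)).congr_deriv ?_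
    simp only [Pi.add_apply, Pi.pow_apply]
    unfold slowPhi₂ slowPsi₁ slowPsi₂
    push_cast
    ring
  · have e : slowPhi b k q t = q t ^ 2 / b * (1 / 2 + k * q t) := by
      unfold slowPhi; field_simp
    rw [e]
    exact mul_pos (by positivity) (by linarith)

theorem continuous_residualPsi : Continuous (residualPsi a c k M) := by
  unfold residualPsi; fun_prop

theorem continuous_residualPhi : Continuous (residualPhi a b c d k C M) := by
  unfold residualPhi; fun_prop

theorem residualPsi_zero : residualPsi a c k M 0 = -2 * c ^ 2 * M + residualPsi a c k 0 0 := by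
  simp [residualPsi]

theorem residualPhi_zero :
    residualPhi a b c d k C M 0 = -2 * c ^ 2 * M + residualPhi a b c d k C 0 0 := by
  simp [residualPhi]

theorem slowPhi_residual (hb : b ≠ 0) {t : ℝ} (hD0 : slowDen a c M (q t) ≠ 0)
    (ha : 6 * c + 2 * c ^ 2 * a - 4 * c ^ 3 * k - 2 * c ^ 2 * d - 2 * c ^ 3 / b = 0) :
    slowPhi₂ a b c k M q t - c * slowPhi₁ a b c k M q t + slowPhi b k q t *
      (q t - d * slowPsi₁ a c M q t + C * q t ^ 3 - slowPhi b k q t)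
      = q t ^ 5 / (b * slowDen a c M (q t) ^ 3) * residualPhi a b c d k C M (q t) :=
  residualPhi_eq hb rfl hD0 ha

theorem slowPsi_residual (hb : b ≠ 0) {t : ℝ} (hD0 : slowDen a c M (q t) ≠ 0)
    (hk : 4 * c + 2 * c ^ 2 * a + 8 * c ^ 3 * (k - 1 / 2) = 0) :
    slowPsi₂ a c M q t - c * slowPsi₁ a c M q t + b * slowPhi b k q t * (1 - q t)
      = q t ^ 4 / slowDen a c M (q t) ^ 3 * residualPsi a c k M (q t) := by
  rw [← residualPsi_eq rfl hD0 hk]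
  unfold slowPhi slowPsi₁ slowPsi₂
  field_simp

theorem IsSlowSolution.isUpperPairAt (hq : IsSlowSolution a c M q) (hc : 0 < c) (hb : 0 < b)
    (hd : 0 ≤ d) (hk : 4 * c + 2 * c ^ 2 * a + 8 * c ^ 3 * (k - 1 / 2) = 0)
    (ha : 6 * c + 2 * c ^ 2 * a - 4 * c ^ 3 * k - 2 * c ^ 2 * d - 2 * c ^ 3 / b = 0)
    (h1 : residualPsi a c k M 0 < 0)
    (h2 : residualPhi a b c d k (d ^ 2 * (8 * c / c ^ 3)) M 0 < 0) :
    ∀ᶠ t in atBot, IsUpperPairAt 1 b c d (slowPhi b k q) (slowPhi₁ a b c k M q)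
      (slowPhi₂ a b c k M q) q (slowPsi₁ a c M q) (slowPsi₂ a c M q) t := by
  filter_upwards [hq.isSmoothPairAt hc hb, hq.eventually_sub hc hd,
    hq.tendsto.eventually (eventually_slowDen hc),
    hq.eventually_of_continuous continuous_residualPsi h1,
    hq.eventually_of_continuous continuous_residualPhi h2,
    hq.eventually_of_continuous (f := fun x => -(3 * k * x)) (y := 1) (by fun_prop) (by simp)]
    with t hs hdel hD r1 r2 h3
  have hD0 := hc.trans hD
  have hq0 := hs.q_pos
  have hb' : b ≠ 0 := hb.ne'
  have h5 : 0 ≤ slowPsi₁ a c M q t := by unfold slowPsi₁; positivity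
  refine ⟨hs, ?_, h5, ?_, ?_⟩
  · have e : q t / b + 3 * (k / b) * q t ^ 2 = q t / b * (1 + 3 * k * q t) := by field_simp
    unfold slowPhi₁
    rw [e]
    exact mul_nonneg (mul_nonneg (by positivity) (by linarith)) h5
  · have e := slowPhi_residual (q := q) (C := d ^ 2 * (8 * c / c ^ 3)) hb' hD0.ne' ha
    have h6 : slowPhi b k q t * q (t - d) ≤ slowPhi b k q t *
        (q t - d * slowPsi₁ a c M q t + d ^ 2 * (8 * c / c ^ 3) * q t ^ 3) :=
      mul_le_mul_of_nonneg_left hdel.2 hs.p_pos.le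
    have h7 := mul_nonpos_of_nonneg_of_nonpos
      (show 0 ≤ q t ^ 5 / (b * slowDen a c M (q t) ^ 3) by positivity) r2.le
    linarith
  · rw [slowPsi_residual hb' hD0.ne' hk]
    exact mul_nonpos_of_nonneg_of_nonpos (by positivity) r1.le

theorem IsSlowSolution.isLowerPairAt (hq : IsSlowSolution a c M q) (hc : 0 < c) (hb : 0 < b)
    (hd : 0 ≤ d) (hk : 4 * c + 2 * c ^ 2 * a + 8 * c ^ 3 * (k - 1 / 2) = 0)
    (ha : 6 * c + 2 * c ^ 2 * a - 4 * c ^ 3 * k - 2 * c ^ 2 * d - 2 * c ^ 3 / b = 0)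
    (h1 : 0 < residualPsi a c k M 0) (h2 : 0 < residualPhi a b c d k 0 M 0) :
    ∀ᶠ t in atBot, IsLowerPairAt 1 b c d (slowPhi b k q) (slowPhi₁ a b c k M q)
      (slowPhi₂ a b c k M q) q (slowPsi₁ a c M q) (slowPsi₂ a c M q) t := by
  filter_upwards [hq.isSmoothPairAt hc hb, hq.eventually_sub hc hd,
    hq.tendsto.eventually (eventually_slowDen hc),
    hq.eventually_of_continuous continuous_residualPsi.neg (neg_neg_of_pos h1),
    hq.eventually_of_continuous continuous_residualPhi.neg (neg_neg_of_pos h2)]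
    with t hs hdel hD r1 r2
  have hD0 := hc.trans hD
  have hq0 := hs.q_pos
  have hb' : b ≠ 0 := hb.ne'
  refine ⟨hs, ?_, ?_⟩
  · have e := slowPhi_residual (q := q) (C := 0) hb' hD0.ne' ha
    have h6 : slowPhi b k q t * (q t - d * slowPsi₁ a c M q t) ≤ slowPhi b k q t * q (t - d) :=
      mul_le_mul_of_nonneg_left hdel.1 hs.p_pos.le
    have h7 := mul_nonneg
      (show 0 ≤ q t ^ 5 / (b * slowDen a c M (q t) ^ 3) by positivity) (neg_neg_iff_pos.1 r2).le
    linarith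
  · rw [slowPsi_residual hb' hD0.ne' hk]
    exact mul_nonneg (by positivity) (neg_neg_iff_pos.1 r1).le

theorem tendsto_log_pow_div_atBot (n : ℕ) :
    Tendsto (fun t : ℝ => Real.log (-t) ^ n / t) atBot (𝓝 0) := by
  have h := (Real.tendsto_pow_log_div_mul_add_atTop (-1) 0 n (by norm_num)).comp
    tendsto_neg_atBot_atTop
  refine h.congr fun t => ?_
  simp

/-- Writing `t² q = R - 2 c t + 2 c a log (-t)` with `R` convergent, the square produces the two
displayed divergent terms, and `t³ q³` converges. -/
theorem IsSlowSolution.tendsto_slowPhi (hq : IsSlowSolution a c M q) (hc : 0 < c) (hb : 0 < b) :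
    ∃ l, Tendsto (fun t => t ^ 3 * slowPhi b k q t - 2 * c ^ 2 / b * t
      + 4 * c ^ 2 * a / b * Real.log (-t)) atBot (𝓝 l) := by
  obtain ⟨R, hR⟩ : ∃ R, R = fun t => t ^ 2 * q t + 2 * c * t - 2 * c * a * Real.log (-t) := ⟨_, rfl⟩
  have h1 := hq.tendsto_asymptotics hc
  rw [← hR] at h1
  have h2 := tendsto_inv_atBot_zero (𝕜 := ℝ)
  have h3 := tendsto_log_pow_div_atBot 1
  have h4 := tendsto_log_pow_div_atBot 2
  have h5 := hq.tendsto_mul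
  refine ⟨_, Tendsto.congr' ?_ (((((((h1.pow 2).mul h2).add ((h1.mul h3).const_mul (4 * c * a))).add
    (h4.const_mul (4 * c ^ 2 * a ^ 2))).const_mul (1 / (2 * b))).add
    (h1.const_mul (-2 * c / b))).add ((h5.pow 3).const_mul (k / b)))⟩
  filter_upwards [eventually_lt_atBot 0] with t ht
  have ht' : t ≠ 0 := ht.ne
  rw [hR]
  unfold slowPhi
  field_simp
  ring

theorem IsSlowSolution.tendsto_sq_mul_slowPhi (hq : IsSlowSolution a c M q) (hb : 0 < b) :
    Tendsto (fun t => t ^ 2 * slowPhi b k q t) atBot (𝓝 (2 * c ^ 2 / b)) := by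
  have h0 : Tendsto q atBot (𝓝 0) := hq.tendsto.mono_right nhdsWithin_le_nhds
  have h5 := hq.tendsto_mul
  have h := ((h5.pow 2).const_mul (1 / (2 * b))).add (((h5.pow 2).mul h0).const_mul (k / b))
  have e : 1 / (2 * b) * (-2 * c) ^ 2 + k / b * ((-2 * c) ^ 2 * 0) = 2 * c ^ 2 / b := by
    field_simp; ring
  rw [e] at h
  refine h.congr fun t => ?_
  unfold slowPhi
  field_simp

theorem tendsto_pow_mul_exp_atBot (n : ℕ) {μ : ℝ} (hμ : 0 < μ) :
    Tendsto (fun t : ℝ => t ^ n * Real.exp (μ * t)) atBot (𝓝 0) := by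
  have h := ((isLittleO_pow_exp_pos_mul_atTop (k := n) hμ).tendsto_div_nhds_zero.comp
    tendsto_neg_atBot_atTop).const_mul ((-1) ^ n)
  rw [mul_zero] at h
  refine h.congr fun t => ?_
  simp only [Function.comp]
  rw [mul_neg, Real.exp_neg, div_inv_eq_mul, ← mul_assoc, ← mul_pow]
  ring_nf

theorem isBigO_of_tendsto_pow_mul {f : ℝ → ℝ} {n : ℕ} {l : ℝ}
    (h : Tendsto (fun t => t ^ n * f t) atBot (𝓝 l)) : f =O[atBot] fun t => 1 / t ^ n := by
  have h1 := (h.isBigO_one ℝ).mul (isBigO_refl (fun t : ℝ => 1 / t ^ n) atBot)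
  refine h1.congr' ?_ ?_
  · filter_upwards [eventually_lt_atBot 0] with t ht
    have : t ≠ 0 := ht.ne
    field_simp
  · exact Eventually.of_forall fun t => one_mul _

theorem isBigO_sub_of_le_of_le {α : Type*} {l : Filter α} {f g p P e h : α → ℝ}
    (h1 : ∀ᶠ t in l, p t - e t ≤ f t) (h2 : ∀ᶠ t in l, f t ≤ P t + e t)
    (hp : (fun t => p t - g t) =O[l] h) (hP : (fun t => P t - g t) =O[l] h) (he : e =O[l] h) :
    (fun t => f t - g t) =O[l] h := by
  have h3 := (hp.norm_left.add hP.norm_left).add he.norm_left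
  refine IsBigO.trans (IsBigO.of_bound 1 ?_) h3
  filter_upwards [h1, h2] with t h1 h2
  simp only [Real.norm_eq_abs, one_mul]
  have a1 := abs_nonneg (p t - g t)
  have a2 := abs_nonneg (P t - g t)
  rw [abs_of_nonneg (a := _ + _) (by positivity)]
  refine abs_le.2 ⟨?_, ?_⟩
  · linarith [neg_abs_le (p t - g t), le_abs_self (e t)]
  · linarith [le_abs_self (P t - g t), le_abs_self (e t)]

end slowPair

/-- Fronts for `r = 1`. -/
theorem exists_profile_algebraic {b c h β : ℝ} (hb : 0 < b)
    (hc : 0 < c) (hh : 0 ≤ h) (hβ : 2 + c + b ≤ β)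
    (hnl : 1 ≤ c ^ 2 / 4 * (1 + 1 / bPrime b h c)) :
    ∃ φ ψ : ℝ → ℝ, IsProfile 1 b c (c * h) β φ ψ ∧ Tendsto φ atBot (𝓝 0) ∧ Tendsto ψ atBot (𝓝 0) ∧
      (∃ t, 0 < φ t) ∧ HasAlgebraicAsymptotics b h c φ (fun t => 1 - ψ t) := by
  unfold HasAlgebraicAsymptotics
  obtain ⟨K, hK⟩ : ∃ K, K = c ^ 2 * (1 + h + 1 / b) - 4 := ⟨_, rfl⟩
  obtain ⟨d, hd⟩ : ∃ d, d = c * h := ⟨_, rfl⟩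
  have hd0 : 0 ≤ d := hd ▸ by positivity
  -- `a` and `k` are the solution of the two linear conditions `hk'` and `ha'`; `a` determines the
  -- coefficient of the logarithm.
  obtain ⟨a, ha⟩ : ∃ a, a = 2 * K / (3 * c) := ⟨_, rfl⟩
  obtain ⟨k, hk⟩ : ∃ k, k = 1 / 2 - 1 / (2 * c ^ 2) - a / (4 * c) := ⟨_, rfl⟩
  have hk' : 4 * c + 2 * c ^ 2 * a + 8 * c ^ 3 * (k - 1 / 2) = 0 := by
    rw [hk]; field_simp; ring
  have ha' : 6 * c + 2 * c ^ 2 * a - 4 * c ^ 3 * k - 2 * c ^ 2 * d - 2 * c ^ 3 / b = 0 := by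
    rw [hk, hd, ha, hK]; field_simp; ring
  obtain ⟨n1, hn1⟩ : ∃ n, n = |residualPsi a c k 0 0| := ⟨_, rfl⟩
  obtain ⟨n2, hn2⟩ : ∃ n, n = |residualPhi a b c d k (d ^ 2 * (8 * c / c ^ 3)) 0 0| := ⟨_, rfl⟩
  obtain ⟨n3, hn3⟩ : ∃ n, n = |residualPhi a b c d k 0 0 0| := ⟨_, rfl⟩
  -- `2 c² M` exceeds every residual constant, so `M` gives strictly negative residuals at `0` and
  -- `-M` strictly positive ones.
  obtain ⟨M, hM⟩ : ∃ M, M = (n1 + n2 + n3 + 1) / (2 * c ^ 2) := ⟨_, rfl⟩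
  have hn1' : 0 ≤ n1 := hn1 ▸ abs_nonneg _
  have hn2' : 0 ≤ n2 := hn2 ▸ abs_nonneg _
  have hn3' : 0 ≤ n3 := hn3 ▸ abs_nonneg _
  have hM0 : 0 ≤ M := hM ▸ by positivity
  have hMc : 2 * c ^ 2 * M = n1 + n2 + n3 + 1 := by rw [hM]; field_simp
  obtain ⟨-, -, -, Q, hQ⟩ := exists_isSlowSolution (a := a) (M := M) hc
  obtain ⟨x₀, hx₀, hmono, q, hq⟩ := exists_isSlowSolution (a := a) (M := -M) hc
  have hU := hQ.isUpperPairAt hc hb hd0 hk' ha'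
    (by rw [residualPsi_zero]; linarith [le_abs_self (residualPsi a c k 0 0)])
    (by
      rw [residualPhi_zero]
      linarith [le_abs_self (residualPhi a b c d k (d ^ 2 * (8 * c / c ^ 3)) 0 0)])
  have hL := hq.isLowerPairAt hc hb hd0 hk' ha'
    (by rw [residualPsi_zero]; linarith [neg_abs_le (residualPsi a c k 0 0)])
    (by rw [residualPhi_zero]; linarith [neg_abs_le (residualPhi a b c d k 0 0 0)])
  have hle := hq.le hQ (by linarith) hx₀ hmono
  have hQ0 : Tendsto Q atBot (𝓝 0) := hQ.tendsto.mono_right nhdsWithin_le_nhds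
  rw [hd] at hU hL
  obtain ⟨φ, ψ, hp, h1, h2, h3, C, μ, hμ, hC⟩ := exists_profile_of_local one_pos le_rfl hb hc hh hβ
    (by rw [sub_self]; positivity) hnl hU hL
    (by
      filter_upwards [hle, hq.tendsto.eventually self_mem_nhdsWithin,
        hQ.eventually_of_continuous (f := fun x => -(3 * |k| * x)) (y := 1) (by fun_prop) (by simp),
        hQ.eventually_of_continuous (f := fun x => 6 * |k| * x) (y := 1) (by fun_prop) (by simp)]
        with t h1 h2 h3 h4
      have h2' : 0 < q t := h2
      have e : slowPhi b k Q t - slowPhi b k q t = (Q t - q t) / b *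
          ((Q t + q t) / 2 + k * (Q t ^ 2 + Q t * q t + q t ^ 2)) := by
        unfold slowPhi; field_simp; ring
      -- `slowPhi` is increasing in `q` for small `q`, even for negative `k`: the cubic contribution
      -- is dominated by `(Q + q) / 2`.
      have h5 : Q t ^ 2 + Q t * q t + q t ^ 2 ≤ 3 * (Q t * Q t) := by nlinarith
      have h6 : |k| * (Q t ^ 2 + Q t * q t + q t ^ 2) ≤ |k| * (3 * (Q t * Q t)) :=
        mul_le_mul_of_nonneg_left h5 (abs_nonneg k)
      have h8 := mul_le_mul_of_nonneg_right (neg_abs_le k)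
        (show 0 ≤ Q t ^ 2 + Q t * q t + q t ^ 2 by nlinarith)
      have h9 : 6 * |k| * Q t * Q t ≤ 1 * Q t := mul_le_mul_of_nonneg_right h4.le (by linarith)
      have : 0 ≤ slowPhi b k Q t - slowPhi b k q t := by
        rw [e]
        exact mul_nonneg (div_nonneg (by linarith) hb.le) (by linarith)
      linarith)
    hle
    (by
      unfold slowPhi
      simpa using ((hQ0.pow 2).div_const (2 * b)).add ((hQ0.pow 3).const_mul (k / b)))
    hQ0
    (by
      have hcb : 0 < c ^ 2 / b := by positivity
      filter_upwards [(hq.tendsto_sq_mul_slowPhi (k := k) hb).eventually_const_lt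
        (show c ^ 2 / b < 2 * c ^ 2 / b by rw [mul_div_assoc]; linarith),
        (tendsto_pow_mul_exp_atBot 2 (half_pos hc)).eventually_lt_const hcb] with t h1 h2
      exact (lt_of_mul_lt_mul_left (h2.trans h1) (sq_nonneg t)).le)
  have hμ0 : 0 < μ := by linarith
  have hexp : ∀ n : ℕ, (fun t => C * Real.exp (μ * t)) =O[atBot] fun t => 1 / t ^ n := fun n =>
    (isBigO_of_tendsto_pow_mul (tendsto_pow_mul_exp_atBot n hμ0)).const_mul_left C
  have hphi : ∀ {N : ℝ} {w : ℝ → ℝ}, IsSlowSolution a c N w →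
      (fun t => slowPhi b k w t - ((2 * c ^ 2 / b) / t ^ 2
        - 8 * c / (3 * b) * K * (Real.log (-t) / t ^ 3))) =O[atBot] fun t => 1 / t ^ 3 := by
    intro N w hw
    obtain ⟨l, hl⟩ := hw.tendsto_slowPhi (k := k) hc hb
    refine isBigO_of_tendsto_pow_mul (hl.congr' ?_)
    filter_upwards [eventually_lt_atBot 0] with t ht
    have ht' : t ≠ 0 := ht.ne
    rw [ha]
    field_simp
    ring
  have hpsi : ∀ {N : ℝ} {w : ℝ → ℝ}, IsSlowSolution a c N w →
      (fun t => w t - (-(2 * c / t) + 4 / 3 * K * (Real.log (-t) / t ^ 2)))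
        =O[atBot] fun t => 1 / t ^ 2 := by
    intro N w hw
    refine isBigO_of_tendsto_pow_mul ((hw.tendsto_asymptotics hc).congr' ?_)
    filter_upwards [eventually_lt_atBot 0] with t ht
    have ht' : t ≠ 0 := ht.ne
    rw [ha]
    field_simp
    ring
  refine ⟨φ, ψ, hp, h1, h2, h3, ?_, ?_⟩
  · rw [← hK]
    exact isBigO_sub_of_le_of_le (hC.mono fun t h => h.1) (hC.mono fun t h => h.2.1)
      (hphi hq) (hphi hQ) (hexp 3)
  · rw [← hK]
    refine (isBigO_sub_of_le_of_le (hC.mono fun t h => h.2.2.1) (hC.mono fun t h => h.2.2.2)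
      (hpsi hq) (hpsi hQ) (hexp 2)).neg_left.congr_left fun t => ?_
    ring

/-! ### The speed `2 √(1 - r)` as a limit of larger speeds. -/

section critical

variable {r b c d h β : ℝ} {φ ψ : ℝ → ℝ}

theorem green_comp_add (F : ℝ → ℝ) (τ t : ℝ) :
    green c β (fun s => F (s + τ)) t = green c β F (t + τ) := by
  have e1 : ∀ s : ℝ, t - s + τ = t + τ - s := fun s => by ring
  have e2 : ∀ s : ℝ, t + s + τ = t + τ + s := fun s => by ring
  simp only [green, e1, e2]

theorem IsProfile.comp_add (hp : IsProfile r b c d β φ ψ) (τ : ℝ) :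
    IsProfile r b c d β (fun t => φ (t + τ)) (fun t => ψ (t + τ)) := by
  have h1 := hp.cont_phi
  have h2 := hp.cont_psi
  have e : ∀ t, t - d + τ = t + τ - d := fun t => by ring
  refine ⟨by fun_prop, by fun_prop, fun s t hst => hp.mono_phi (by linarith),
    fun s t hst => hp.mono_psi (by linarith), fun t => hp.phi_nonneg _, fun t => hp.psi_nonneg _,
    fun t => hp.phi_le_one _, fun t => hp.psi_le_one _, fun t => ?_, fun t => ?_⟩
  · simp only [e]
    rw [green_comp_add (fun t => sourcePhi r β (φ t) (ψ (t - d)))]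
    exact hp.eq_phi _
  · rw [green_comp_add (fun t => sourcePsi b β (φ t) (ψ t))]
    exact hp.eq_psi _

/-- Compactness of the product of intervals over the rationals gives convergence there, and the
common Lipschitz constant extends it to every real point. -/
theorem exists_subseq_tendsto_of_lipschitz {f : ℕ → ℝ → ℝ} {L : ℝ}
    (hL : ∀ k t s, |f k t - f k s| ≤ L * |t - s|) (h0 : ∀ k t, 0 ≤ f k t) (h1 : ∀ k t, f k t ≤ 1) :
    ∃ n : ℕ → ℕ, StrictMono n ∧ ∃ g : ℝ → ℝ, ∀ t, Tendsto (fun k => f (n k) t) atTop (𝓝 (g t)) := by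
  have hL0 : 0 ≤ L := by simpa using (abs_nonneg _).trans (hL 0 1 0)
  obtain ⟨G, -, n, hn, hG⟩ := (isCompact_univ_pi fun _ : ℚ => isCompact_Icc (a := (0 : ℝ))
    (b := 1)).tendsto_subseq (x := fun k (x : ℚ) => f k x) (fun k x _ => ⟨h0 k x, h1 k x⟩)
  have hG' : ∀ x : ℚ, Tendsto (fun k => f (n k) x) atTop (𝓝 (G x)) := tendsto_pi_nhds.1 hG
  have hex : ∀ t, ∃ y, Tendsto (fun k => f (n k) t) atTop (𝓝 y) := fun t => by
    refine cauchySeq_tendsto_of_complete (Metric.cauchySeq_iff.2 fun ε hε => ?_)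
    obtain ⟨x, hx1, hx2⟩ := exists_rat_btwn (show t < t + ε / (3 * (L + 1)) by
      have : 0 < ε / (3 * (L + 1)) := by positivity
      linarith)
    obtain ⟨N, hN⟩ := Metric.cauchySeq_iff.1 (hG' x).cauchySeq (ε / 3) (by positivity)
    have hLx : L * |t - x| ≤ ε / 3 := by
      rw [abs_sub_comm, abs_of_pos (by linarith)]
      calc L * (x - t) ≤ (L + 1) * (ε / (3 * (L + 1))) := by gcongr <;> linarith
        _ = ε / 3 := by field_simp
    refine ⟨N, fun i hi j hj => ?_⟩
    have e1 := hN i hi j hj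
    have e2 := (hL (n i) t x).trans hLx
    have e3 := (hL (n j) t x).trans hLx
    rw [Real.dist_eq] at e1 ⊢
    rw [abs_lt] at e1 ⊢
    rw [abs_le] at e2 e3
    constructor <;> linarith [e1.1, e1.2, e2.1, e2.2, e3.1, e3.2]
  choose g hg using hex
  exact ⟨n, hn, g, hg⟩

/-- The second component of a profile is dominated by the first. -/
theorem IsProfile.psi_le_mul_phi (hp : IsProfile r b c (c * h) β φ ψ) (hr0 : 0 < r)
    (hr1 : r < 1) (hb : 0 < b) (hc : 0 ≤ c) (hβ : 2 + c + b ≤ β) (hφ : Tendsto φ atBot (𝓝 0))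
    (hψ : Tendsto ψ atBot (𝓝 0)) (hne : ∃ t, 0 < φ t) (t : ℝ) :
    ψ t ≤ 2 * max 1 b / (1 - r) * φ t := by
  have hβ0 : 0 < β := by linarith
  have hr : 0 < 1 - r := by linarith
  obtain ⟨K, hK⟩ : ∃ K, K = 2 * max 1 b / (1 - r) := ⟨_, rfl⟩
  have hKr : K * ((1 - r) / 2) = max 1 b := by rw [hK]; field_simp
  have hK0 : 0 < K := by rw [hK]; positivity
  rw [← hK]
  by_contra! hlt
  have c1 := hp.continuous_sourcePhi
  have c2 := hp.continuous_sourcePsi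
  have m1 := hp.abs_sourcePhi_le hr0 hr1.le (by linarith)
  have m2 := hp.abs_sourcePsi_le hb (by linarith)
  obtain ⟨φ1, hφ1⟩ : ∃ f, f = greenDeriv c β (fun t => sourcePhi r β (φ t) (ψ (t - c * h))) := ⟨_, rfl⟩
  obtain ⟨ψ1, hψ1⟩ : ∃ f, f = greenDeriv c β (fun t => sourcePsi b β (φ t) (ψ t)) := ⟨_, rfl⟩
  have d1 : ∀ t, HasDerivAt φ (φ1 t) t := fun t => by
    rw [hφ1]
    exact (hasDerivAt_green hβ0 c1 m1 t).congr_of_eventuallyEq (Eventually.of_forall hp.eq_phi)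
  have d2 : ∀ t, HasDerivAt ψ (ψ1 t) t := fun t => by
    rw [hψ1]
    exact (hasDerivAt_green hβ0 c2 m2 t).congr_of_eventuallyEq (Eventually.of_forall hp.eq_psi)
  have d3 : ∀ t, HasDerivAt φ1 (c * φ1 t + β * φ t
      - sourcePhi r β (φ t) (ψ (t - c * h))) t := fun t => by
    have := hasDerivAt_greenDeriv (c := c) hβ0 c1 m1 t
    rwa [← hp.eq_phi, ← hφ1] at this
  have d4 : ∀ t, HasDerivAt ψ1 (c * ψ1 t + β * ψ t - sourcePsi b β (φ t) (ψ t)) t := fun t => by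
    have := hasDerivAt_greenDeriv (c := c) hβ0 c2 m2 t
    rwa [← hp.eq_psi, ← hψ1] at this
  obtain ⟨w, hw⟩ : ∃ w, w = fun t => K * φ t - ψ t := ⟨_, rfl⟩
  have dw : ∀ t, HasDerivAt w (K * φ1 t - ψ1 t) t := fun t => by
    rw [hw]; exact ((d1 t).const_mul K).sub (d2 t)
  have hexp : ∀ t, HasDerivAt (fun t => Real.exp (-c * t)) (Real.exp (-c * t) * -c) t := fun t => by
    simpa using ((hasDerivAt_id t).const_mul (-c)).exp
  -- The factor `e^{-c t}` removes the first-order term, so `e^{-c t} w'` is non-increasing wherever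
  -- `φ ≤ (1 - r) / 2`.
  have dz : ∀ t, HasDerivAt (fun t => Real.exp (-c * t) * (K * φ1 t - ψ1 t))
      (Real.exp (-c * t) * (φ t * (b * (1 - ψ t) - K * (1 - r - φ t + r * ψ (t - c * h))))) t :=
    fun t => by
      refine ((hexp t).mul (((d3 t).const_mul K).sub (d4 t))).congr_deriv ?_
      unfold sourcePhi sourcePsi
      simp only [Pi.sub_apply]
      ring
  have hfront := hp.isPositiveMonotoneFront hr0 hr1.le hb hc hβ hφ hψ hne
  -- Where `φ ≥ (1 - r) / 2`, the choice of `K` gives `K φ ≥ 1 ≥ ψ`. A negative value of `w` must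
  -- occur further left.
  have hsmall : ∀ s, (1 - r) / 2 ≤ φ s → 0 ≤ w s := fun s hs => by
    have e1 : K * ((1 - r) / 2) ≤ K * φ s := mul_le_mul_of_nonneg_left hs hK0.le
    have e2 := le_max_left 1 b
    have e3 := hp.psi_le_one s
    rw [hw]; linarith
  have hwt : w t < 0 := by rw [hw]; linarith
  have hφt : φ t < (1 - r) / 2 := by
    by_contra! hle
    exact absurd (hsmall t hle) hwt.not_ge
  obtain ⟨u, hu⟩ := (hfront.phi_atTop.eventually_const_lt (show (1 - r) / 2 < 1 by linarith)).exists
  have htu : t ≤ u := by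
    by_contra! h
    exact absurd (hp.mono_phi h.le) (by linarith)
  obtain ⟨τ, hτ, hφτ⟩ := intermediate_value_Icc htu hp.cont_phi.continuousOn ⟨hφt.le, hu.le⟩
  have hwlim : Tendsto w atBot (𝓝 0) := by
    rw [hw]; simpa using (hφ.const_mul K).sub hψ
  obtain ⟨s₀, hs₀, hs₀t⟩ := ((hwlim.eventually_const_lt hwt).and (eventually_lt_atBot t)).exists
  obtain ⟨s, hs, hs'⟩ := exists_hasDerivAt_eq_slope w (fun t => K * φ1 t - ψ1 t) hs₀t
    (fun s _ => (dw s).continuousAt.continuousWithinAt) (fun s _ => dw s)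
  have hsneg : K * φ1 s - ψ1 s < 0 := by
    rw [hs']; exact div_neg_of_neg_of_pos (by linarith) (by linarith)
  have hanti : AntitoneOn (fun t => Real.exp (-c * t) * (K * φ1 t - ψ1 t)) (Icc s τ) := by
    refine antitoneOn_of_hasDerivWithinAt_nonpos (convex_Icc s τ)
      (fun x _ => (dz x).continuousAt.continuousWithinAt)
      (fun x _ => (dz x).hasDerivWithinAt) (fun x hx => ?_)
    have hx' : φ x ≤ (1 - r) / 2 := hφτ ▸ hp.mono_phi (interior_subset hx).2
    have e1 : K * ((1 - r) / 2) ≤ K * (1 - r - φ x + r * ψ (x - c * h)) :=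
      mul_le_mul_of_nonneg_left (by linarith [mul_nonneg hr0.le (hp.psi_nonneg (x - c * h))]) hK0.le
    have e2 := le_max_right 1 b
    have e3 := mul_nonneg hb.le (hp.psi_nonneg x)
    exact mul_nonpos_of_nonneg_of_nonpos (Real.exp_pos _).le
      (mul_nonpos_of_nonneg_of_nonpos (hp.phi_nonneg x) (by linarith))
  have hsτ : s ≤ τ := hs.2.le.trans hτ.1
  have hneg : ∀ x ∈ Icc s τ, K * φ1 x - ψ1 x ≤ 0 := fun x hx => by
    have e1 := hanti (left_mem_Icc.2 hsτ) hx hx.1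
    have e2 := mul_neg_of_pos_of_neg (Real.exp_pos (-c * s)) hsneg
    exact (neg_of_mul_neg_right (e1.trans_lt e2) (Real.exp_pos _).le).le
  have hwanti : AntitoneOn w (Icc s τ) :=
    antitoneOn_of_hasDerivWithinAt_nonpos (convex_Icc s τ)
      (fun x _ => (dw x).continuousAt.continuousWithinAt)
      (fun x _ => (dw x).hasDerivWithinAt) (fun x hx => hneg x (interior_subset hx))
  have := hwanti ⟨hs.2.le, hτ.1⟩ (right_mem_Icc.2 hsτ) hτ.1
  linarith [hsmall τ hφτ.ge]

/-- Profiles are closed under pointwise limits in which the speed varies. -/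
theorem IsProfile.of_tendsto {cs : ℕ → ℝ} {C : ℝ} {φs ψs : ℕ → ℝ → ℝ} (hr0 : 0 < r) (hr1 : r ≤ 1)
    (hb : 0 < b) (hc0 : ∀ k, 0 ≤ cs k) (hcC : ∀ k, cs k ≤ C) (hβ : 2 + C + b ≤ β)
    (hp : ∀ k, IsProfile r b (cs k) (cs k * h) β (φs k) (ψs k)) (hc : Tendsto cs atTop (𝓝 c))
    (hφ : ∀ t, Tendsto (fun k => φs k t) atTop (𝓝 (φ t)))
    (hψ : ∀ t, Tendsto (fun k => ψs k t) atTop (𝓝 (ψ t))) : IsProfile r b c (c * h) β φ ψ := by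
  have hC : 0 ≤ C := (hc0 0).trans (hcC 0)
  have hβ0 : 0 < β := by linarith
  have hlip := fun k t s => (hp k).lipschitz hr0 hr1 hb (hc0 k) (by linarith [hcC k]) t s
  have hφL : ∀ t s, |φ t - φ s| ≤ β * |t - s| := fun t s =>
    le_of_tendsto ((hφ t).sub (hφ s)).abs (Eventually.of_forall fun k => (hlip k t s).1)
  have hψL : ∀ t s, |ψ t - ψ s| ≤ β * |t - s| := fun t s =>
    le_of_tendsto ((hψ t).sub (hψ s)).abs (Eventually.of_forall fun k => (hlip k t s).2)
  -- The delay `c h` moves with the speed; the common Lipschitz bound controls this shift.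
  have hdelay : ∀ t, Tendsto (fun k => ψs k (t - cs k * h)) atTop (𝓝 (ψ (t - c * h))) := fun t => by
    have h1 : Tendsto (fun k => ψs k (t - cs k * h) - ψs k (t - c * h)) atTop (𝓝 0) := by
      refine squeeze_zero_norm (a := fun k => β * |t - cs k * h - (t - c * h)|)
        (fun k => (hlip k _ _).2) ?_
      have := (((hc.mul_const h).const_sub t).sub_const (t - c * h)).abs.const_mul β
      simpa using this
    simpa using h1.add (hψ (t - c * h))
  refine ⟨continuous_of_abs_sub_le hφL, continuous_of_abs_sub_le hψL,
    fun s t hst => le_of_tendsto_of_tendsto' (hφ s) (hφ t) fun k => (hp k).mono_phi hst,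
    fun s t hst => le_of_tendsto_of_tendsto' (hψ s) (hψ t) fun k => (hp k).mono_psi hst,
    fun t => ge_of_tendsto' (hφ t) fun k => (hp k).phi_nonneg t,
    fun t => ge_of_tendsto' (hψ t) fun k => (hp k).psi_nonneg t,
    fun t => le_of_tendsto' (hφ t) fun k => (hp k).phi_le_one t,
    fun t => le_of_tendsto' (hψ t) fun k => (hp k).psi_le_one t, fun t => ?_, fun t => ?_⟩
  · refine tendsto_nhds_unique (hφ t) ?_
    refine (tendsto_green (M := β) (c := cs) (t := fun _ => t) (t₁ := t)
      (F := fun k t => sourcePhi r β (φs k t) (ψs k (t - cs k * h)))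
      (F₁ := fun t => sourcePhi r β (φ t) (ψ (t - c * h))) hβ0 hc0 hcC hc
      (fun k => (hp k).continuous_sourcePhi)
      (fun k => (hp k).abs_sourcePhi_le hr0 hr1 (by linarith)) (fun s => ?_)).congr
      fun k => ((hp k).eq_phi t).symm
    exact (hφ _).mul (((hφ _).const_sub _).add ((hdelay _).const_mul r))
  · refine tendsto_nhds_unique (hψ t) ?_
    refine (tendsto_green (M := β) (c := cs) (t := fun _ => t) (t₁ := t)
      (F := fun k t => sourcePsi b β (φs k t) (ψs k t))
      (F₁ := fun t => sourcePsi b β (φ t) (ψ t)) hβ0 hc0 hcC hc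
      (fun k => (hp k).continuous_sourcePsi)
      (fun k => (hp k).abs_sourcePsi_le hb (by linarith)) (fun s => ?_)).congr
      fun k => ((hp k).eq_psi t).symm
    exact ((hψ _).const_mul β).add (((hφ _).const_mul b).mul ((hψ _).const_sub 1))

/-- Fronts at the limit of a decreasing family of admissible speeds. -/
theorem exists_profile_critical (hr0 : 0 < r) (hr1 : r < 1) (hb : 0 < b) (hc : 0 < c) (hh : 0 ≤ h)
    (hβ : 3 + c + b ≤ β) (hlin : ∀ c' > c, 1 - r < c' ^ 2 / 4)
    (hnl : ∀ c' > c, 1 ≤ c' ^ 2 / 4 * (1 + 1 / bPrime b h c')) :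
    ∃ φ ψ : ℝ → ℝ, IsProfile r b c (c * h) β φ ψ ∧ Tendsto φ atBot (𝓝 0) ∧ Tendsto ψ atBot (𝓝 0) ∧
      ∃ t, 0 < φ t := by
  obtain ⟨K, hK⟩ : ∃ K, K = 2 * max 1 b / (1 - r) := ⟨_, rfl⟩
  -- Translation to `φ 0 = 1 / 2` keeps the limit nontrivial. The extra unit in `β` lets one value
  -- serve all speeds up to `c + 1`.
  have hstep : ∀ c', c < c' → c' ≤ c + 1 → ∃ φ ψ : ℝ → ℝ, IsProfile r b c' (c' * h) β φ ψ ∧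
      φ 0 = 1 / 2 ∧ ∀ t, ψ t ≤ K * φ t := by
    intro c' hc' hc1
    have hc'0 : 0 < c' := hc.trans hc'
    obtain ⟨φ, ψ, hp, h1, h2, h3, -⟩ := exists_profile_exponential hr0 hr1 hb hc'0 hh
      (β := β) (by linarith) (hlin c' hc') (hnl c' hc')
    have hβ' : 2 + c' + b ≤ β := by linarith
    have hf := hp.isPositiveMonotoneFront hr0 hr1.le hb hc'0.le hβ' h1 h2 h3
    obtain ⟨x, hx⟩ := (hf.phi_atBot.eventually_lt_const one_half_pos).exists
    obtain ⟨y, hy⟩ := (hf.phi_atTop.eventually_const_lt one_half_lt_one).exists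
    obtain ⟨τ, hτ⟩ := mem_range_of_exists_le_of_exists_ge hp.cont_phi ⟨x, hx.le⟩ ⟨y, hy.le⟩
    exact ⟨_, _, hp.comp_add τ, by simpa using hτ, fun t => hK ▸
      hp.psi_le_mul_phi hr0 hr1 hb hc'0.le hβ' h1 h2 h3 _⟩
  have hstep' : ∀ k : ℕ, ∃ φ ψ : ℝ → ℝ, IsProfile r b (c + 1 / ((k : ℝ) + 1))
      ((c + 1 / ((k : ℝ) + 1)) * h) β φ ψ ∧ φ 0 = 1 / 2 ∧ ∀ t, ψ t ≤ K * φ t := fun k => by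
    have h1 : 0 < 1 / ((k : ℝ) + 1) := by positivity
    have h2 : 1 / ((k : ℝ) + 1) ≤ 1 := by
      rw [div_le_one (by positivity)]
      linarith [(Nat.cast_nonneg k : (0 : ℝ) ≤ k)]
    exact hstep _ (by linarith) (by linarith)
  choose φs ψs hp h0 hle using hstep'
  have hk0 : ∀ k : ℕ, 0 ≤ c + 1 / ((k : ℝ) + 1) := fun k => by positivity
  have hk1 : ∀ k : ℕ, c + 1 / ((k : ℝ) + 1) ≤ c + 1 := fun k => by
    gcongr
    rw [div_le_one (by positivity)]
    linarith [(Nat.cast_nonneg k : (0 : ℝ) ≤ k)]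
  have hlip := fun k t s => (hp k).lipschitz hr0 hr1.le hb (hk0 k) (by linarith [hk1 k]) t s
  obtain ⟨n, hn, φ, hφ⟩ := exists_subseq_tendsto_of_lipschitz (fun k t s => (hlip k t s).1)
    (fun k => (hp k).phi_nonneg) (fun k => (hp k).phi_le_one)
  obtain ⟨m, hm, ψ, hψ⟩ := exists_subseq_tendsto_of_lipschitz (fun k t s => (hlip (n k) t s).2)
    (fun k => (hp (n k)).psi_nonneg) (fun k => (hp (n k)).psi_le_one)
  have hφ' : ∀ t, Tendsto (fun k => φs (n (m k)) t) atTop (𝓝 (φ t)) := fun t =>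
    (hφ t).comp hm.tendsto_atTop
  have hlim : Tendsto (fun k => c + 1 / ((n (m k) : ℝ) + 1)) atTop (𝓝 c) := by
    have := (tendsto_one_div_add_atTop_nhds_zero_nat (𝕜 := ℝ)).comp
      (hn.tendsto_atTop.comp hm.tendsto_atTop)
    simpa using this.const_add c
  have hP : IsProfile r b c (c * h) β φ ψ := IsProfile.of_tendsto hr0 hr1.le hb
    (fun k => hk0 (n (m k))) (fun k => hk1 (n (m k))) (by linarith) (fun k => hp (n (m k))) hlim hφ' hψ
  have hφ0 : φ 0 = 1 / 2 := tendsto_nhds_unique (hφ 0)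
    (tendsto_const_nhds.congr fun k => (h0 (n k)).symm)
  have hψφ : ∀ t, ψ t ≤ K * φ t := fun t =>
    le_of_tendsto_of_tendsto' (hψ t) ((hφ' t).const_mul K) fun k => hle _ t
  have hx := tendsto_atBot_ciInf hP.mono_phi ⟨0, by rintro _ ⟨t, rfl⟩; exact hP.phi_nonneg t⟩
  have hy := tendsto_atBot_ciInf hP.mono_psi ⟨0, by rintro _ ⟨t, rfl⟩; exact hP.psi_nonneg t⟩
  generalize ⨅ t, φ t = x at hx
  generalize ⨅ t, ψ t = y at hy
  obtain ⟨e1, e2⟩ := hP.limit_eq hr0 hr1.le hb hc.le (by linarith)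
    (fun s => tendsto_atBot_add_const_right _ s tendsto_id) hx hy
  -- An equilibrium with `x ≠ 0` would have `y = 1` and hence `x = 1`, which the normalization
  -- excludes. Then `x = 0`, and `ψ ≤ K φ` gives `y = 0`.
  have hx2 : x ≤ 1 / 2 := le_of_tendsto hx ((eventually_le_atBot 0).mono fun t ht =>
    hφ0 ▸ hP.mono_phi ht)
  have hx0 : x = 0 := by
    by_contra hne
    rcases mul_eq_zero.1 e1 with e | e
    · exact hne e
    · rcases mul_eq_zero.1 e2 with e' | e'
      · rcases mul_eq_zero.1 e' with e'' | e''
        · exact hb.ne' e''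
        · exact hne e''
      · have hy1 : y = 1 := by linarith
        rw [hy1] at e
        linarith
  have hy0 : y = 0 := by
    refine le_antisymm ?_ (ge_of_tendsto' hy hP.psi_nonneg)
    have := le_of_tendsto_of_tendsto' hy (hx.const_mul K) hψφ
    rwa [hx0, mul_zero] at this
  exact ⟨φ, ψ, hP, hx0 ▸ hx, hy0 ▸ hy, 0, by rw [hφ0]; norm_num⟩

end critical

/-! ### The equation for the critical speed. -/

section speed

variable {r b h c c' cs : ℝ}

/-- Half of the right-hand side of the equation for the critical speed. -/
noncomputable def sharpRate (r b h c : ℝ) : ℝ :=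
  max (√(1 - r)) (√(bPrime b h c) / √(1 + bPrime b h c))

theorem bPrime_pos (hb : 0 < b) : 0 < bPrime b h c := mul_pos hb (Real.exp_pos _)

theorem sqrt_bPrime_div (hb : 0 < b) :
    √(bPrime b h c) / √(1 + bPrime b h c) = √(bPrime b h c / (1 + bPrime b h c)) :=
  (Real.sqrt_div (bPrime_pos hb).le _).symm

theorem sharpRate_anti (hb : 0 < b) (hh : 0 ≤ h) (hc : 0 ≤ c) (hcc : c ≤ c') :
    sharpRate r b h c' ≤ sharpRate r b h c := by
  have h1 : bPrime b h c' ≤ bPrime b h c := by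
    unfold bPrime
    gcongr
  have h0 := bPrime_pos (h := h) (c := c') hb
  have h0' := bPrime_pos (h := h) (c := c) hb
  unfold sharpRate
  refine max_le_max le_rfl ?_
  rw [sqrt_bPrime_div hb, sqrt_bPrime_div hb]
  refine Real.sqrt_le_sqrt ?_
  rw [div_le_div_iff₀ (by linarith) (by linarith)]
  linarith

theorem continuous_sharpRate (hb : 0 < b) : Continuous (sharpRate r b h) := by
  have h1 : Continuous (bPrime b h) := by unfold bPrime; fun_prop
  unfold sharpRate
  refine continuous_const.max (h1.sqrt.div (continuous_const.add h1).sqrt fun c => ?_)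
  have := bPrime_pos (h := h) (c := c) hb
  positivity

theorem sharpRate_pos (hb : 0 < b) : 0 < sharpRate r b h c := by
  have := bPrime_pos (h := h) (c := c) hb
  exact lt_max_of_lt_right (by positivity)

theorem sharpRate_le_one (hr0 : 0 < r) (hb : 0 < b) : sharpRate r b h c ≤ 1 := by
  have := bPrime_pos (h := h) (c := c) hb
  refine max_le (Real.sqrt_le_one.2 (by linarith)) ?_
  rw [sqrt_bPrime_div hb, Real.sqrt_le_one, div_le_one (by linarith)]
  linarith

/-- The right-hand side is continuous and non-increasing in `c ≥ 0`, with values in `(0, 2]`, so it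
meets the strictly increasing left-hand side exactly once. -/
theorem existsUnique_isPositiveRootSharp (hr0 : 0 < r) (hb : 0 < b) (hh : 0 ≤ h) :
    ∃! cs : ℝ, IsPositiveRootSharp r b h cs := by
  have hcont : Continuous fun c => c - 2 * sharpRate r b h c :=
    continuous_id.sub ((continuous_sharpRate hb).const_mul 2)
  obtain ⟨c, hc, h0⟩ := intermediate_value_Icc (a := 0) (b := 2) (by norm_num) hcont.continuousOn
    (show (0 : ℝ) ∈ Icc _ _ from ⟨by linarith [sharpRate_pos (r := r) (h := h) (c := 0) hb],
      by linarith [sharpRate_le_one (h := h) (c := 2) hr0 hb]⟩)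
  refine ⟨c, ⟨?_, sub_eq_zero.1 h0⟩, fun c' hc' => ?_⟩
  · linarith [sharpRate_pos (r := r) (h := h) (c := c) hb]
  · have h1 : c' = 2 * sharpRate r b h c' := hc'.2
    rcases le_total c c' with h | h
    · linarith [sharpRate_anti (r := r) hb hh hc.1 h]
    · linarith [sharpRate_anti (r := r) hb hh hc'.1.le h]

/-- Monotonicity propagates `sharpRate ≤ c / 2` to all larger speeds; squaring the two entries of
the maximum gives the two conditions on the upper solution. -/
theorem IsPositiveRootSharp.le_of_le (hcs : IsPositiveRootSharp r b h cs)
    (hb : 0 < b) (hh : 0 ≤ h) (hc : cs ≤ c) :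
    1 - r ≤ c ^ 2 / 4 ∧ 1 ≤ c ^ 2 / 4 * (1 + 1 / bPrime b h c) := by
  have h0 := hcs.1
  have h1 : cs = 2 * sharpRate r b h cs := hcs.2
  have h2 : sharpRate r b h c ≤ c / 2 := by linarith [sharpRate_anti (r := r) hb hh h0.le hc]
  have h3 := bPrime_pos (h := h) (c := c) hb
  unfold sharpRate at h2
  rw [sqrt_bPrime_div hb, max_le_iff, Real.sqrt_le_left (by linarith),
    Real.sqrt_le_left (by linarith)] at h2
  obtain ⟨h4, h5⟩ := h2
  refine ⟨by linarith, ?_⟩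
  rw [div_le_iff₀ (by linarith)] at h5
  have e : c ^ 2 / 4 * (1 + 1 / bPrime b h c) = c ^ 2 / 4 * (1 + bPrime b h c) / bPrime b h c := by
    field_simp
    ring
  rw [e, le_div_iff₀ h3]
  linarith

end speed

end BZFronts

/-! ### Assembly of the cases. -/

theorem theorem7 (r b h : ℝ) (hr0 : 0 < r) (hr1 : r ≤ 1) (hb : 0 < b) (hh : 0 ≤ h) :
    (∃! cs : ℝ, IsPositiveRootSharp r b h cs) ∧
    ∀ cs c : ℝ, IsPositiveRootSharp r b h cs → cs ≤ c →
      ∃ φ θ : ℝ → ℝ, IsPositiveMonotoneFront r b h c φ θ ∧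
        (r = 1 → cs < c → HasAlgebraicAsymptotics b h c φ θ) ∧
        (r < 1 → 2 * √(1 - r) < c → HasExponentialAsymptotics r b c φ θ) := by
  refine ⟨existsUnique_isPositiveRootSharp hr0 hb hh, fun cs c hcs hc => ?_⟩
  have hc0 : 0 < c := hcs.1.trans_le hc
  obtain ⟨hlin, hnl⟩ := hcs.le_of_le hb hh hc
  rcases hr1.eq_or_lt with rfl | hr1'
  -- For `r = 1` the linear condition is just `0 < c² / 4`, so the construction covers `c = c_#` as
  -- well and no limit is needed.
  · obtain ⟨φ, ψ, hp, h1, h2, h3, h4⟩ := exists_profile_algebraic hb hc0 hh le_rfl hnl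
    exact ⟨φ, _, hp.isPositiveMonotoneFront hr0 hr1 hb hc0.le le_rfl h1 h2 h3, fun _ _ => h4,
      fun h => absurd h (lt_irrefl _)⟩
  · by_cases hcr : 2 * √(1 - r) < c
    · have hlin' : 1 - r < c ^ 2 / 4 := by
        have := (Real.sqrt_lt' (half_pos hc0)).1 (show √(1 - r) < c / 2 by linarith)
        linarith
      obtain ⟨φ, ψ, hp, h1, h2, h3, h4⟩ :=
        exists_profile_exponential hr0 hr1' hb hc0 hh le_rfl hlin' hnl
      exact ⟨φ, _, hp.isPositiveMonotoneFront hr0 hr1 hb hc0.le le_rfl h1 h2 h3,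
        fun h => absurd h hr1'.ne, fun _ _ => h4⟩
    -- Here `hlin` forces `c = 2 √(1 - r)`, and both conditions hold, the linear one strictly, for
    -- every larger speed.
    · obtain ⟨φ, ψ, hp, h1, h2, h3⟩ := exists_profile_critical hr0 hr1' hb hc0 hh le_rfl
        (fun c' hc' => by nlinarith)
        (fun c' hc' => (hcs.le_of_le hb hh (hc.trans hc'.le)).2)
      exact ⟨φ, _, hp.isPositiveMonotoneFront hr0 hr1 hb hc0.le (by linarith) h1 h2 h3,
        fun h => absurd h hr1'.ne, fun _ h => absurd h hcr⟩
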